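/- Let $p$ be a prime and let $\mathcal F$ be a saturated fusion system over a finite $p$-group $S$. For a saturated fusion system $\mathcal E$ over a finite $p$-group $T$, let $O_p(\mathcal E)\trianglelefteq T$ be the largest subgroup normal in $\mathcal E$; let $\mathfrak{hyp}(\mathcal E)=\langle s^{-1}\alpha(s) : s\in P\le T,\ \alpha\in O^p(\mathrm{Aut}_{\mathcal E}(P))\rangle$; let $O^p(\mathcal E)$ be the smallest saturated fusion subsystem $\mathcal E'\subseteq\mathcal E$ over $\mathfrak{hyp}(\mathcal E)$ of $p$-power index (that is, $\mathrm{Aut}_{\mathcal E'}(P)\ge O^p(\mathrm{Aut}_{\mathcal E}(P))$ for all $P\le\mathfrak{hyp}(\mathcal E)$); and let $O^{p'}(\mathcal E)$ be the smallest saturated fusion subsystem $\mathcal E'\subseteq\mathcal E$ over $T$ of index prime to $p$ (that is, $\mathrm{Aut}_{\mathcal E'}(P)\ge O^{p'}(\mathrm{Aut}_{\mathcal E}(P))$ for all $P\le T$). Set $Q=O_p(\mathcal F)$ and $\mathcal F_0=C_{\mathcal F}(Q)/Z(Q)$, a fusion system over $C_S(Q)/Z(Q)$. (1) Let $\mathcal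 F_0\supseteq\mathcal F_1\supseteq\cdots\supseteq\mathcal F_m$ be such that $\mathcal F_i=O^p(\mathcal F_{i-1})$ if $i$ is odd, $\mathcal F_i=O^{p'}(\mathcal F_{i-1})$ if $i$ is even, and $O^p(\mathcal F_m)=O^{p'}(\mathcal F_m)=\mathcal F_m$. Then the reduction $\mathrm{red}(\mathcal F)=\mathcal F_m$ of $\mathcal F$ is reduced: it is saturated, it has no nontrivial normal $p$-subgroup, no proper normal fusion subsystem of $p$-power index, and no proper normal fusion subsystem of index prime to $p$. (2) More generally, let $\mathcal F_0\supseteq\mathcal F_1\supseteq\cdots\supseteq\mathcal F_m$ be such that for each $1\le i\le m$, $\mathcal F_i=O^p(\mathcal F_{i-1})$ or $\mathcal F_i=O^{p'}(\mathcal F_{i-1})$. Then $\mathcal F_i$ is saturated and $O_p(\mathcal F_i)=1$ for each $0\le i\le m$. -/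

import Mathlib

/-- `O^p(A)`: the smallest normal subgroup of `A` of `p`-power index (for `A` finite). -/
def pResidual (p : ℕ) (A : Type*) [Group A] : Subgroup A :=
  sInf {N : Subgroup A | N.Normal ∧ ∃ k : ℕ, N.index = p ^ k}

/-- `O^{p'}(A)`: the smallest normal subgroup of `A` of index prime to `p` (for `A` finite). -/
def pPrimeResidual (p : ℕ) (A : Type*) [Group A] : Subgroup A :=
  sInf {N : Subgroup A | N.Normal ∧ N.index.Coprime p}

/-- Conjugation `c_g : x ↦ g x g⁻¹`, restricted to a subgroup `P`. -/
def conjHom {G : Type*} [Group G] (g : G) (P : Subgroup G) : P →* G :=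
  (MulAut.conj g).toMonoidHom.comp P.subtype

/-- `φ'`, defined on `P'`, agrees with `φ`, defined on `P`, wherever both are defined.  For
`P ≤ P'` this says that `φ'` extends `φ`. -/
def Extends {G : Type*} [Group G] {P' P : Subgroup G} (φ' : P' →* G) (φ : P →* G) : Prop :=
  ∀ (x : G) (h : x ∈ P) (h' : x ∈ P'), φ' ⟨x, h'⟩ = φ ⟨x, h⟩

/-- A fusion system over the group `carrier`, which is a subgroup of an ambient group `G`.
`Mor P` is the set `Hom_F(P, carrier)`.  Since each morphism is an isomorphism in `F` followed by
an inclusion, `Hom_F(P, Q)` consists of the morphisms in `Mor P` with image in `Q`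
(see `FusionSystem.Hom`), so these sets determine the category. -/
@[ext]
structure FusionSystem (G : Type*) [Group G] where
  /-- The underlying group of the fusion system. -/
  carrier : Subgroup G
  /-- The morphisms from `P` to `carrier`. -/
  Mor : (P : Subgroup G) → Set (P →* G)
  dom_le : ∀ {P : Subgroup G} {φ : P →* G}, φ ∈ Mor P → P ≤ carrier
  range_le : ∀ {P : Subgroup G} {φ : P →* G}, φ ∈ Mor P → φ.range ≤ carrier
  injective : ∀ {P : Subgroup G} {φ : P →* G}, φ ∈ Mor P → Function.Injective φ
  conj_mem : ∀ {P : Subgroup G} {g : G}, P ≤ carrier → g ∈ carrier → conjHom g P ∈ Mor P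
  comp_mem : ∀ {P Q : Subgroup G} {φ : P →* G} {ψ : Q →* G} (h : ∀ x, φ x ∈ Q),
    φ ∈ Mor P → ψ ∈ Mor Q → ψ.comp (φ.codRestrict Q h) ∈ Mor P
  inv_mem : ∀ {P : Subgroup G} {φ : P →* G}, φ ∈ Mor P →
    ∃ ψ ∈ Mor φ.range, ∀ x : P, ψ ⟨φ x, x, rfl⟩ = (x : G)

namespace FusionSystem

variable {G : Type*} [Group G]

/-- `Hom_F(P, Q)`, each morphism being composed with the inclusion of `Q`. -/
def Hom (F : FusionSystem G) (P Q : Subgroup G) : Set (P →* G) :=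
  {φ | φ ∈ F.Mor P ∧ φ.range ≤ Q ∧ Q ≤ F.carrier}

/-- Inclusion of fusion subsystems. -/
instance : PartialOrder (FusionSystem G) where
  le E F := E.carrier ≤ F.carrier ∧ ∀ P, E.Mor P ⊆ F.Mor P
  le_refl F := ⟨le_rfl, fun _ => subset_rfl⟩
  le_trans A B C h h' := ⟨h.1.trans h'.1, fun P => (h.2 P).trans (h'.2 P)⟩
  le_antisymm A B h h' := FusionSystem.ext (le_antisymm h.1 h'.1)
    (funext fun P => Set.Subset.antisymm (h.2 P) (h'.2 P))

theorem inv_mem' (F : FusionSystem G) {P Q : Subgroup G} {φ : P →* G} (hφ : φ ∈ F.Mor P)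
    (hQ : φ.range = Q) :
    ∃ ψ ∈ F.Mor Q, ∀ (x : P) (h : φ x ∈ Q), ψ ⟨φ x, h⟩ = (x : G) := by
  subst hQ
  obtain ⟨ψ, h, h'⟩ := F.inv_mem hφ
  exact ⟨ψ, h, fun x _ => h' x⟩

theorem subtype_mem (F : FusionSystem G) {P : Subgroup G} (hP : P ≤ F.carrier) :
    P.subtype ∈ F.Mor P := by
  have h := F.conj_mem hP F.carrier.one_mem
  have e : conjHom 1 P = P.subtype := by
    ext x
    simp [conjHom]
  rwa [e] at h

/-- `P` and `P'` are isomorphic as objects of the category `F`. -/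
def IsConj (F : FusionSystem G) (P P' : Subgroup G) : Prop :=
  ∃ φ ∈ F.Mor P, φ.range = P'

/-- The group `Aut_F(P)`. -/
def aut (F : FusionSystem G) (P : Subgroup G) (hP : P ≤ F.carrier) : Subgroup (MulAut P) where
  carrier := {α | P.subtype.comp α.toMonoidHom ∈ F.Mor P}
  one_mem' := F.subtype_mem hP
  mul_mem' {a b} ha hb :=
    F.comp_mem (φ := P.subtype.comp b.toMonoidHom) (fun x => (b x).2) hb ha
  inv_mem' {a} ha := by
    have hr : (P.subtype.comp a.toMonoidHom).range = P := by
      ext x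
      constructor
      · rintro ⟨y, rfl⟩
        exact (a y).2
      · intro hx
        exact ⟨a.symm ⟨x, hx⟩, by simp⟩
    obtain ⟨ψ, h, h'⟩ := F.inv_mem' ha hr
    have e : P.subtype.comp (a⁻¹ : MulAut P).toMonoidHom = ψ := by
      ext x
      have := h' (a.symm x) (by simp)
      simp at this
      exact this.symm
    rw [← e] at h
    exact h

/-- The group `Aut_S(P)` of automorphisms of `P` induced by conjugation by elements of `N_S(P)`,
where `S` is the underlying group of `F`. -/
def autConj (F : FusionSystem G) (P : Subgroup G) : Subgroup (MulAut P) :=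
  (F.carrier.subgroupOf (Subgroup.normalizer (P : Set G))).map P.normalizerMonoidHom

/-! ### Saturation -/

def IsFullyCentralized (F : FusionSystem G) (P : Subgroup G) : Prop :=
  P ≤ F.carrier ∧ ∀ P' : Subgroup G, F.IsConj P P' →
    Nat.card ↥(Subgroup.centralizer (P' : Set G) ⊓ F.carrier) ≤
      Nat.card ↥(Subgroup.centralizer (P : Set G) ⊓ F.carrier)

def IsFullyNormalized (F : FusionSystem G) (P : Subgroup G) : Prop :=
  P ≤ F.carrier ∧ ∀ P' : Subgroup G, F.IsConj P P' →
    Nat.card ↥(Subgroup.normalizer (P' : Set G) ⊓ F.carrier) ≤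
      Nat.card ↥(Subgroup.normalizer (P : Set G) ⊓ F.carrier)

/-- The subgroup `N_φ` of those `g ∈ N_S(P)` for which `φ c_g φ⁻¹` is conjugation by an element
`h` of `S` on `φ(P)`.  (Such an `h` normalizes `φ(P)`.) -/
def extGroup (F : FusionSystem G) {P : Subgroup G} (φ : P →* G) : Subgroup G where
  carrier := {g | g ∈ F.carrier ∧ ∃ hg : g ∈ Subgroup.normalizer (P : Set G),
    ∃ h ∈ F.carrier, ∀ x : P,
      φ ⟨g * x * g⁻¹, (Subgroup.mem_normalizer_iff.1 hg x).1 x.2⟩ = h * φ x * h⁻¹}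
  one_mem' := ⟨F.carrier.one_mem, Subgroup.one_mem _, 1, F.carrier.one_mem, fun x => by simp⟩
  mul_mem' := by
    rintro a b ⟨ha, ha', h, hh, H⟩ ⟨hb, hb', k, hk, K⟩
    refine ⟨F.carrier.mul_mem ha hb, Subgroup.mul_mem _ ha' hb', h * k,
      F.carrier.mul_mem hh hk, fun x => ?_⟩
    have h1 := H ⟨b * x * b⁻¹, (Subgroup.mem_normalizer_iff.1 hb' x).1 x.2⟩
    rw [K x] at h1
    simp only [mul_assoc, mul_inv_rev] at h1 ⊢
    exact h1
  inv_mem' := by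
    rintro a ⟨ha, ha', h, hh, H⟩
    have ha'' := Subgroup.inv_mem _ ha'
    refine ⟨F.carrier.inv_mem ha, ha'', h⁻¹, F.carrier.inv_mem hh, fun x => ?_⟩
    have h1 := H ⟨a⁻¹ * x * a⁻¹⁻¹, (Subgroup.mem_normalizer_iff.1 ha'' x).1 x.2⟩
    have e : (⟨a * (a⁻¹ * (x : G) * a⁻¹⁻¹) * a⁻¹, (Subgroup.mem_normalizer_iff.1 ha' _).1
        ((Subgroup.mem_normalizer_iff.1 ha'' x).1 x.2)⟩ : P) = x := by
      ext
      simp [mul_assoc]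
    rw [e] at h1
    rw [h1]
    simp [mul_assoc]

/-- Saturation, for a fusion system over a finite `p`-group. -/
structure IsSaturated (p : ℕ) (F : FusionSystem G) : Prop where
  fullyCentralized : ∀ P : Subgroup G, F.IsFullyNormalized P → F.IsFullyCentralized P
  sylow : ∀ (P : Subgroup G) (hP : P ≤ F.carrier), F.IsFullyNormalized P →
    ∃ R : Sylow p (F.aut P hP), (R : Subgroup (F.aut P hP)).map (F.aut P hP).subtype = F.autConj P
  extension : ∀ (P : Subgroup G) (φ : P →* G), φ ∈ F.Mor P → F.IsFullyCentralized φ.range →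
    ∃ φ' ∈ F.Mor (F.extGroup φ), Extends φ' φ

/-! ### Normal subgroups, and `O_p(F)` -/

/-- `P` is normal in `F`: it is normal in `S`, and each morphism `φ` of `F`, defined on `Q`, extends
to a morphism of `F` defined on `PQ` which sends `P` onto itself.  (If `φ` sends `Q` into `R`, then
the extension sends `PQ` into `PR`.) -/
def IsNormal (F : FusionSystem G) (P : Subgroup G) : Prop :=
  P ≤ F.carrier ∧ F.carrier ≤ Subgroup.normalizer (P : Set G) ∧
  ∀ (Q : Subgroup G) (φ : Q →* G), φ ∈ F.Mor Q →
    ∃ φ' ∈ F.Mor (P ⊔ Q), Extends φ' φ ∧ (P.subgroupOf (P ⊔ Q)).map φ' = P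

/-- `O_p(F)`: the largest subgroup which is normal in `F`, that is, the product of all of them. -/
def opCore (F : FusionSystem G) : Subgroup G := sSup {P | F.IsNormal P}

theorem opCore_le (F : FusionSystem G) : F.opCore ≤ F.carrier := sSup_le fun _ h => h.1

/-- `N` is strongly closed in `F`. -/
def IsStronglyClosed (F : FusionSystem G) (N : Subgroup G) : Prop :=
  N ≤ F.carrier ∧
    ∀ (P : Subgroup G) (φ : P →* G), φ ∈ F.Mor P → ∀ x : P, (x : G) ∈ N → φ x ∈ N

theorem IsStronglyClosed.mem_iff {F : FusionSystem G} {N : Subgroup G}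
    (hN : F.IsStronglyClosed N) {P : Subgroup G} {φ : P →* G}
    (hφ : φ ∈ F.Mor P) (x : P) : φ x ∈ N ↔ (x : G) ∈ N := by
  refine ⟨fun h => ?_, hN.2 P φ hφ x⟩
  obtain ⟨ψ, hψ, hψ'⟩ := F.inv_mem hφ
  have := hN.2 _ ψ hψ ⟨φ x, x, rfl⟩ h
  rwa [hψ'] at this

/-! ### Centralizers -/

/-- The centralizer fusion system `C_F(Q)`, over `C_S(Q)`: its morphisms are those morphisms
between subgroups of `C_S(Q)` which extend to a morphism of `F` that is the identity on `Q`. -/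
def centralizer (F : FusionSystem G) (Q : Subgroup G) (hQ : Q ≤ F.carrier) : FusionSystem G where
  carrier := Subgroup.centralizer (Q : Set G) ⊓ F.carrier
  Mor P := {φ | P ≤ Subgroup.centralizer (Q : Set G) ⊓ F.carrier ∧
    φ.range ≤ Subgroup.centralizer (Q : Set G) ⊓ F.carrier ∧
    ∃ φ' ∈ F.Mor (P ⊔ Q), Extends φ' φ ∧ Extends φ' Q.subtype}
  dom_le h := h.1
  range_le h := h.2.1
  injective := by
    rintro P φ ⟨-, -, φ', hφ', h, -⟩ x y hxy
    have hx := h x x.2 (le_sup_left (a := P) (b := Q) x.2)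
    have hy := h y y.2 (le_sup_left (a := P) (b := Q) y.2)
    have := F.injective hφ' ((hx.trans hxy).trans hy.symm)
    exact Subtype.ext (Subtype.mk.inj this)
  conj_mem := by
    intro P g hP hg
    refine ⟨hP, ?_, conjHom g (P ⊔ Q),
      F.conj_mem (sup_le (hP.trans inf_le_right) hQ) hg.2, fun x h h' => rfl, fun x h h' => ?_⟩
    · rintro _ ⟨x, rfl⟩
      exact Subgroup.mul_mem _ (Subgroup.mul_mem _ hg (hP x.2)) (Subgroup.inv_mem _ hg)
    · have := Subgroup.mem_centralizer_iff.1 hg.1 x h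
      simp [conjHom, ← this]
  comp_mem := by
    rintro P R φ ψ h ⟨h1, h2, φ', hφ', h3, h4⟩ ⟨k1, k2, ψ', hψ', k3, k4⟩
    have hPQ : P ⊔ Q ≤ ((R ⊔ Q).comap φ').map (P ⊔ Q).subtype := by
      refine sup_le (fun x hx => ?_) (fun x hx => ?_)
      · have hx' : x ∈ P ⊔ Q := le_sup_left (a := P) (b := Q) hx
        refine ⟨⟨x, hx'⟩, ?_, rfl⟩
        change φ' ⟨x, hx'⟩ ∈ R ⊔ Q
        rw [h3 x hx hx']
        exact le_sup_left (a := R) (b := Q) (h ⟨x, hx⟩)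
      · have hx' : x ∈ P ⊔ Q := le_sup_right (a := P) (b := Q) hx
        refine ⟨⟨x, hx'⟩, ?_, rfl⟩
        change φ' ⟨x, hx'⟩ ∈ R ⊔ Q
        rw [h4 x hx hx']
        exact le_sup_right (a := R) (b := Q) hx
    have hm : ∀ x : (P ⊔ Q : Subgroup G), φ' x ∈ R ⊔ Q := by
      rintro ⟨x, hx⟩
      obtain ⟨⟨y, hy⟩, hy', rfl⟩ := hPQ hx
      exact hy'
    refine ⟨h1, ?_, _, F.comp_mem hm hφ' hψ', fun x hx hx' => ?_, fun x hx hx' => ?_⟩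
    · rintro _ ⟨x, rfl⟩
      exact k2 ⟨_, rfl⟩
    · have e := h3 x hx hx'
      have := k3 (φ ⟨x, hx⟩) (h ⟨x, hx⟩) (le_sup_left (a := R) (b := Q) (h ⟨x, hx⟩))
      refine Eq.trans (congrArg ψ' (Subtype.ext ?_)) this
      exact e
    · have e := h4 x hx hx'
      have := k4 x hx (le_sup_right (a := R) (b := Q) hx)
      refine Eq.trans (congrArg ψ' (Subtype.ext ?_)) this
      exact e
  inv_mem := by
    rintro P φ ⟨h1, h2, φ', hφ', h3, h4⟩
    have hr : φ'.range = φ.range ⊔ Q := by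
      have hP : ∀ x (hx : x ∈ P), φ' ⟨x, le_sup_left (a := P) (b := Q) hx⟩ = φ ⟨x, hx⟩ :=
        fun x hx => h3 x hx _
      have hQ' : ∀ x (hx : x ∈ Q), φ' ⟨x, le_sup_right (a := P) (b := Q) hx⟩ = x :=
        fun x hx => h4 x hx _
      apply le_antisymm
      · have : P ⊔ Q ≤ ((φ.range ⊔ Q).comap φ').map (P ⊔ Q).subtype := by
          refine sup_le (fun x hx => ?_) (fun x hx => ?_)
          · refine ⟨⟨x, le_sup_left (a := P) (b := Q) hx⟩, ?_, rfl⟩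
            change φ' _ ∈ φ.range ⊔ Q
            rw [hP x hx]
            exact le_sup_left (a := φ.range) (b := Q) ⟨_, rfl⟩
          · refine ⟨⟨x, le_sup_right (a := P) (b := Q) hx⟩, ?_, rfl⟩
            change φ' _ ∈ φ.range ⊔ Q
            rw [hQ' x hx]
            exact le_sup_right (a := φ.range) (b := Q) hx
        rintro _ ⟨⟨x, hx⟩, rfl⟩
        obtain ⟨⟨y, hy⟩, hy', rfl⟩ := this hx
        exact hy'
      · refine sup_le ?_ ?_
        · rintro _ ⟨⟨x, hx⟩, rfl⟩
          exact ⟨_, hP x hx⟩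
        · intro x hx
          exact ⟨_, hQ' x hx⟩
    obtain ⟨ψ, hψ, hψ'⟩ := F.inv_mem' hφ' hr
    have hs : φ.range ≤ φ.range ⊔ Q := le_sup_left
    have key : ∀ x : P, ψ ⟨φ x, hs ⟨x, rfl⟩⟩ = (x : G) := by
      intro x
      have e := h3 x x.2 (le_sup_left (a := P) (b := Q) x.2)
      have := hψ' ⟨x, le_sup_left (a := P) (b := Q) x.2⟩ (by rw [e]; exact hs ⟨x, rfl⟩)
      refine Eq.trans (congrArg ψ (Subtype.ext e.symm)) this
    refine ⟨ψ.comp (Subgroup.inclusion hs), ⟨h2, ?_, ψ, hψ, fun x h h' => rfl, fun x h h' => ?_⟩,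
      key⟩
    · rintro _ ⟨⟨_, x, rfl⟩, rfl⟩
      exact Set.mem_of_eq_of_mem (key x) (h1 x.2)
    · have e := h4 x h (le_sup_right (a := P) (b := Q) h)
      have := hψ' ⟨x, le_sup_right (a := P) (b := Q) h⟩ (by rw [e]; exact h')
      refine Eq.trans (congrArg ψ (Subtype.ext ?_)) this
      exact e.symm

/-! ### Quotients -/

section Quotient

variable (F : FusionSystem G) (N : Subgroup G) [(N.subgroupOf F.carrier).Normal]

/-- The subgroup `P ≤ S` containing `N` such that `P / N` is the given subgroup `A` of `S / N`. -/
def preim (A : Subgroup (F.carrier ⧸ N.subgroupOf F.carrier)) : Subgroup G :=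
  (A.comap (QuotientGroup.mk' (N.subgroupOf F.carrier))).map F.carrier.subtype

/-- `ψ : P / N → S / N` is induced by `φ : P → S`, i.e. `ψ (x N) = φ (x) N` for `x ∈ P`. -/
def Induces {A : Subgroup (F.carrier ⧸ N.subgroupOf F.carrier)} (φ : F.preim N A →* G)
    (ψ : A →* F.carrier ⧸ N.subgroupOf F.carrier) : Prop :=
  ∀ (x w : F.carrier) (hx : (x : F.carrier ⧸ N.subgroupOf F.carrier) ∈ A)
    (hx' : (x : G) ∈ F.preim N A), φ ⟨x, hx'⟩ = w →
      ψ ⟨(x : F.carrier ⧸ N.subgroupOf F.carrier), hx⟩ = (w : F.carrier ⧸ N.subgroupOf F.carrier)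

variable {F N}

theorem mem_preim {A : Subgroup (F.carrier ⧸ N.subgroupOf F.carrier)} (x : F.carrier) :
    (x : G) ∈ F.preim N A ↔ (x : F.carrier ⧸ N.subgroupOf F.carrier) ∈ A := by
  constructor
  · rintro ⟨y, hy, hyx⟩
    have : y = x := Subtype.ext hyx
    subst this
    exact hy
  · intro h
    exact ⟨x, h, rfl⟩

theorem preim_le {A : Subgroup (F.carrier ⧸ N.subgroupOf F.carrier)} :
    F.preim N A ≤ F.carrier := by
  rintro _ ⟨y, -, rfl⟩
  exact y.2

theorem mk_eq_one (x : F.carrier) :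
    (x : F.carrier ⧸ N.subgroupOf F.carrier) = 1 ↔ (x : G) ∈ N := by
  rw [QuotientGroup.eq_one_iff, Subgroup.mem_subgroupOf]

variable (F N)

/-- The quotient fusion system `F / N` over `S / N`, for `N` strongly closed in `F`. -/
def quotient [Finite G] (hN : F.IsStronglyClosed N) :
    FusionSystem (F.carrier ⧸ N.subgroupOf F.carrier) where
  carrier := ⊤
  Mor A := {ψ | ∃ φ ∈ F.Mor (F.preim N A), F.Induces N φ ψ}
  dom_le _ := le_top
  range_le _ := le_top
  injective := by
    rintro A ψ ⟨φ, hφ, h⟩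
    rw [injective_iff_map_eq_one]
    rintro ⟨a, ha⟩ h1
    induction a using QuotientGroup.induction_on with
    | H x =>
      have hx' := (mem_preim x).2 ha
      have hw : φ ⟨x, hx'⟩ ∈ F.carrier := F.range_le hφ ⟨_, rfl⟩
      have e := h x ⟨_, hw⟩ ha hx' rfl
      rw [h1] at e
      have := (hN.mem_iff hφ _).1 ((mk_eq_one _).1 e.symm)
      exact Subtype.ext ((mk_eq_one x).2 this)
  conj_mem := by
    intro A g _ _
    induction g using QuotientGroup.induction_on with
    | H g =>
      refine ⟨_, F.conj_mem preim_le g.2, ?_⟩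
      intro x w hx hx' hw
      have : w = g * x * g⁻¹ := Subtype.ext hw.symm
      subst this
      rfl
  comp_mem := by
    rintro A B ψ₁ ψ₂ h ⟨φ₁, hφ₁, h₁⟩ ⟨φ₂, hφ₂, h₂⟩
    have hm : ∀ x, φ₁ x ∈ F.preim N B := by
      rintro ⟨_, x, hx, rfl⟩
      have hx' := (mem_preim x).2 hx
      have hw : φ₁ ⟨x, hx'⟩ ∈ F.carrier := F.range_le hφ₁ ⟨_, rfl⟩
      have e := h₁ x ⟨_, hw⟩ hx hx' rfl
      refine (mem_preim (N := N) (A := B) (⟨_, hw⟩ : F.carrier)).2 ?_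
      rw [← e]
      exact h _
    refine ⟨_, F.comp_mem hm hφ₁ hφ₂, ?_⟩
    intro x w hx hx' hw
    have hv : φ₁ ⟨x, hx'⟩ ∈ F.carrier := F.range_le hφ₁ ⟨_, rfl⟩
    have e := h₁ x ⟨_, hv⟩ hx hx' rfl
    have hvB : ((⟨_, hv⟩ : F.carrier) : F.carrier ⧸ N.subgroupOf F.carrier) ∈ B := by
      rw [← e]
      exact h _
    have e₂ := h₂ ⟨_, hv⟩ w hvB (hm _) hw
    refine Eq.trans (congrArg ψ₂ (Subtype.ext ?_)) e₂
    exact e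
  inv_mem := by
    rintro A ψ ⟨φ, hφ, h⟩
    have hinj : Function.Injective ψ := by
      rw [injective_iff_map_eq_one]
      rintro ⟨a, ha⟩ h1
      induction a using QuotientGroup.induction_on with
      | H x =>
        have hx' := (mem_preim x).2 ha
        have hw : φ ⟨x, hx'⟩ ∈ F.carrier := F.range_le hφ ⟨_, rfl⟩
        have e := h x ⟨_, hw⟩ ha hx' rfl
        rw [h1] at e
        have := (hN.mem_iff hφ _).1 ((mk_eq_one _).1 e.symm)
        exact Subtype.ext ((mk_eq_one x).2 this)
    have hNA : ∀ n ∈ N, n ∈ F.preim N A := by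
      intro n hn
      refine (mem_preim (N := N) (A := A) (⟨n, hN.1 hn⟩ : F.carrier)).2 ?_
      rw [(mk_eq_one (N := N) (⟨n, hN.1 hn⟩ : F.carrier)).2 hn]
      exact A.one_mem
    have hNr : ∀ n ∈ N, n ∈ φ.range := by
      let f : N → N := fun n => ⟨φ ⟨n, hNA n n.2⟩, hN.2 _ φ hφ _ n.2⟩
      have hf : Function.Injective f := by
        intro a b hab
        have := F.injective hφ (congrArg Subtype.val hab)
        exact Subtype.ext (Subtype.mk.inj this)
      have hs := Finite.surjective_of_injective hf
      intro n hn
      obtain ⟨m, hm⟩ := hs ⟨n, hn⟩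
      exact ⟨_, congrArg Subtype.val hm⟩
    have hr : φ.range = F.preim N ψ.range := by
      apply le_antisymm
      · rintro _ ⟨⟨_, x, hx, rfl⟩, rfl⟩
        have hx' := (mem_preim x).2 hx
        have hw : φ ⟨x, hx'⟩ ∈ F.carrier := F.range_le hφ ⟨_, rfl⟩
        have e := h x ⟨_, hw⟩ hx hx' rfl
        exact (mem_preim (N := N) (A := ψ.range) (⟨_, hw⟩ : F.carrier)).2 ⟨_, e⟩
      · rintro _ ⟨y, ⟨⟨a, ha⟩, hy⟩, rfl⟩
        induction a using QuotientGroup.induction_on with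
        | H x =>
          have hx' := (mem_preim x).2 ha
          have hw : φ ⟨x, hx'⟩ ∈ F.carrier := F.range_le hφ ⟨_, rfl⟩
          have e := h x ⟨_, hw⟩ ha hx' rfl
          have e' : ((⟨_, hw⟩ : F.carrier) : F.carrier ⧸ N.subgroupOf F.carrier) = y :=
            e.symm.trans hy
          have hn := Subgroup.mem_subgroupOf.1 (QuotientGroup.eq.1 e')
          have := φ.range.mul_mem ⟨⟨x, hx'⟩, rfl⟩ (hNr _ hn)
          simpa using this
    obtain ⟨χ, hχ, hχ'⟩ := F.inv_mem' hφ hr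
    refine ⟨A.subtype.comp (MonoidHom.ofInjective hinj).symm.toMonoidHom, ⟨χ, hχ, ?_⟩, ?_⟩
    · intro x w hx hx' hw
      obtain ⟨⟨z, hz⟩, hz'⟩ : (x : G) ∈ φ.range := by
        rw [hr]
        exact hx'
      have hzw : z = w := by
        rw [← hw]
        have := hχ' ⟨z, hz⟩ (by rw [hz']; exact hx')
        refine this.symm.trans (congrArg χ (Subtype.ext hz'))
      subst hzw
      have hwA := (mem_preim w).1 hz
      have e := h w x hwA hz hz'
      have : (⟨(x : F.carrier ⧸ N.subgroupOf F.carrier), hx⟩ : ψ.range) =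
          MonoidHom.ofInjective hinj ⟨_, hwA⟩ := Subtype.ext e.symm
      rw [this]
      simp
    · intro x
      have : (⟨ψ x, x, rfl⟩ : ψ.range) = MonoidHom.ofInjective hinj x := rfl
      rw [this]
      simp

end Quotient

/-! ### Fusion subsystems -/

/-- `E` is a normal fusion subsystem of `F`.  In the third condition, the automorphism `α` of the
underlying group `T` of `E` is regarded as a homomorphism from `T` to `G` with image `T`, and
`φ = φ₀ ∘ α` on `P`; similarly for `β` in the last one, where `φ' = β φ β⁻¹` on `β(P)`. -/
def IsNormalSubsystem (p : ℕ) (E F : FusionSystem G) : Prop :=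
  E.IsSaturated p ∧ E ≤ F ∧ F.IsStronglyClosed E.carrier ∧
  (∀ (P : Subgroup G) (hP : P ≤ E.carrier), ∀ φ ∈ F.Hom P E.carrier,
    ∃ α ∈ F.Mor E.carrier, α.range = E.carrier ∧
      ∃ φ₀ ∈ E.Mor ((P.subgroupOf E.carrier).map α),
        ∀ (x : P) (y : (P.subgroupOf E.carrier).map α),
          (y : G) = α ⟨x, hP x.2⟩ → φ x = φ₀ y) ∧
  (∀ (P : Subgroup G) (hP : P ≤ E.carrier), ∀ φ ∈ E.Mor P,
    ∀ β ∈ F.Mor E.carrier, β.range = E.carrier →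
      ∃ φ' ∈ E.Mor ((P.subgroupOf E.carrier).map β),
        ∀ (x : P) (y : (P.subgroupOf E.carrier).map β) (z : E.carrier),
          (y : G) = β ⟨x, hP x.2⟩ → (z : G) = φ x → φ' y = β z)

/-- The hyperfocal subgroup, generated by the elements `s⁻¹ α(s)` for `s ∈ P ≤ S` and
`α ∈ O^p(Aut_F(P))`. -/
def hyp (p : ℕ) (F : FusionSystem G) : Subgroup G :=
  Subgroup.closure {g | ∃ (P : Subgroup G) (hP : P ≤ F.carrier) (s : P),
    ∃ α ∈ pResidual p (F.aut P hP), g = (s : G)⁻¹ * ((α : MulAut P) s : P)}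

/-- `E` is a saturated fusion subsystem of `F` of `p`-power index. -/
def HasPPowerIndex (p : ℕ) (E F : FusionSystem G) : Prop :=
  E.IsSaturated p ∧ E ≤ F ∧ F.hyp p ≤ E.carrier ∧
  ∀ (P : Subgroup G) (hE : P ≤ E.carrier) (hF : P ≤ F.carrier),
    (pResidual p (F.aut P hF)).map (F.aut P hF).subtype ≤ E.aut P hE

/-- `E` is a saturated fusion subsystem of `F` of index prime to `p`. -/
def HasPrimeToPIndex (p : ℕ) (E F : FusionSystem G) : Prop :=
  E.IsSaturated p ∧ E ≤ F ∧ E.carrier = F.carrier ∧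
  ∀ (P : Subgroup G) (hE : P ≤ E.carrier) (hF : P ≤ F.carrier),
    (pPrimeResidual p (F.aut P hF)).map (F.aut P hF).subtype ≤ E.aut P hE

/-- `E = O^p(F)`: the smallest saturated fusion subsystem of `p`-power index over the hyperfocal
subgroup of `F`. -/
def IsOUpperP (p : ℕ) (F E : FusionSystem G) : Prop :=
  IsLeast {E' | HasPPowerIndex p E' F ∧ E'.carrier = F.hyp p} E

/-- `E = O^{p'}(F)`: the smallest saturated fusion subsystem of index prime to `p`. -/
def IsOUpperPPrime (p : ℕ) (F E : FusionSystem G) : Prop :=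
  IsLeast {E' | HasPrimeToPIndex p E' F} E

/-- Reduced fusion systems (over finite `p`-groups). -/
structure IsReduced (p : ℕ) (F : FusionSystem G) : Prop where
  saturated : F.IsSaturated p
  normal_eq_bot : ∀ P, F.IsNormal P → P = ⊥
  pPower : ∀ E, IsNormalSubsystem p E F → HasPPowerIndex p E F → E = F
  primeToP : ∀ E, IsNormalSubsystem p E F → HasPrimeToPIndex p E F → E = F

/-! ### The reduction -/

/-- The center of a subgroup `Q`. -/
def centerOf (Q : Subgroup G) : Subgroup G := Q ⊓ Subgroup.centralizer (Q : Set G)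

instance (F : FusionSystem G) (Q : Subgroup G) (hQ : Q ≤ F.carrier) :
    ((centerOf Q).subgroupOf (F.centralizer Q hQ).carrier).Normal where
  conj_mem := by
    rintro ⟨n, hn⟩ h ⟨g, hg⟩
    have := Subgroup.mem_centralizer_iff.1 hg.1 n h.1
    have e : g * n * g⁻¹ = n := by rw [← this, mul_inv_cancel_right]
    change g * n * g⁻¹ ∈ centerOf Q
    rw [e]
    exact h

theorem isStronglyClosed_centerOf (F : FusionSystem G) (Q : Subgroup G) (hQ : Q ≤ F.carrier) :
    (F.centralizer Q hQ).IsStronglyClosed (centerOf Q) := by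
  refine ⟨fun x h => ⟨h.2, hQ h.1⟩, ?_⟩
  rintro P φ ⟨-, -, φ', hφ', h1, h2⟩ x hx
  have e1 := h1 x x.2 (le_sup_left (a := P) (b := Q) x.2)
  have e2 := h2 x hx.1 (le_sup_right (a := P) (b := Q) hx.1)
  have : φ x = x := e1.symm.trans e2
  rw [this]
  exact hx

/-- The group `C_S(Q) / Z(Q)`, where `Q = O_p(F)`. -/
abbrev CoreQuotient (F : FusionSystem G) : Type _ :=
  (F.centralizer F.opCore F.opCore_le).carrier ⧸
    (centerOf F.opCore).subgroupOf (F.centralizer F.opCore F.opCore_le).carrier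

/-- The fusion system `C_F(Q) / Z(Q)`, where `Q = O_p(F)`. -/
def coreQuotient [Finite G] (F : FusionSystem G) : FusionSystem F.CoreQuotient :=
  (F.centralizer F.opCore F.opCore_le).quotient (centerOf F.opCore)
    (F.isStronglyClosed_centerOf F.opCore F.opCore_le)

/-- `R` is the reduction of `F`: the last term `E m` of a sequence which starts with
`C_F(Q) / Z(Q)`, where `Q = O_p(F)`, is obtained by applying `O^p` (to get the terms with odd index)
and `O^{p'}` (to get the terms with even index) alternately, and is such that
`O^p(E m) = O^{p'}(E m) = E m`. -/
def IsReduction [Finite G] (p : ℕ) (F : FusionSystem G) (R : FusionSystem F.CoreQuotient) : Prop :=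
  ∃ (m : ℕ) (E : ℕ → FusionSystem F.CoreQuotient), E 0 = F.coreQuotient ∧
    (∀ i < m, (Even i → IsOUpperP p (E i) (E (i + 1))) ∧
      (Odd i → IsOUpperPPrime p (E i) (E (i + 1)))) ∧
    IsOUpperP p (E m) (E m) ∧ IsOUpperPPrime p (E m) (E m) ∧ R = E m

/-- A fusion system has at most one reduction. -/
theorem IsReduction.unique [Finite G] {p : ℕ} {F : FusionSystem G}
    {R R' : FusionSystem F.CoreQuotient} (h : F.IsReduction p R) (h' : F.IsReduction p R') :
    R = R' := by
  obtain ⟨m, E, h0, hs, hm, hm', rfl⟩ := h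
  obtain ⟨n, D, k0, ks, kn, kn', rfl⟩ := h'
  have key : ∀ i, i ≤ n → E (min i m) = D i := by
    intro i
    induction i with
    | zero => simp [h0, k0]
    | succ i ih =>
      intro hi
      have e := ih (by omega)
      have hd := ks i (by omega)
      rcases lt_or_ge i m with him | him
      · have hE := hs i him
        rw [min_eq_left him.le] at e
        rw [min_eq_left him]
        rw [← e] at hd
        rcases Nat.even_or_odd i with hev | hodd
        · exact (hE.1 hev).unique (hd.1 hev)
        · exact (hE.2 hodd).unique (hd.2 hodd)
      · rw [min_eq_right him] at e
        rw [min_eq_right (by omega)]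
        rw [← e] at hd
        rcases Nat.even_or_odd i with hev | hodd
        · exact hm.unique (hd.1 hev)
        · exact hm'.unique (hd.2 hodd)
  have key' : ∀ j, min n m + j ≤ m → E (min n m + j) = D n := by
    intro j
    induction j with
    | zero => intro _; exact key n le_rfl
    | succ j ih =>
      intro hj
      have e := ih (by omega)
      have hE := hs (min n m + j) (by omega)
      rw [e] at hE
      rcases Nat.even_or_odd (min n m + j) with hev | hodd
      · exact (hE.1 hev).unique kn
      · exact (hE.2 hodd).unique kn'
  have := key' (m - min n m) (by omega)
  rwa [show min n m + (m - min n m) = m by omega] at this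

end FusionSystem

/-! Write S for the underlying p-group of F and Q for O_p(F). Saturation is handled in the form of
Roberts and Shpectorov: every subgroup is isomorphic in F to a fully automized, receptive one
(`RSat`, equivalent to `IsSaturated` over a finite p-group). This form passes to C_F(Q)/Z(Q), since
only the subgroups of C_S(Q) containing Z(Q) have to be considered. The residuals O^p and O^{p'} are
saturated by definition. So the main point is the triviality of O_p.

It rests on one criterion, `RSat.isNormal_of_elements`: N ≤ S is normal in F as soon as, for each x
∈ N, every morphism of F on ⟨x⟩ agrees at x, modulo Z(N), with an automorphism of N in F. Indeed the
upper central series of N then consists of strongly closed subgroups and, continued by S, forms a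
chain whose factors are centralized by N. If P is fully automized, the automorphisms of P
stabilizing this chain form a normal p-subgroup of Aut_F(P), hence lie in Aut_S(P); so an
automorphism of P in F extends to a strictly larger subgroup unless N ≤ P. Alperin's fusion theorem
concludes (`RSat.isNormal_of_chain`).

For C_F(Q)/Z(Q), let N ≤ C_S(Q) be the preimage of its O_p. A morphism of F on ⟨x⟩, x ∈ N, extends
to Q⟨x⟩, and its restriction to Q extends to an automorphism ψ of C_S(Q)Q in F. Dividing by ψ leaves
a morphism of C_F(Q), which agrees with an automorphism of N modulo Z(Q); and ψ preserves N because
it preserves C_F(Q). So N is normal in F, and N ≤ Q ∩ C_S(Q) = Z(Q) (`isNormal_preim_opCore`,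
`opCore_coreQuotient`).

For E = O^p(F) or O^{p'}(F) over T, minimality makes E invariant under Aut_F(T), and every morphism
of F, restricted to the part of its domain in T, is a morphism of E followed by an element of
Aut_F(T) (`IsOUpperP.factors`, `IsOUpperPPrime.factors`). By the criterion O_p(E) is normal in F,
hence trivial if O_p(F) is. If both operators fix F, minimality excludes proper subsystems of
p-power index or of index prime to p. -/

namespace FusionSystem

/-! ### Morphisms of a fusion system as total functions on the ambient group -/

variable {G : Type*} [Group G]

/-- `f` is multiplicative on the subgroup `P`. -/
def HomOn (f : G → G) (P : Subgroup G) : Prop :=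
  ∀ x ∈ P, ∀ y ∈ P, f (x * y) = f x * f y

/-- The image of `P` under a map which is multiplicative on `P`. -/
def img (f : G → G) (P : Subgroup G) : Subgroup G := Subgroup.closure (f '' P)

theorem HomOn.mono {f : G → G} {P Q : Subgroup G} (h : HomOn f Q) (hPQ : P ≤ Q) : HomOn f P :=
  fun x hx y hy => h x (hPQ hx) y (hPQ hy)

theorem HomOn.map_one {f : G → G} {P : Subgroup G} (h : HomOn f P) : f 1 = 1 := by
  have := h 1 P.one_mem 1 P.one_mem
  simpa using this

theorem HomOn.map_inv {f : G → G} {P : Subgroup G} (h : HomOn f P) {x : G} (hx : x ∈ P) :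
    f x⁻¹ = (f x)⁻¹ := by
  have := h x hx x⁻¹ (P.inv_mem hx)
  rw [mul_inv_cancel, h.map_one] at this
  exact (inv_eq_of_mul_eq_one_right this.symm).symm

theorem HomOn.map_conj {f : G → G} {P : Subgroup G} (h : HomOn f P) {x y : G} (hx : x ∈ P)
    (hy : y ∈ P) : f (x * y * x⁻¹) = f x * f y * (f x)⁻¹ := by
  rw [h _ (P.mul_mem hx hy) _ (P.inv_mem hx), h x hx y hy, h.map_inv hx]

theorem mem_img_of_mem {f : G → G} {P : Subgroup G} {x : G} (hx : x ∈ P) : f x ∈ img f P :=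
  Subgroup.subset_closure ⟨x, hx, rfl⟩

theorem img_le {f : G → G} {P Q : Subgroup G} : img f P ≤ Q ↔ ∀ x ∈ P, f x ∈ Q := by
  rw [img, Subgroup.closure_le]
  exact ⟨fun h x hx => h ⟨x, hx, rfl⟩, fun h => by rintro _ ⟨x, hx, rfl⟩; exact h x hx⟩

theorem img_mono {f : G → G} {P Q : Subgroup G} (h : P ≤ Q) : img f P ≤ img f Q :=
  img_le.2 fun _ hx => mem_img_of_mem (h hx)

theorem HomOn.mem_img {f : G → G} {P : Subgroup G} (h : HomOn f P) {y : G} :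
    y ∈ img f P ↔ ∃ x ∈ P, f x = y := by
  refine ⟨fun hy => ?_, ?_⟩
  · induction hy using Subgroup.closure_induction with
    | mem x hx => exact hx
    | one => exact ⟨1, P.one_mem, h.map_one⟩
    | mul x y _ _ hx hy =>
      obtain ⟨a, ha, rfl⟩ := hx
      obtain ⟨b, hb, rfl⟩ := hy
      exact ⟨a * b, P.mul_mem ha hb, h a ha b hb⟩
    | inv x _ hx =>
      obtain ⟨a, ha, rfl⟩ := hx
      exact ⟨a⁻¹, P.inv_mem ha, h.map_inv ha⟩
  · rintro ⟨x, hx, rfl⟩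
    exact mem_img_of_mem hx

theorem HomOn.img_comp {f g : G → G} {P : Subgroup G} (h : HomOn f P) :
    img g (img f P) = img (g ∘ f) P := by
  apply le_antisymm
  · refine img_le.2 fun y hy => ?_
    obtain ⟨x, hx, rfl⟩ := h.mem_img.1 hy
    exact mem_img_of_mem (f := g ∘ f) hx
  · exact img_le.2 fun x hx => mem_img_of_mem (mem_img_of_mem hx)

theorem HomOn.sup_le {f : G → G} {P Q R : Subgroup G} (h : HomOn f (P ⊔ Q))
    (hP : ∀ x ∈ P, f x ∈ R) (hQ : ∀ x ∈ Q, f x ∈ R) : ∀ x ∈ P ⊔ Q, f x ∈ R := by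
  -- The elements of P ⊔ Q which `f` sends into `R` form a subgroup, so it suffices that it contains
  -- P and Q.
  have : P ⊔ Q ≤ (R.comap (MonoidHom.mk' (fun x : (P ⊔ Q : Subgroup G) => f x)
      (fun x y => h x x.2 y y.2))).map (P ⊔ Q).subtype := by
    refine _root_.sup_le (fun x hx => ?_) (fun x hx => ?_)
    · exact ⟨⟨x, le_sup_left (a := P) hx⟩, hP x hx, rfl⟩
    · exact ⟨⟨x, le_sup_right (a := P) hx⟩, hQ x hx, rfl⟩
  intro x hx
  obtain ⟨⟨y, hy⟩, hy', rfl⟩ := this hx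
  exact hy'

theorem HomOn.eqOn_sup {f g : G → G} {P Q : Subgroup G} (hf : HomOn f (P ⊔ Q))
    (hg : HomOn g (P ⊔ Q)) (hP : ∀ x ∈ P, f x = g x) (hQ : ∀ x ∈ Q, f x = g x) :
    ∀ x ∈ P ⊔ Q, f x = g x := by
  have : P ⊔ Q ≤ ((MonoidHom.mk' (fun x : (P ⊔ Q : Subgroup G) => f x)
      (fun x y => hf x x.2 y y.2)).eqLocus (MonoidHom.mk' (fun x : (P ⊔ Q : Subgroup G) => g x)
      (fun x y => hg x x.2 y y.2))).map (P ⊔ Q).subtype := by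
    refine _root_.sup_le (fun x hx => ?_) (fun x hx => ?_)
    · exact ⟨⟨x, le_sup_left (a := P) hx⟩, hP x hx, rfl⟩
    · exact ⟨⟨x, le_sup_right (a := P) hx⟩, hQ x hx, rfl⟩
  intro x hx
  obtain ⟨⟨y, hy⟩, hy', rfl⟩ := this hx
  exact hy'

/-- The total function `f` restricts to a morphism of `F` on `P`. -/
def IsMor (F : FusionSystem G) (P : Subgroup G) (f : G → G) : Prop :=
  ∃ φ ∈ F.Mor P, ∀ x (h : x ∈ P), φ ⟨x, h⟩ = f x

namespace IsMor

variable {F : FusionSystem G} {P Q : Subgroup G} {f g : G → G}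

theorem dom_le (h : F.IsMor P f) : P ≤ F.carrier := by
  obtain ⟨φ, hφ, -⟩ := h
  exact F.dom_le hφ

theorem mem (h : F.IsMor P f) {x : G} (hx : x ∈ P) : f x ∈ F.carrier := by
  obtain ⟨φ, hφ, h⟩ := h
  rw [← h x hx]
  exact F.range_le hφ ⟨_, rfl⟩

theorem homOn (h : F.IsMor P f) : HomOn f P := by
  obtain ⟨φ, hφ, h⟩ := h
  intro x hx y hy
  rw [← h x hx, ← h y hy, ← map_mul, ← h _ (P.mul_mem hx hy)]
  rfl

theorem inj (h : F.IsMor P f) {x y : G} (hx : x ∈ P) (hy : y ∈ P) (e : f x = f y) : x = y := by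
  obtain ⟨φ, hφ, h⟩ := h
  rw [← h x hx, ← h y hy] at e
  exact congrArg Subtype.val (F.injective hφ e)

theorem congr (h : F.IsMor P f) (e : ∀ x ∈ P, f x = g x) : F.IsMor P g := by
  obtain ⟨φ, hφ, h⟩ := h
  exact ⟨φ, hφ, fun x hx => (h x hx).trans (e x hx)⟩

theorem comp (h : F.IsMor P f) (h' : F.IsMor Q g) (hPQ : ∀ x ∈ P, f x ∈ Q) :
    F.IsMor P (g ∘ f) := by
  obtain ⟨φ, hφ, h⟩ := h
  obtain ⟨ψ, hψ, h'⟩ := h'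
  have hm : ∀ x, φ x ∈ Q := by
    rintro ⟨x, hx⟩
    rw [h x hx]
    exact hPQ x hx
  refine ⟨_, F.comp_mem hm hφ hψ, fun x hx => ?_⟩
  exact (h' (φ ⟨x, hx⟩) (hm _)).trans (congrArg g (h x hx))

theorem of_conj {s : G} (hP : P ≤ F.carrier) (hs : s ∈ F.carrier) :
    F.IsMor P (fun x => s * x * s⁻¹) :=
  ⟨_, F.conj_mem hP hs, fun _ _ => rfl⟩

theorem of_id (hP : P ≤ F.carrier) : F.IsMor P id :=
  ⟨_, F.subtype_mem hP, fun _ _ => rfl⟩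

theorem mono (h : F.IsMor Q f) (hPQ : P ≤ Q) : F.IsMor P f :=
  (of_id (hPQ.trans h.dom_le)).comp h hPQ

end IsMor

open Classical in
/-- A total function which extends a homomorphism defined on a subgroup. -/
noncomputable def toFun {P : Subgroup G} (φ : P →* G) (x : G) : G :=
  if h : x ∈ P then φ ⟨x, h⟩ else 1

theorem toFun_apply {P : Subgroup G} (φ : P →* G) {x : G} (h : x ∈ P) :
    toFun φ x = φ ⟨x, h⟩ := dif_pos h

theorem isMor_toFun {F : FusionSystem G} {P : Subgroup G} {φ : P →* G} (h : φ ∈ F.Mor P) :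
    F.IsMor P (toFun φ) :=
  ⟨φ, h, fun _ hx => (toFun_apply φ hx).symm⟩

theorem isMor_iff_mem {F : FusionSystem G} {P : Subgroup G} {φ : P →* G} {f : G → G}
    (h : ∀ x (hx : x ∈ P), φ ⟨x, hx⟩ = f x) : F.IsMor P f ↔ φ ∈ F.Mor P := by
  refine ⟨?_, fun hφ => ⟨φ, hφ, h⟩⟩
  rintro ⟨ψ, hψ, h'⟩
  have : φ = ψ := by
    ext ⟨x, hx⟩
    rw [h x hx, h' x hx]
  rwa [this]

theorem le_iff_isMor {E F : FusionSystem G} :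
    E ≤ F ↔ E.carrier ≤ F.carrier ∧ ∀ P f, E.IsMor P f → F.IsMor P f := by
  refine ⟨fun h => ⟨h.1, fun P f => ?_⟩, fun h => ⟨h.1, fun P φ hφ => ?_⟩⟩
  · rintro ⟨φ, hφ, e⟩
    exact ⟨φ, h.2 P hφ, e⟩
  · exact (isMor_iff_mem fun _ hx => (toFun_apply φ hx).symm).1 (h.2 P _ (isMor_toFun hφ))

/-- `f` and `g` are mutually inverse isomorphisms in `F` between `P` and `Q`. -/
structure Iso (F : FusionSystem G) (P Q : Subgroup G) (f g : G → G) : Prop where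
  mor : F.IsMor P f
  inv_mor : F.IsMor Q g
  map : ∀ x ∈ P, f x ∈ Q
  inv_map : ∀ y ∈ Q, g y ∈ P
  left : ∀ x ∈ P, g (f x) = x
  right : ∀ y ∈ Q, f (g y) = y

namespace Iso

variable {F : FusionSystem G} {P Q R : Subgroup G} {f g f' g' : G → G}

theorem symm (h : F.Iso P Q f g) : F.Iso Q P g f :=
  ⟨h.inv_mor, h.mor, h.inv_map, h.map, h.right, h.left⟩

theorem trans (h : F.Iso P Q f g) (h' : F.Iso Q R f' g') : F.Iso P R (f' ∘ f) (g ∘ g') where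
  mor := h.mor.comp h'.mor h.map
  inv_mor := h'.inv_mor.comp h.inv_mor h'.inv_map
  map x hx := h'.map _ (h.map x hx)
  inv_map x hx := h.inv_map _ (h'.inv_map x hx)
  left x hx := by simp [h'.left _ (h.map x hx), h.left x hx]
  right x hx := by simp [h.right _ (h'.inv_map x hx), h'.right x hx]

theorem refl (hP : P ≤ F.carrier) : F.Iso P P id id :=
  ⟨.of_id hP, .of_id hP, fun _ h => h, fun _ h => h, fun _ _ => rfl, fun _ _ => rfl⟩

theorem mono (h : F.Iso P Q f g) (hR : R ≤ P) : F.Iso R (img f R) f g where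
  mor := h.mor.mono hR
  inv_mor := h.inv_mor.mono (img_le.2 fun x hx => h.map x (hR hx))
  map _ hx := mem_img_of_mem hx
  inv_map y hy := by
    obtain ⟨x, hx, rfl⟩ := (h.mor.mono hR).homOn.mem_img.1 hy
    rwa [h.left x (hR hx)]
  left x hx := h.left x (hR hx)
  right y hy := h.right y (img_le.2 (fun x hx => h.map x (hR hx)) hy)

theorem ofLE {E : FusionSystem G} (h : E.Iso P Q f g) (hEF : E ≤ F) : F.Iso P Q f g :=
  { h with mor := (le_iff_isMor.1 hEF).2 _ _ h.mor
           inv_mor := (le_iff_isMor.1 hEF).2 _ _ h.inv_mor }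

/-- The group isomorphism given by an isomorphism in a fusion system. -/
def toMulEquiv (h : F.Iso P Q f g) : P ≃* Q where
  toFun x := ⟨f x, h.map x x.2⟩
  invFun y := ⟨g y, h.inv_map y y.2⟩
  left_inv x := Subtype.ext (h.left x x.2)
  right_inv y := Subtype.ext (h.right y y.2)
  map_mul' x y := Subtype.ext (h.mor.homOn x x.2 y y.2)

theorem card_eq (h : F.Iso P Q f g) : Nat.card P = Nat.card Q :=
  Nat.card_congr h.toMulEquiv.toEquiv

theorem of_conj {s : G} (hP : P ≤ F.carrier) (hs : s ∈ F.carrier) :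
    F.Iso P (img (fun x => s * x * s⁻¹) P) (fun x => s * x * s⁻¹) (fun x => s⁻¹ * x * s) where
  mor := .of_conj hP hs
  inv_mor := by
    have h : img (fun x => s * x * s⁻¹) P ≤ F.carrier :=
      img_le.2 fun x hx => (IsMor.of_conj hP hs).mem hx
    simpa using IsMor.of_conj (s := s⁻¹) h (F.carrier.inv_mem hs)
  map x hx := mem_img_of_mem (f := fun x => s * x * s⁻¹) hx
  inv_map y hy := by
    obtain ⟨x, hx, rfl⟩ := (IsMor.of_conj hP hs).homOn.mem_img.1 hy
    simpa [mul_assoc] using hx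
  left x hx := by simp [mul_assoc]
  right x hx := by simp [mul_assoc]

end Iso

theorem IsMor.iso {F : FusionSystem G} {P : Subgroup G} {f : G → G} (h : F.IsMor P f) :
    ∃ g, F.Iso P (img f P) f g := by
  obtain ⟨φ, hφ, e⟩ := id h
  have hr : φ.range = img f P := by
    ext y
    rw [h.homOn.mem_img]
    constructor
    · rintro ⟨⟨x, hx⟩, rfl⟩
      exact ⟨x, hx, (e x hx).symm⟩
    · rintro ⟨x, hx, rfl⟩
      exact ⟨⟨x, hx⟩, e x hx⟩
  obtain ⟨ψ, hψ, e'⟩ := F.inv_mem' hφ hr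
  have key : ∀ x ∈ P, toFun ψ (f x) = x := by
    intro x hx
    have := e' ⟨x, hx⟩ (by rw [e x hx]; exact mem_img_of_mem hx)
    rw [← toFun_apply, e x hx] at this
    exact this
  refine ⟨toFun ψ, h, isMor_toFun hψ, fun _ => mem_img_of_mem, ?_, key, ?_⟩
  · intro y hy
    obtain ⟨x, hx, rfl⟩ := h.homOn.mem_img.1 hy
    rwa [key x hx]
  · intro y hy
    obtain ⟨x, hx, rfl⟩ := h.homOn.mem_img.1 hy
    rw [key x hx]

theorem card_le_of_injOn [Finite G] {A B : Subgroup G} {f : G → G} (hm : ∀ x ∈ A, f x ∈ B)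
    (hi : ∀ x ∈ A, ∀ y ∈ A, f x = f y → x = y) : Nat.card A ≤ Nat.card B :=
  Nat.card_le_card_of_injective (fun x : A => (⟨f x, hm x x.2⟩ : B)) fun x y h =>
    Subtype.ext (hi x x.2 y y.2 (congrArg Subtype.val h))

theorem surjOn_of_card_le [Finite G] {A B : Subgroup G} {f : G → G} (hm : ∀ x ∈ A, f x ∈ B)
    (hi : ∀ x ∈ A, ∀ y ∈ A, f x = f y → x = y) (hc : Nat.card B ≤ Nat.card A) :
    ∀ y ∈ B, ∃ x ∈ A, f x = y := by
  have hinj : Function.Injective (fun x : A => (⟨f x, hm x x.2⟩ : B)) := fun x y h =>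
    Subtype.ext (hi x x.2 y y.2 (congrArg Subtype.val h))
  have hb := hinj.bijective_of_nat_card_le hc
  intro y hy
  obtain ⟨x, hx⟩ := hb.2 ⟨y, hy⟩
  exact ⟨x, x.2, congrArg Subtype.val hx⟩

/-- Morphisms are injective, so counting gives surjectivity. This is the usual way to obtain an
inverse in what follows. -/
theorem IsMor.iso_of_card_le [Finite G] {F : FusionSystem G} {P Q : Subgroup G} {f : G → G}
    (h : F.IsMor P f) (hm : ∀ x ∈ P, f x ∈ Q) (hc : Nat.card Q ≤ Nat.card P) :
    ∃ g, F.Iso P Q f g := by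
  obtain ⟨g, hg⟩ := h.iso
  have : img f P = Q := by
    refine le_antisymm (img_le.2 hm) fun y hy => ?_
    obtain ⟨x, hx, rfl⟩ := surjOn_of_card_le hm (fun x hx y hy => h.inj hx hy) hc y hy
    exact mem_img_of_mem hx
  rw [this] at hg
  exact ⟨g, hg⟩

theorem IsMor.iso_self [Finite G] {F : FusionSystem G} {P : Subgroup G} {f : G → G}
    (h : F.IsMor P f) (hm : ∀ x ∈ P, f x ∈ P) : ∃ g, F.Iso P P f g :=
  h.iso_of_card_le hm le_rfl

theorem mem_aut_iff {F : FusionSystem G} {P : Subgroup G} (hP : P ≤ F.carrier) {α : MulAut P}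
    {f : G → G} (e : ∀ x : P, (α x : G) = f x) : α ∈ F.aut P hP ↔ F.IsMor P f :=
  (isMor_iff_mem (φ := P.subtype.comp α.toMonoidHom) fun x hx => e ⟨x, hx⟩).symm

/-- A total function which extends an automorphism of a subgroup. -/
noncomputable def autFun {P : Subgroup G} (α : MulAut P) : G → G :=
  toFun (P.subtype.comp α.toMonoidHom)

theorem autFun_apply {P : Subgroup G} (α : MulAut P) (x : P) : (α x : G) = autFun α x :=
  (toFun_apply (P.subtype.comp α.toMonoidHom) x.2).symm

theorem autFun_mem {P : Subgroup G} (α : MulAut P) {x : G} (hx : x ∈ P) : autFun α x ∈ P := by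
  rw [← autFun_apply α ⟨x, hx⟩]
  exact (α ⟨x, hx⟩).2

theorem autFun_mul {P : Subgroup G} (α β : MulAut P) {x : G} (hx : x ∈ P) :
    autFun (α * β) x = autFun α (autFun β x) := by
  rw [← autFun_apply β ⟨x, hx⟩, ← autFun_apply, ← autFun_apply _ ⟨x, hx⟩]
  rfl

theorem mulAut_ext {P : Subgroup G} {α β : MulAut P} (h : ∀ x ∈ P, autFun α x = autFun β x) :
    α = β := by
  ext x
  rw [autFun_apply, autFun_apply, h x x.2]

theorem mem_aut_iff_isMor {F : FusionSystem G} {P : Subgroup G} (hP : P ≤ F.carrier)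
    {α : MulAut P} : α ∈ F.aut P hP ↔ F.IsMor P (autFun α) :=
  mem_aut_iff hP (autFun_apply α)

theorem autFun_iso {F : FusionSystem G} {P : Subgroup G} {hP : P ≤ F.carrier}
    {α : MulAut P} (h : α ∈ F.aut P hP) : F.Iso P P (autFun α) (autFun α⁻¹) where
  mor := (mem_aut_iff_isMor hP).1 h
  inv_mor := (mem_aut_iff_isMor hP).1 (Subgroup.inv_mem _ h)
  map _ hx := autFun_mem α hx
  inv_map _ hx := autFun_mem _ hx
  left x hx := by
    rw [← autFun_mul _ _ hx, inv_mul_cancel, ← autFun_apply 1 ⟨x, hx⟩]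
    rfl
  right x hx := by
    rw [← autFun_mul _ _ hx, mul_inv_cancel, ← autFun_apply 1 ⟨x, hx⟩]
    rfl

theorem Iso.autFun_toMulEquiv {F : FusionSystem G} {P : Subgroup G} {f g : G → G}
    (h : F.Iso P P f g) {x : G} (hx : x ∈ P) : autFun (h.toMulEquiv : MulAut P) x = f x :=
  (autFun_apply (h.toMulEquiv : MulAut P) ⟨x, hx⟩).symm

theorem Iso.toMulEquiv_mem_aut {F : FusionSystem G} {P : Subgroup G} {f g : G → G}
    (h : F.Iso P P f g) (hP : P ≤ F.carrier) : (h.toMulEquiv : MulAut P) ∈ F.aut P hP :=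
  (mem_aut_iff hP fun _ => rfl).2 h.mor

theorem mem_autConj_iff {F : FusionSystem G} {P : Subgroup G} {α : MulAut P} :
    α ∈ F.autConj P ↔ ∃ s ∈ F.carrier, ∀ x ∈ P, autFun α x = s * x * s⁻¹ := by
  constructor
  · rintro ⟨⟨s, hs⟩, hs', rfl⟩
    refine ⟨s, hs', fun x hx => ?_⟩
    rw [← autFun_apply _ ⟨x, hx⟩]
    rfl
  · rintro ⟨s, hs, h⟩
    have hn : s ∈ Subgroup.normalizer (P : Set G) := by
      rw [Subgroup.mem_normalizer_iff]
      intro x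
      constructor
      · intro hx
        rw [← h x hx]
        exact autFun_mem _ hx
      · intro hx
        -- If s x s⁻¹ lies in P, then x is its image under α⁻¹ and so lies in P too.
        have e := autFun_apply α (α⁻¹ ⟨_, hx⟩)
        rw [h _ (α⁻¹ ⟨_, hx⟩).2] at e
        have e2 : α (α⁻¹ ⟨_, hx⟩) = ⟨_, hx⟩ := by
          rw [← MulAut.mul_apply, mul_inv_cancel, MulAut.one_apply]
        rw [e2] at e
        have : x = (α⁻¹ ⟨_, hx⟩ : P) := by simpa using e
        rw [this]
        exact (α⁻¹ ⟨_, hx⟩).2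
    refine ⟨⟨s, hn⟩, hs, ?_⟩
    apply mulAut_ext
    intro x hx
    rw [h x hx, ← autFun_apply _ ⟨x, hx⟩]
    rfl

theorem autConj_le_aut {F : FusionSystem G} {P : Subgroup G} (hP : P ≤ F.carrier) :
    F.autConj P ≤ F.aut P hP := by
  intro α hα
  obtain ⟨s, hs, h⟩ := mem_autConj_iff.1 hα
  exact (mem_aut_iff_isMor hP).2 ((IsMor.of_conj hP hs).congr fun x hx => (h x hx).symm)

theorem mem_normalizer_of_finite [Finite G] {P : Subgroup G} {g : G}
    (h : ∀ x ∈ P, g * x * g⁻¹ ∈ P) : g ∈ Subgroup.normalizer (P : Set G) := by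
  rw [Subgroup.mem_normalizer_iff]
  refine fun x => ⟨h x, fun hx => ?_⟩
  obtain ⟨y, hy, e⟩ := surjOn_of_card_le (f := fun x => g * x * g⁻¹) h
    (fun x _ y _ e => by simpa using e) le_rfl _ hx
  have : y = x := by simpa using e
  rwa [← this]

end FusionSystem

/-! ### Residual subgroups and Sylow arguments in finite groups -/

section Groups

/-- A total, single-valued, multiplicative relation is the graph of a homomorphism. This suits
restricted or induced automorphisms, which are characterized by equations between elements. -/
theorem exists_hom_of_rel {X Y : Type*} [Group X] [Group Y] {A : Subgroup X} {B : Subgroup Y}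
    {rel : X → Y → Prop} (tot : ∀ a ∈ A, ∃ b ∈ B, rel a b)
    (uniq : ∀ a ∈ A, ∀ b ∈ B, ∀ b' ∈ B, rel a b → rel a b' → b = b')
    (mul : ∀ a ∈ A, ∀ a' ∈ A, ∀ b ∈ B, ∀ b' ∈ B, rel a b → rel a' b' → rel (a * a') (b * b')) :
    ∃ r : A →* B, ∀ a : A, rel a (r a) := by
  choose f hf hf' using tot
  refine ⟨MonoidHom.mk' (fun a => ⟨f a a.2, hf a a.2⟩) fun a b => ?_, fun a => hf' a a.2⟩
  exact Subtype.ext (uniq _ (A.mul_mem a.2 b.2) _ (hf _ _) _ (B.mul_mem (hf _ _) (hf _ _))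
    (hf' _ _) (mul _ a.2 _ b.2 _ (hf _ _) _ (hf _ _) (hf' _ _) (hf' _ _)))

/-- A surjection can only divide the index of a subgroup, and `compat` puts the image of H ∩ A into
K. With H and K the groups Aut_S, this transfers full automization from one fusion system or
subgroup to another. -/
theorem relIndex_dvd_of_rel {X Y : Type*} [Group X] [Group Y] {A H : Subgroup X}
    {B K : Subgroup Y} {rel : X → Y → Prop} (tot : ∀ a ∈ A, ∃ b ∈ B, rel a b)
    (uniq : ∀ a ∈ A, ∀ b ∈ B, ∀ b' ∈ B, rel a b → rel a b' → b = b')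
    (mul : ∀ a ∈ A, ∀ a' ∈ A, ∀ b ∈ B, ∀ b' ∈ B, rel a b → rel a' b' → rel (a * a') (b * b'))
    (surj : ∀ b ∈ B, ∃ a ∈ A, rel a b) (compat : ∀ a ∈ A, ∀ b ∈ B, a ∈ H → rel a b → b ∈ K) :
    K.relIndex B ∣ H.relIndex A := by
  obtain ⟨r, hr⟩ := exists_hom_of_rel tot uniq mul
  have hs : Function.Surjective r := by
    intro b
    obtain ⟨a, ha, h⟩ := surj b b.2
    exact ⟨⟨a, ha⟩, Subtype.ext (uniq a ha _ (r _).2 _ b.2 (hr ⟨a, ha⟩) h)⟩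
  have h1 : ((H.subgroupOf A).map r).index ∣ (H.subgroupOf A).index :=
    Subgroup.index_map_dvd _ hs
  refine Dvd.dvd.trans (Subgroup.index_dvd_of_le ?_) h1
  rintro _ ⟨a, ha, rfl⟩
  exact compat a a.2 _ (r a).2 ha (hr a)

variable {p : ℕ}

/-- The preimage of a normal subgroup of p-power index is again one, even if `f` is not onto. This
allows restriction maps between automorphism groups. -/
theorem mem_pResidual_of_hom (hp : p.Prime) {A B : Type*} [Group A] [Group B] (f : A →* B) {a : A}
    (ha : a ∈ pResidual p A) : f a ∈ pResidual p B := by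
  unfold pResidual at *
  rw [Subgroup.mem_sInf] at *
  rintro N ⟨hN, k, hk⟩
  refine ha (N.comap f) ⟨hN.comap f, ?_⟩
  have : (N.comap f).index ∣ p ^ k := by
    rw [← hk, Subgroup.index_comap]
    exact Subgroup.relIndex_dvd_index_of_normal _ _
  obtain ⟨j, -, hj⟩ := (Nat.dvd_prime_pow hp).1 this
  exact ⟨j, hj⟩

theorem mem_pPrimeResidual_of_hom {A B : Type*} [Group A] [Group B] (f : A →* B) {a : A}
    (ha : a ∈ pPrimeResidual p A) : f a ∈ pPrimeResidual p B := by
  unfold pPrimeResidual at *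
  rw [Subgroup.mem_sInf] at *
  rintro N ⟨hN, hk⟩
  refine ha (N.comap f) ⟨hN.comap f, ?_⟩
  refine Nat.Coprime.coprime_dvd_left ?_ hk
  rw [Subgroup.index_comap]
  exact Subgroup.relIndex_dvd_index_of_normal _ _

/-- In a family closed under meets a minimal element is the least one. Hence the two residuals
belong to the families whose infimum they are. -/
theorem sInf_mem_of_inf_mem {α : Type*} [CompleteLattice α] [Finite α] {s : Set α}
    (htop : ⊤ ∈ s) (hinf : ∀ a ∈ s, ∀ b ∈ s, a ⊓ b ∈ s) : sInf s ∈ s := by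
  obtain ⟨m, hm⟩ := s.toFinite.exists_minimal ⟨⊤, htop⟩
  have : sInf s = m := le_antisymm (sInf_le hm.prop) (le_sInf fun b hb => by
    have := hm.le_of_le (hinf m hm.prop b hb) inf_le_left
    exact this.trans inf_le_right)
  rw [this]
  exact hm.prop

theorem Subgroup.index_inf_dvd_mul {A : Type*} [Group A] (H K : Subgroup A) [K.Normal] :
    (H ⊓ K).index ∣ H.index * K.index := by
  rw [← Subgroup.relIndex_mul_index (inf_le_left : H ⊓ K ≤ H), mul_comm, Subgroup.inf_relIndex_left]
  exact Nat.mul_dvd_mul_left _ (Subgroup.relIndex_dvd_index_of_normal _ _)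

theorem pResidual_spec (hp : p.Prime) (A : Type*) [Group A] [Finite A] :
    (pResidual p A).Normal ∧ ∃ k : ℕ, (pResidual p A).index = p ^ k := by
  refine sInf_mem_of_inf_mem (s := {N : Subgroup A | N.Normal ∧ ∃ k : ℕ, N.index = p ^ k})
    ⟨inferInstance, 0, by simp⟩ ?_
  rintro N ⟨hN, k, hk⟩ M ⟨hM, l, hl⟩
  refine ⟨inferInstance, ?_⟩
  have := Subgroup.index_inf_dvd_mul N M
  rw [hk, hl, ← pow_add] at this
  obtain ⟨j, -, hj⟩ := (Nat.dvd_prime_pow hp).1 this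
  exact ⟨j, hj⟩

theorem pPrimeResidual_spec (A : Type*) [Group A] [Finite A] :
    (pPrimeResidual p A).Normal ∧ (pPrimeResidual p A).index.Coprime p := by
  refine sInf_mem_of_inf_mem (s := {N : Subgroup A | N.Normal ∧ N.index.Coprime p})
    ⟨inferInstance, by simp⟩ ?_
  rintro N ⟨hN, hk⟩ M ⟨hM, hl⟩
  exact ⟨inferInstance, Nat.Coprime.coprime_dvd_left (Subgroup.index_inf_dvd_mul N M)
    (hk.mul_left hl)⟩

/-- The index of the join divides both a power of p and the index of H, which is prime to p. -/
theorem pResidual_sup_eq_top (hp : p.Prime) {A : Type*} [Group A] [Finite A] {H : Subgroup A}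
    (hH : ¬ p ∣ H.index) : pResidual p A ⊔ H = ⊤ := by
  obtain ⟨-, k, hk⟩ := pResidual_spec hp A
  rw [← Subgroup.index_eq_one]
  have h1 : (pResidual p A ⊔ H).index ∣ p ^ k := by
    rw [← hk]
    exact Subgroup.index_dvd_of_le le_sup_left
  have h2 : (pResidual p A ⊔ H).index ∣ H.index := Subgroup.index_dvd_of_le le_sup_right
  refine Nat.eq_one_of_dvd_coprimes (a := p ^ k) (b := H.index) ?_ h1 h2
  exact Nat.Coprime.pow_left _ ((Nat.Prime.coprime_iff_not_dvd hp).2 hH)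

/-- The Frattini argument: H is a Sylow p-subgroup of A, and it lies in O^{p'}(A) because the index
of the latter is prime to p. -/
theorem pPrimeResidual_sup_normalizer_eq_top (hp : p.Prime) {A : Type*} [Group A] [Finite A]
    {H : Subgroup A} (hH : ¬ p ∣ H.index) (hpH : IsPGroup p H) :
    pPrimeResidual p A ⊔ Subgroup.normalizer (H : Set A) = ⊤ := by
  have := Fact.mk hp
  obtain ⟨hn, hi⟩ := pPrimeResidual_spec (p := p) A
  let R : Sylow p A := hpH.toSylow hH
  have hle : H ≤ pPrimeResidual p A := by
    rw [← Subgroup.relIndex_eq_one]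
    have h1 : (pPrimeResidual p A).relIndex H ∣ (pPrimeResidual p A).index :=
      Subgroup.relIndex_dvd_index_of_normal _ _
    obtain ⟨k, hk⟩ := hpH.index ((pPrimeResidual p A).subgroupOf H)
    have hk' : (pPrimeResidual p A).relIndex H = p ^ k := hk
    exact Nat.eq_one_of_dvd_coprimes (hi.pow_right k) h1 (dvd_of_eq hk')
  have := Sylow.normalizer_sup_eq_top' (P := R) (N := pPrimeResidual p A) hle
  rw [sup_comm]
  exact this

/-- Sylow's theorem in A: the index hypothesis makes H ∩ A a Sylow p-subgroup of A. -/
theorem exists_conj_le_of_not_dvd_relIndex (hp : p.Prime) {X : Type*} [Group X] [Finite X]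
    {A H K : Subgroup X} (hH : IsPGroup p H) (hi : ¬ p ∣ H.relIndex A)
    (hKA : K ≤ A) (hK : IsPGroup p K) : ∃ a ∈ A, ∀ k ∈ K, a * k * a⁻¹ ∈ H := by
  have := Fact.mk hp
  have hH' : IsPGroup p (H.subgroupOf A) := hH.comap_of_injective _ A.subtype_injective
  have hK' : IsPGroup p (K.subgroupOf A) := hK.comap_of_injective _ A.subtype_injective
  let R : Sylow p A := hH'.toSylow hi
  obtain ⟨T, hT⟩ := hK'.exists_le_sylow
  obtain ⟨a, ha⟩ := MulAction.exists_smul_eq A T R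
  refine ⟨a, a.2, fun k hk => ?_⟩
  have h1 : (⟨k, hKA hk⟩ : A) ∈ T := hT hk
  have h2 : a * ⟨k, hKA hk⟩ * a⁻¹ ∈ R := by
    change _ ∈ (R : Subgroup A)
    rw [← ha, Sylow.coe_subgroup_smul]
    exact Subgroup.smul_mem_pointwise_smul _ (MulAut.conj a) _ h1
  exact h2

theorem le_of_normal_of_not_dvd_relIndex (hp : p.Prime) {X : Type*} [Group X] [Finite X]
    {A H K : Subgroup X} (hH : IsPGroup p H) (hi : ¬ p ∣ H.relIndex A)
    (hKA : K ≤ A) (hK : IsPGroup p K) (hn : ∀ a ∈ A, ∀ k ∈ K, a * k * a⁻¹ ∈ K) : K ≤ H := by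
  obtain ⟨a, ha, h⟩ := exists_conj_le_of_not_dvd_relIndex hp hH hi hKA hK
  intro k hk
  have := h _ (hn a⁻¹ (A.inv_mem ha) k hk)
  simpa [mul_assoc] using this

end Groups

/-! ### Automorphisms stabilizing a chain of strongly closed subgroups -/

namespace FusionSystem

variable {G : Type*} [Group G]

theorem IsStronglyClosed.isMor_mem_iff {F : FusionSystem G} {N : Subgroup G}
    (hN : F.IsStronglyClosed N) {P : Subgroup G} {f : G → G} (h : F.IsMor P f) {x : G}
    (hx : x ∈ P) : f x ∈ N ↔ x ∈ N := by
  obtain ⟨φ, hφ, e⟩ := h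
  rw [← e x hx]
  exact hN.mem_iff hφ ⟨x, hx⟩

theorem isStronglyClosed_iff {F : FusionSystem G} {N : Subgroup G} : F.IsStronglyClosed N ↔
    N ≤ F.carrier ∧ ∀ P f, F.IsMor P f → ∀ x ∈ P, x ∈ N → f x ∈ N := by
  refine ⟨fun h => ⟨h.1, fun P f hf x hx hxN => (h.isMor_mem_iff hf hx).2 hxN⟩,
    fun h => ⟨h.1, fun P φ hφ x hx => ?_⟩⟩
  have := h.2 P _ (isMor_toFun hφ) x x.2 hx
  rwa [toFun_apply φ x.2] at this

/-- The automorphisms of `P` in `F` which stabilize a chain of strongly closed subgroups. -/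
def chainStab (F : FusionSystem G) (P : Subgroup G) (hP : P ≤ F.carrier) {C : ℕ → Subgroup G}
    (hC : ∀ i, F.IsStronglyClosed (C i)) : Subgroup (MulAut P) where
  carrier := {α | α ∈ F.aut P hP ∧
    ∀ i, ∀ x ∈ P, x ∈ C (i + 1) → autFun α x * x⁻¹ ∈ C i}
  one_mem' := by
    refine ⟨Subgroup.one_mem _, fun i x hx _ => ?_⟩
    rw [← autFun_apply 1 ⟨x, hx⟩]
    simp
  mul_mem' := by
    rintro α β ⟨ha, ha'⟩ ⟨hb, hb'⟩
    refine ⟨Subgroup.mul_mem _ ha hb, fun i x hx hxi => ?_⟩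
    rw [autFun_mul _ _ hx]
    have h1 := ((hC (i + 1)).isMor_mem_iff (autFun_iso hb).mor hx).2 hxi
    have := (C i).mul_mem (ha' i _ (autFun_mem β hx) h1) (hb' i x hx hxi)
    simpa [mul_assoc] using this
  inv_mem' := by
    rintro α ⟨ha, ha'⟩
    refine ⟨Subgroup.inv_mem _ ha, fun i x hx hxi => ?_⟩
    have h1 := ((hC (i + 1)).isMor_mem_iff (autFun_iso ha).inv_mor hx).2 hxi
    have := (C i).inv_mem (ha' i _ (autFun_mem α⁻¹ hx) h1)
    rw [(autFun_iso ha).right x hx] at this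
    simpa using this

theorem chainStab_conj {F : FusionSystem G} {P : Subgroup G} {hP : P ≤ F.carrier}
    {C : ℕ → Subgroup G} (hC : ∀ i, F.IsStronglyClosed (C i)) :
    ∀ β ∈ F.aut P hP, ∀ α ∈ F.chainStab P hP hC, β * α * β⁻¹ ∈ F.chainStab P hP hC := by
  rintro β hb α ⟨ha, ha'⟩
  refine ⟨Subgroup.mul_mem _ (Subgroup.mul_mem _ hb ha) (Subgroup.inv_mem _ hb),
    fun i x hx hxi => ?_⟩
  have hy := autFun_mem β⁻¹ hx
  have hyi := ((hC (i + 1)).isMor_mem_iff (autFun_iso hb).inv_mor hx).2 hxi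
  have h1 := ha' i _ hy hyi
  have hm : autFun α (autFun β⁻¹ x) * (autFun β⁻¹ x)⁻¹ ∈ P :=
    P.mul_mem (autFun_mem _ hy) (P.inv_mem hy)
  have h2 := ((hC i).isMor_mem_iff (autFun_iso hb).mor hm).2 h1
  rw [(autFun_iso hb).mor.homOn _ (autFun_mem _ hy) _ (P.inv_mem hy),
    (autFun_iso hb).mor.homOn.map_inv hy, (autFun_iso hb).right x hx] at h2
  rwa [autFun_mul _ _ hx, autFun_mul _ _ hy]

/-- An automorphism of order prime to p which acts trivially on the factors of a chain in a p-group
is trivial. This is proved by climbing the chain one term at a time. -/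
theorem isPGroup_chainStab {p : ℕ} (hp : p.Prime) (hG : IsPGroup p G) [Finite G]
    {F : FusionSystem G} {P : Subgroup G} {hP : P ≤ F.carrier}
    {C : ℕ → Subgroup G} (hC : ∀ i, F.IsStronglyClosed (C i)) (h0 : C 0 = ⊥) {m : ℕ}
    (hm : P ≤ C m) : IsPGroup p (F.chainStab P hP hC) := by
  have key : ∀ α ∈ F.chainStab P hP hC, ∀ n, p.Coprime n → α ^ n = 1 → α = 1 := by
    rintro α ⟨-, hα⟩ n hn hαn
    have hfix : ∀ i, ∀ x ∈ P, x ∈ C i → autFun α x = x := by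
      intro i
      induction i with
      | zero =>
        intro x hx hx0
        rw [h0, Subgroup.mem_bot] at hx0
        subst hx0
        simpa using (autFun_apply α 1).symm
      | succ i ih =>
        intro x hx hxi
        have hz := hα i x hx hxi
        have hzP : autFun α x * x⁻¹ ∈ P := P.mul_mem (autFun_mem _ hx) (P.inv_mem hx)
        have hzf := ih _ hzP hz
        set z := autFun α x * x⁻¹ with hzd
        have hx1 : autFun α x = z * x := by simp [hzd]
        -- The commutator z = α(x)x⁻¹ lies one term lower and so is fixed by α. Iterating α
        -- therefore multiplies x by powers of z, whence zⁿ = 1; as z has p-power order, z = 1.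
        have hpow : ∀ j : ℕ, autFun (α ^ j) x = z ^ j * x := by
          intro j
          induction j with
          | zero => rw [pow_zero, ← autFun_apply 1 ⟨x, hx⟩]; simp
          | succ j hj =>
            rw [pow_succ', autFun_mul _ _ hx, hj]
            have h2 : ∀ j : ℕ, autFun α (z ^ j) = z ^ j := by
              intro j
              have h3 := autFun_apply α (⟨z, hzP⟩ ^ j)
              rw [map_pow] at h3
              have h4 : α ⟨z, hzP⟩ = ⟨z, hzP⟩ := Subtype.ext ((autFun_apply α ⟨z, hzP⟩).trans hzf)
              rw [h4] at h3
              exact h3.symm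
            have h5 := autFun_apply α (⟨z, hzP⟩ ^ j * ⟨x, hx⟩)
            rw [map_mul, Subgroup.coe_mul, autFun_apply, autFun_apply] at h5
            change autFun α (z ^ j) * autFun α x = autFun α (z ^ j * x) at h5
            rw [← h5, h2, pow_succ, mul_assoc (z ^ j) z x, ← hx1]
        have hz1 : z ^ n = 1 := by
          have := hpow n
          rw [hαn, ← autFun_apply 1 ⟨x, hx⟩] at this
          simpa using this
        obtain ⟨k, hk⟩ := hG z
        have h1 : orderOf z ∣ n := orderOf_dvd_of_pow_eq_one hz1
        have h2 : orderOf z ∣ p ^ k := orderOf_dvd_of_pow_eq_one hk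
        have h3 := Nat.eq_one_of_dvd_coprimes (hn.pow_left k) h2 h1
        rw [orderOf_eq_one_iff] at h3
        rw [hx1, h3, one_mul]
    apply mulAut_ext
    intro x hx
    rw [hfix m x hx (hm hx), ← autFun_apply 1 ⟨x, hx⟩]
    rfl
  rintro ⟨α, hα⟩
  -- Here p^k is the p-part of the order of α, so α^(p^k) is killed by n, which is prime to p.
  obtain ⟨k, n, hn, hkn⟩ := Nat.exists_eq_pow_mul_and_not_dvd (orderOf_pos α).ne' p hp.ne_one
  refine ⟨k, Subtype.ext ?_⟩
  refine key (α ^ p ^ k) (Subgroup.pow_mem _ hα _) n ((Nat.Prime.coprime_iff_not_dvd hp).2 hn) ?_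
  rw [← pow_mul, ← hkn, pow_orderOf_eq_one]

end FusionSystem

/-! ### Roberts–Shpectorov saturation and Alperin's fusion theorem -/

namespace FusionSystem

variable {G : Type*} [Group G]

theorem range_eq_img {P : Subgroup G} (φ : P →* G) : φ.range = img (toFun φ) P := by
  have hm : HomOn (toFun φ) P := by
    intro x hx y hy
    rw [toFun_apply φ hx, toFun_apply φ hy, toFun_apply φ (P.mul_mem hx hy), ← map_mul]
    rfl
  ext y
  rw [hm.mem_img]
  constructor
  · rintro ⟨⟨x, hx⟩, rfl⟩
    exact ⟨x, hx, toFun_apply φ hx⟩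
  · rintro ⟨x, hx, rfl⟩
    exact ⟨⟨x, hx⟩, (toFun_apply φ hx).symm⟩

theorem isConj_iff {F : FusionSystem G} {P Q : Subgroup G} :
    F.IsConj P Q ↔ ∃ f g, F.Iso P Q f g := by
  constructor
  · rintro ⟨φ, hφ, rfl⟩
    obtain ⟨g, hg⟩ := (isMor_toFun hφ).iso
    rw [range_eq_img]
    exact ⟨_, g, hg⟩
  · rintro ⟨f, g, h⟩
    obtain ⟨φ, hφ, e⟩ := h.mor
    refine ⟨φ, hφ, ?_⟩
    ext y
    constructor
    · rintro ⟨⟨x, hx⟩, rfl⟩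
      rw [e x hx]
      exact h.map x hx
    · intro hy
      exact ⟨⟨g y, h.inv_map y hy⟩, (e _ _).trans (h.right y hy)⟩

/-- The subgroup `N_f` of those `g ∈ N_S(P)` for which `f c_g f⁻¹` is conjugation by an element
of `S`. -/
def extG (F : FusionSystem G) (P : Subgroup G) (f : G → G) : Subgroup G where
  carrier := {g | g ∈ F.carrier ∧ g ∈ Subgroup.normalizer (P : Set G) ∧
    ∃ h ∈ F.carrier, ∀ x ∈ P, f (g * x * g⁻¹) = h * f x * h⁻¹}
  one_mem' := ⟨F.carrier.one_mem, Subgroup.one_mem _, 1, F.carrier.one_mem, fun x _ => by simp⟩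
  mul_mem' := by
    rintro a b ⟨ha, ha', h, hh, H⟩ ⟨hb, hb', k, hk, K⟩
    refine ⟨F.carrier.mul_mem ha hb, Subgroup.mul_mem _ ha' hb', h * k,
      F.carrier.mul_mem hh hk, fun x hx => ?_⟩
    have h1 := H _ ((Subgroup.mem_normalizer_iff.1 hb' x).1 hx)
    rw [K x hx] at h1
    simp only [mul_assoc, mul_inv_rev] at h1 ⊢
    exact h1
  inv_mem' := by
    rintro a ⟨ha, ha', h, hh, H⟩
    have ha'' := Subgroup.inv_mem _ ha'
    refine ⟨F.carrier.inv_mem ha, ha'', h⁻¹, F.carrier.inv_mem hh, fun x hx => ?_⟩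
    have h1 := H _ ((Subgroup.mem_normalizer_iff.1 ha'' x).1 hx)
    have e : a * (a⁻¹ * x * a⁻¹⁻¹) * a⁻¹ = x := by simp [mul_assoc]
    rw [e] at h1
    rw [h1]
    simp [mul_assoc]

theorem IsMor.le_extG {F : FusionSystem G} {P : Subgroup G} {f : G → G} (h : F.IsMor P f) :
    P ≤ F.extG P f := fun g hg =>
  ⟨h.dom_le hg, Subgroup.le_normalizer hg, f g, h.mem hg, fun _ hx => h.homOn.map_conj hg hx⟩

/-- Subgroups which are fully automized and receptive. -/
structure Good (p : ℕ) (F : FusionSystem G) (Q : Subgroup G) : Prop where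
  le : Q ≤ F.carrier
  automized : ¬ p ∣ (F.autConj Q).relIndex (F.aut Q le)
  receptive : ∀ P f g, F.Iso P Q f g → ∃ f', F.IsMor (F.extG P f) f' ∧ ∀ x ∈ P, f' x = f x

/-- Saturation in the sense of Roberts and Shpectorov: each subgroup is isomorphic to one which is
fully automized and receptive. -/
def RSat (p : ℕ) (F : FusionSystem G) : Prop :=
  ∀ P ≤ F.carrier, ∃ Q f g, F.Iso P Q f g ∧ Good p F Q

theorem exists_autConj {F : FusionSystem G} {P : Subgroup G} {n : G} (hn : n ∈ F.carrier)
    (hn' : n ∈ Subgroup.normalizer (P : Set G)) :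
    ∃ α ∈ F.autConj P, ∀ x ∈ P, autFun α x = n * x * n⁻¹ := by
  refine ⟨_, ⟨⟨n, hn'⟩, hn, rfl⟩, fun x hx => ?_⟩
  rw [← autFun_apply _ ⟨x, hx⟩]
  rfl

theorem isPGroup_autConj {p : ℕ} (hG : IsPGroup p G) (F : FusionSystem G) (P : Subgroup G) :
    IsPGroup p (F.autConj P) :=
  ((hG.to_subgroup _).to_subgroup _).map _

theorem Iso.autFun_congr {F : FusionSystem G} {P Q : Subgroup G} {f g : G → G}
    (h : F.Iso P Q f g) (α : MulAut P) {y : G} (hy : y ∈ Q) :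
    autFun (MulAut.congr h.toMulEquiv α) y = f (autFun α (g y)) := by
  rw [← autFun_apply _ ⟨y, hy⟩, ← autFun_apply α ⟨g y, h.inv_map y hy⟩]
  rfl

theorem Iso.congr_mem_aut {F : FusionSystem G} {P Q : Subgroup G} {f g : G → G}
    (h : F.Iso P Q f g) {α : MulAut P} {hP : P ≤ F.carrier} (hα : α ∈ F.aut P hP)
    (hQ : Q ≤ F.carrier) : MulAut.congr h.toMulEquiv α ∈ F.aut Q hQ := by
  rw [mem_aut_iff_isMor]
  refine ((h.inv_mor.comp (autFun_iso hα).mor h.inv_map).comp h.mor fun y hy =>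
    autFun_mem α (h.inv_map y hy)).congr fun y hy => ?_
  exact (h.autFun_congr α hy).symm

/-- The isomorphism `f` carries Aut_S(P) to a p-subgroup of Aut_F(Q), and Sylow's theorem provides α
∈ Aut_F(Q) conjugating it into Aut_S(Q). Then N_{αf} is all of N_S(P), and receptivity of Q applies
to αf. The extension χ need not agree with `f` on P. -/
theorem Good.exists_extension [Finite G] {p : ℕ} (hp : p.Prime) (hG : IsPGroup p G)
    {F : FusionSystem G} {P Q : Subgroup G} (hQ : Good p F Q) {f g : G → G}
    (h : F.Iso P Q f g) : ∃ χ, F.IsMor (Subgroup.normalizer (P : Set G) ⊓ F.carrier) χ ∧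
      ∀ x ∈ P, χ x ∈ Q := by
  have hP := h.mor.dom_le
  have hA : (F.autConj P).map (MulAut.congr h.toMulEquiv).toMonoidHom ≤ F.aut Q hQ.le := by
    rintro _ ⟨α, hα, rfl⟩
    exact h.congr_mem_aut (autConj_le_aut hP hα) _
  obtain ⟨α, hα, hα'⟩ := exists_conj_le_of_not_dvd_relIndex hp (isPGroup_autConj hG F Q)
    hQ.automized hA ((isPGroup_autConj hG F P).map _)
  have hi := h.trans (autFun_iso hα)
  obtain ⟨χ, hχ, hχ'⟩ := hQ.receptive _ _ _ hi
  refine ⟨χ, hχ.mono ?_, fun x hx => ?_⟩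
  · rintro n ⟨hn, hnS⟩
    obtain ⟨β, hβ, hβ'⟩ := exists_autConj hnS hn
    obtain ⟨s, hs, hs'⟩ := mem_autConj_iff.1 (hα' _ ⟨β, hβ, rfl⟩)
    refine ⟨hnS, hn, s, hs, fun x hx => ?_⟩
    have hy := autFun_mem α (h.map x hx)
    have e := hs' _ hy
    rw [autFun_mul _ _ hy, autFun_mul _ _ (autFun_mem _ hy),
      (autFun_iso hα).left _ (h.map x hx)] at e
    have e2 := h.autFun_congr β (h.map x hx)
    rw [h.left x hx, hβ' x hx] at e2
    change autFun α (autFun (MulAut.congr h.toMulEquiv β) (f x)) = _ at e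
    rw [e2] at e
    exact e
  · rw [hχ' x hx]
    exact autFun_mem α (h.map x hx)

/-- Receptivity is pulled back from Q along χ. The composite χf extends to a morphism ω on N_f; if a
∈ N_f acts through s ∈ N_S(P), then ω(a) and χ(s) differ by an element of C_S(Q), which `hc` puts in
the image of χ. So χ⁻¹ω is defined on N_f and extends `f`. -/
theorem receptive_of_extension {F : FusionSystem G} {P Q : Subgroup G}
    {χ : G → G} (hQ : ∀ P f g, F.Iso P Q f g → ∃ f', F.IsMor (F.extG P f) f' ∧ ∀ x ∈ P, f' x = f x)
    (hχ : F.IsMor (Subgroup.normalizer (P : Set G) ⊓ F.carrier) χ) {χ' : G → G}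
    (hPQ : F.Iso P Q χ χ')
    (hc : ∀ c ∈ Subgroup.centralizer (Q : Set G) ⊓ F.carrier,
      ∃ d ∈ Subgroup.normalizer (P : Set G) ⊓ F.carrier, χ d = c) :
    ∀ R f g, F.Iso R P f g → ∃ f', F.IsMor (F.extG R f) f' ∧ ∀ x ∈ R, f' x = f x := by
  intro R f g h
  obtain ⟨ω, hω, hω'⟩ := hQ _ _ _ (h.trans hPQ)
  obtain ⟨κ, hκ⟩ := hχ.iso
  have hPN : P ≤ Subgroup.normalizer (P : Set G) ⊓ F.carrier :=
    le_inf Subgroup.le_normalizer hPQ.mor.dom_le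
  have key : ∀ a ∈ F.extG R f, a ∈ F.extG R (χ ∘ f) ∧
      ω a ∈ img χ (Subgroup.normalizer (P : Set G) ⊓ F.carrier) := by
    rintro a ⟨ha, ha', s, hs, H⟩
    -- Conjugation by s on P is transported by `f` from conjugation by a on R, and likewise for the
    -- inverses.
    have hsN : s ∈ Subgroup.normalizer (P : Set G) := by
      have h1 : ∀ y, y ∈ P → s * y * s⁻¹ ∈ P := by
        intro y hy
        have := H _ (h.inv_map y hy)
        rw [h.right y hy] at this
        rw [← this]
        exact h.map _ ((Subgroup.mem_normalizer_iff.1 ha' _).1 (h.inv_map y hy))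
      have h2 : ∀ y, y ∈ P → s⁻¹ * y * s⁻¹⁻¹ ∈ P := by
        intro y hy
        have ha'' := Subgroup.inv_mem _ ha'
        have hz := (Subgroup.mem_normalizer_iff.1 ha'' _).1 (h.inv_map y hy)
        have := H _ hz
        have e : a * (a⁻¹ * g y * a⁻¹⁻¹) * a⁻¹ = g y := by simp [mul_assoc]
        rw [e, h.right y hy] at this
        have e2 : s⁻¹ * y * s⁻¹⁻¹ = f (a⁻¹ * g y * a⁻¹⁻¹) := by
          calc s⁻¹ * y * s⁻¹⁻¹
            _ = s⁻¹ * (s * f (a⁻¹ * g y * a⁻¹⁻¹) * s⁻¹) * s⁻¹⁻¹ := by rw [← this]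
            _ = _ := by simp [mul_assoc]
        rw [e2]
        exact h.map _ hz
      rw [Subgroup.mem_normalizer_iff]
      refine fun y => ⟨h1 y, fun hy => ?_⟩
      have := h2 _ hy
      simpa [mul_assoc] using this
    have hsm : s ∈ Subgroup.normalizer (P : Set G) ⊓ F.carrier := ⟨hsN, hs⟩
    have hext : a ∈ F.extG R (χ ∘ f) := by
      refine ⟨ha, ha', χ s, hχ.mem hsm, fun x hx => ?_⟩
      simp only [Function.comp]
      rw [H x hx, hχ.homOn.map_conj hsm (hPN (h.map x hx))]
    refine ⟨hext, ?_⟩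
    have hcen : (χ s)⁻¹ * ω a ∈ Subgroup.centralizer (Q : Set G) ⊓ F.carrier := by
      refine ⟨?_, F.carrier.mul_mem (F.carrier.inv_mem (hχ.mem hsm)) (hω.mem hext)⟩
      refine Subgroup.mem_centralizer_iff.2 fun y hy => ?_
      have hx := h.inv_map _ (hPQ.inv_map y hy)
      set x := g (χ' y)
      have hxy : χ (f x) = y := by rw [h.right _ (hPQ.inv_map y hy), hPQ.right y hy]
      have e1 := hω.homOn.map_conj hext ((h.trans hPQ).mor.le_extG hx)
      have hax := (Subgroup.mem_normalizer_iff.1 ha' _).1 hx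
      rw [hω' _ hax, hω' _ hx] at e1
      simp only [Function.comp] at e1
      rw [H x hx, hχ.homOn.map_conj hsm (hPN (h.map x hx)), hxy] at e1
      have e2 : y = (χ s)⁻¹ * (ω a * y * (ω a)⁻¹) * χ s := by
        rw [← e1]
        group
      calc y * ((χ s)⁻¹ * ω a) = (χ s)⁻¹ * (ω a * y * (ω a)⁻¹) * χ s * ((χ s)⁻¹ * ω a) := by
            rw [← e2]
        _ = _ := by group
    obtain ⟨d, hd, hd'⟩ := hc _ hcen
    refine hχ.homOn.mem_img.2 ⟨s * d, Subgroup.mul_mem _ hsm hd, ?_⟩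
    rw [hχ.homOn s hsm d hd, hd']
    group
  refine ⟨κ ∘ ω, (hω.mono fun a ha => (key a ha).1).comp hκ.inv_mor fun a ha => (key a ha).2,
    fun x hx => ?_⟩
  simp only [Function.comp]
  rw [hω' x hx]
  exact hκ.left _ (hPN (h.map x hx))

/-- Conjugation by χ identifies Aut_F(Q) with Aut_F(P), and `hc` says that it takes Aut_S(Q) into
Aut_S(P). -/
theorem Iso.not_dvd_relIndex {p : ℕ} {F : FusionSystem G} {P Q : Subgroup G} {χ χ' : G → G}
    (h : F.Iso P Q χ χ') (hP : P ≤ F.carrier) (hQ : Q ≤ F.carrier)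
    (hi : ¬ p ∣ (F.autConj Q).relIndex (F.aut Q hQ))
    (hc : ∀ s ∈ Subgroup.normalizer (Q : Set G) ⊓ F.carrier,
      ∃ d ∈ F.carrier, ∀ x ∈ P, χ' (s * χ x * s⁻¹) = d * x * d⁻¹) :
    ¬ p ∣ (F.autConj P).relIndex (F.aut P hP) := by
  have hd := relIndex_dvd_of_rel (A := F.aut Q hQ) (H := F.autConj Q) (B := F.aut P hP)
    (K := F.autConj P) (rel := fun a b => b = MulAut.congr h.symm.toMulEquiv a)
    (fun a ha => ⟨_, h.symm.congr_mem_aut ha hP, rfl⟩)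
    (fun a _ b _ b' _ hb hb' => hb.trans hb'.symm)
    (by
      rintro a _ a' _ b _ b' _ rfl rfl
      rw [map_mul])
    (fun b hb => ⟨_, h.congr_mem_aut hb hQ, by
      ext x
      simp only [autFun_apply]
      rw [h.symm.autFun_congr _ x.2, h.autFun_congr _ (h.map x x.2), h.left _ x.2,
        h.left _ (autFun_mem b x.2)]⟩)
    (by
      rintro a _ b _ ha rfl
      obtain ⟨⟨s, hs⟩, hs', rfl⟩ := ha
      obtain ⟨d, hd, hd'⟩ := hc s ⟨hs, hs'⟩
      refine mem_autConj_iff.2 ⟨d, hd, fun x hx => ?_⟩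
      rw [h.symm.autFun_congr _ hx, ← hd' x hx, ← autFun_apply _ ⟨_, h.map x hx⟩]
      rfl)
  exact fun hdvd => hi (hdvd.trans hd)

theorem mem_normalizer_of_mem_centralizer {P : Subgroup G} {c : G}
    (h : c ∈ Subgroup.centralizer (P : Set G)) : c ∈ Subgroup.normalizer (P : Set G) := by
  rw [Subgroup.mem_centralizer_iff] at h
  have h' := fun x hx => mul_inv_eq_of_eq_mul (h x hx).symm
  rw [Subgroup.mem_normalizer_iff]
  refine fun x => ⟨fun hx => ?_, fun hx => ?_⟩
  · rw [h' x hx]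
    exact hx
  · have := h _ hx
    have e : c * x * c⁻¹ = x := by simpa [mul_assoc] using this.symm
    rwa [e] at hx

theorem conj_mem_of_mem_normalizer {P : Subgroup G} {n x : G}
    (h : n ∈ Subgroup.normalizer (P : Set G)) (hx : x ∈ P) : n * x * n⁻¹ ∈ P :=
  (Subgroup.mem_normalizer_iff.1 h x).1 hx

section Saturated

variable [Finite G] {p : ℕ} {F : FusionSystem G}

theorem IsFullyNormalized.good (hp : p.Prime) (hF : F.IsSaturated p) {P : Subgroup G}
    (hP : F.IsFullyNormalized P) : Good p F P where
  le := hP.1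
  automized := by
    have := Fact.mk hp
    obtain ⟨R, hR⟩ := hF.sylow P hP.1 hP
    have e : (F.autConj P).relIndex (F.aut P hP.1) = (R : Subgroup (F.aut P hP.1)).index := by
      rw [← hR, Subgroup.relIndex, Subgroup.subgroupOf, Subgroup.comap_map_eq_self_of_injective]
      exact Subgroup.subtype_injective _
    rw [e]
    exact R.not_dvd_index
  receptive := by
    intro Q f g h
    obtain ⟨φ, hφ, e⟩ := h.mor
    have hr : φ.range = P := by
      ext y
      constructor
      · rintro ⟨⟨x, hx⟩, rfl⟩
        rw [e x hx]
        exact h.map x hx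
      · intro hy
        exact ⟨⟨g y, h.inv_map y hy⟩, (e _ _).trans (h.right y hy)⟩
    obtain ⟨φ', hφ', e'⟩ := hF.extension Q φ hφ (by
      rw [hr]
      exact hF.fullyCentralized P hP)
    have hle : F.extG Q f ≤ F.extGroup φ := by
      rintro a ⟨ha, ha', s, hs, H⟩
      refine ⟨ha, ha', s, hs, fun x => ?_⟩
      rw [e, e x x.2]
      exact H x x.2
    refine ⟨toFun φ', (isMor_toFun hφ').mono hle, fun x hx => ?_⟩
    have hx' := hle (h.mor.le_extG hx)
    rw [toFun_apply φ' hx', e' x hx hx', e x hx]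

/-- An F-conjugate with normalizer in S of largest order is fully normalized, and hence good. -/
theorem IsSaturated.rsat (hp : p.Prime) (hF : F.IsSaturated p) : RSat p F := by
  intro P hP
  obtain ⟨Q, hQ, hmax⟩ := Set.exists_max_image {Q | ∃ f g, F.Iso P Q f g}
    (fun Q => Nat.card ↥(Subgroup.normalizer (Q : Set G) ⊓ F.carrier)) (Set.toFinite _)
    ⟨P, id, id, .refl hP⟩
  obtain ⟨f, g, h⟩ := hQ
  refine ⟨Q, f, g, h, IsFullyNormalized.good hp hF ⟨h.inv_mor.dom_le, fun R hR => ?_⟩⟩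
  obtain ⟨f', g', h'⟩ := isConj_iff.1 hR
  exact hmax R ⟨_, _, h.trans h'⟩

theorem map_mem_normalizer {P Q : Subgroup G} {χ χ' : G → G}
    (hχ : F.IsMor (Subgroup.normalizer (P : Set G) ⊓ F.carrier) χ) (h : F.Iso P Q χ χ') {d : G}
    (hd : d ∈ Subgroup.normalizer (P : Set G) ⊓ F.carrier) :
    χ d ∈ Subgroup.normalizer (Q : Set G) ⊓ F.carrier := by
  have hPN : P ≤ Subgroup.normalizer (P : Set G) ⊓ F.carrier :=
    le_inf Subgroup.le_normalizer h.mor.dom_le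
  refine ⟨mem_normalizer_of_finite fun y hy => ?_, hχ.mem hd⟩
  have := hχ.homOn.map_conj hd (hPN (h.inv_map y hy))
  rw [h.right y hy] at this
  rw [← this]
  exact h.map _ (conj_mem_of_mem_normalizer hd.1 (h.inv_map y hy))

theorem RSat.exists_extension (hp : p.Prime) (hG : IsPGroup p G) (hF : RSat p F) {P : Subgroup G}
    (hP : P ≤ F.carrier) : ∃ Q χ χ', Good p F Q ∧
      F.IsMor (Subgroup.normalizer (P : Set G) ⊓ F.carrier) χ ∧ F.Iso P Q χ χ' := by
  obtain ⟨Q, f, g, h, hQ⟩ := hF P hP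
  obtain ⟨χ, hχ, hχ'⟩ := hQ.exists_extension hp hG h
  obtain ⟨χ', hi⟩ := (hχ.mono (le_inf Subgroup.le_normalizer hP)).iso_of_card_le hχ'
    (le_of_eq h.card_eq.symm)
  exact ⟨Q, χ, χ', hQ, hχ, hi⟩

/-- The map χ from N_S(P) towards a good conjugate Q embeds C_S(P) in C_S(Q). As P is fully
centralized this is onto, which is what `receptive_of_extension` needs. -/
theorem RSat.receptive (hp : p.Prime) (hG : IsPGroup p G) (hF : RSat p F) {P : Subgroup G}
    (hP : F.IsFullyCentralized P) :
    ∀ R f g, F.Iso R P f g → ∃ f', F.IsMor (F.extG R f) f' ∧ ∀ x ∈ R, f' x = f x := by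
  obtain ⟨Q, χ, χ', hQ, hχ, hi⟩ := hF.exists_extension hp hG hP.1
  have hPN : P ≤ Subgroup.normalizer (P : Set G) ⊓ F.carrier :=
    le_inf Subgroup.le_normalizer hi.mor.dom_le
  have hCN : Subgroup.centralizer (P : Set G) ⊓ F.carrier ≤
      Subgroup.normalizer (P : Set G) ⊓ F.carrier :=
    fun c hc => ⟨mem_normalizer_of_mem_centralizer hc.1, hc.2⟩
  refine receptive_of_extension hQ.receptive hχ hi fun c hc => ?_
  obtain ⟨d, hd, e⟩ := surjOn_of_card_le
    (A := Subgroup.centralizer (P : Set G) ⊓ F.carrier)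
    (B := Subgroup.centralizer (Q : Set G) ⊓ F.carrier) (f := χ) (fun d hd => by
      refine ⟨?_, hχ.mem (hCN hd)⟩
      refine Subgroup.mem_centralizer_iff.2 fun y hy => ?_
      have hx := hi.inv_map y hy
      have := Subgroup.mem_centralizer_iff.1 hd.1 _ hx
      have h2 := congrArg χ this
      rwa [hχ.homOn _ (hPN hx) _ (hCN hd), hχ.homOn _ (hCN hd) _ (hPN hx), hi.right y hy] at h2)
    (fun x hx y hy e => hχ.inj (hCN hx) (hCN hy) e)
    (hP.2 Q (isConj_iff.2 ⟨_, _, hi⟩)) c hc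
  exact ⟨d, hCN hd, e⟩

/-- Now χ maps N_S(P) onto N_S(Q), Q a good conjugate, by comparison of orders; so both properties
come back from Q to P. -/
theorem RSat.good_of_isFullyNormalized (hp : p.Prime) (hG : IsPGroup p G) (hF : RSat p F)
    {P : Subgroup G} (hP : F.IsFullyNormalized P) : Good p F P := by
  obtain ⟨Q, χ, χ', hQ, hχ, hi⟩ := hF.exists_extension hp hG hP.1
  have hPN : P ≤ Subgroup.normalizer (P : Set G) ⊓ F.carrier :=
    le_inf Subgroup.le_normalizer hi.mor.dom_le
  have hs : ∀ c ∈ Subgroup.normalizer (Q : Set G) ⊓ F.carrier,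
      ∃ d ∈ Subgroup.normalizer (P : Set G) ⊓ F.carrier, χ d = c :=
    surjOn_of_card_le (fun d hd => map_mem_normalizer hχ hi hd)
      (fun x hx y hy e => hχ.inj hx hy e) (hP.2 Q (isConj_iff.2 ⟨_, _, hi⟩))
  refine ⟨hP.1, hi.not_dvd_relIndex hP.1 hQ.le hQ.automized fun s hsm => ?_,
    receptive_of_extension hQ.receptive hχ hi fun c hc =>
      hs c ⟨mem_normalizer_of_mem_centralizer hc.1, hc.2⟩⟩
  obtain ⟨d, hd, rfl⟩ := hs s hsm
  refine ⟨d, hd.2, fun x hx => ?_⟩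
  rw [← hχ.homOn.map_conj hd (hPN hx)]
  exact hi.left _ (conj_mem_of_mem_normalizer hd.1 hx)

/-- For any isomorphism g : Q → P, the group N_g contains C_S(Q). Receptivity extends g there, and
the extension embeds C_S(Q) in C_S(P). -/
theorem Good.isFullyCentralized {P : Subgroup G} (hP : Good p F P) : F.IsFullyCentralized P := by
  refine ⟨hP.le, fun Q hQ => ?_⟩
  obtain ⟨f, g, h⟩ := isConj_iff.1 hQ
  obtain ⟨f', hf', e⟩ := hP.receptive _ _ _ h.symm
  have hCN : Subgroup.centralizer (Q : Set G) ⊓ F.carrier ≤ F.extG Q g := by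
    rintro c ⟨hc, hcS⟩
    refine ⟨hcS, mem_normalizer_of_mem_centralizer hc, 1, F.carrier.one_mem, fun x hx => ?_⟩
    rw [mul_inv_eq_of_eq_mul (Subgroup.mem_centralizer_iff.1 hc x hx).symm]
    simp
  refine card_le_of_injOn (f := f') (fun c hc => ⟨?_, hf'.mem (hCN hc)⟩)
    fun x hx y hy e => hf'.inj (hCN hx) (hCN hy) e
  refine Subgroup.mem_centralizer_iff.2 fun y hy => ?_
  have hx := h.map y hy
  have hx' := h.symm.mor.le_extG hx
  have h2 := congrArg f' (Subgroup.mem_centralizer_iff.1 hc.1 _ hx)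
  rwa [hf'.homOn _ hx' _ (hCN hc), hf'.homOn _ (hCN hc) _ hx', e _ hx, h.left y hy] at h2

theorem RSat.isSaturated (hp : p.Prime) (hG : IsPGroup p G) (hF : RSat p F) :
    F.IsSaturated p where
  fullyCentralized P hP := (hF.good_of_isFullyNormalized hp hG hP).isFullyCentralized
  sylow P hP hn := by
    have := Fact.mk hp
    have hg := hF.good_of_isFullyNormalized hp hG hn
    refine ⟨((isPGroup_autConj hG F P).comap_of_injective _
      (F.aut P hP).subtype_injective).toSylow hg.automized, ?_⟩
    change ((F.autConj P).subgroupOf (F.aut P hP)).map (F.aut P hP).subtype = _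
    rw [Subgroup.subgroupOf_map_subtype, inf_eq_left]
    exact autConj_le_aut hP
  extension P φ hφ hc := by
    obtain ⟨g, h⟩ := (isMor_toFun hφ).iso
    rw [range_eq_img] at hc
    obtain ⟨f', hf', e⟩ := hF.receptive hp hG hc _ _ _ h
    have hle : F.extGroup φ ≤ F.extG P (toFun φ) := by
      rintro a ⟨ha, ha', s, hs, H⟩
      refine ⟨ha, ha', s, hs, fun x hx => ?_⟩
      rw [toFun_apply φ (conj_mem_of_mem_normalizer ha' hx), toFun_apply φ hx]
      exact H ⟨x, hx⟩
    obtain ⟨φ', hφ', e'⟩ := hf'.mono hle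
    refine ⟨φ', hφ', fun x hx hx' => ?_⟩
    rw [e', e x hx, toFun_apply φ hx]

theorem lt_normalizer_inf (hG : IsPGroup p G) (hp : p.Prime) {P S : Subgroup G} (h : P < S) :
    P < Subgroup.normalizer (P : Set G) ⊓ S := by
  have := Fact.mk hp
  have hS : IsPGroup p S := hG.to_subgroup S
  have := hS.isNilpotent
  have hlt : P.subgroupOf S < ⊤ := by
    rw [lt_top_iff_ne_top, Ne, Subgroup.subgroupOf_eq_top]
    exact not_le_of_gt h
  obtain ⟨a, ha, ha'⟩ := SetLike.exists_of_lt (Group.normalizerCondition_of_isNilpotent _ hlt)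
  refine lt_of_le_not_ge (le_inf Subgroup.le_normalizer h.le) fun hle =>
    ha' (hle (show (a : G) ∈ _ from ⟨?_, a.2⟩))
  refine mem_normalizer_of_finite fun x hx => ?_
  exact (Subgroup.mem_normalizer_iff.1 ha ⟨x, h.le hx⟩).1 hx

/-- Alperin's fusion theorem, as an induction principle. -/
theorem RSat.induction (hp : p.Prime) (hG : IsPGroup p G) (hF : RSat p F)
    {H : Subgroup G → (G → G) → Prop}
    (mono : ∀ (P Q : Subgroup G) f, F.IsMor Q f → P ≤ Q → H Q f → H P f)
    (comp : ∀ (P Q : Subgroup G) f g, F.IsMor P f → F.IsMor Q g → (∀ x ∈ P, f x ∈ Q) → H P f → H Q g →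
      H P (g ∘ f))
    (inv : ∀ (P Q : Subgroup G) f g, F.Iso P Q f g → H P f → H Q g)
    (congr : ∀ (P : Subgroup G) f g, F.IsMor P f → (∀ x ∈ P, f x = g x) → H P f → H P g)
    (step : ∀ P f g, Good p F P → F.Iso P P f g → (∀ (Q : Subgroup G) k, P < Q → F.IsMor Q k → H Q k) → H P f) :
    ∀ P f, F.IsMor P f → H P f := by
  -- Induction on |S| − |P|: the property is known for morphisms on all subgroups larger than P.
  have main : ∀ n, ∀ (P : Subgroup G) f, Nat.card F.carrier - Nat.card P = n → F.IsMor P f → H P f := by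
    intro n
    induction n using Nat.strong_induction_on with
    | _ n ih =>
      rintro P f rfl hf
      have larger : ∀ R : Subgroup G, Nat.card R = Nat.card P → ∀ (Q : Subgroup G) k, R < Q → F.IsMor Q k → H Q k := by
        intro R hR Q k hRQ hk
        refine ih _ ?_ Q k rfl hk
        have h1 : Nat.card R < Nat.card Q := by
          refine lt_of_le_of_ne (Subgroup.card_le_of_le hRQ.le) fun e => hRQ.ne ?_
          exact Subgroup.eq_of_le_of_card_ge hRQ.le e.ge
        have h2 := Subgroup.card_le_of_le hk.dom_le
        omega
      -- A proper subgroup R of S has some isomorphism onto its good conjugate which is the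
      -- restriction of a morphism on N_S(R) > R, and so has the property by induction.
      have ext : ∀ R : Subgroup G, R < F.carrier → Nat.card R = Nat.card P → ∀ Q f g, Good p F Q →
          F.Iso R Q f g → ∃ χ χ', F.Iso R Q χ χ' ∧ H R χ := by
        intro R hR hRP Q f g hQ h
        obtain ⟨χ, hχ, hχ'⟩ := hQ.exists_extension hp hG h
        have hle : R ≤ Subgroup.normalizer (R : Set G) ⊓ F.carrier :=
          le_inf Subgroup.le_normalizer hR.le
        obtain ⟨χ', hi⟩ := (hχ.mono hle).iso_of_card_le hχ' (le_of_eq h.card_eq.symm)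
        exact ⟨χ, χ', hi, mono _ _ _ hχ hle
          (larger R hRP _ _ (lt_normalizer_inf hG hp hR) hχ)⟩
      obtain ⟨Q, u, v, h, hQ⟩ := hF P hf.dom_le
      obtain ⟨g, hg⟩ := hf.iso
      -- If P = S, then S is its own only conjugate. So S is good and `f` is an automorphism of it.
      rcases hf.dom_le.eq_or_lt with hPS | hPS
      · have hS : ∀ R : Subgroup G, R ≤ F.carrier → Nat.card P = Nat.card R → R = P := by
          intro R hR hc
          rw [hPS] at hc ⊢
          exact Subgroup.eq_of_le_of_card_ge hR hc.le
        have e1 := hS Q hQ.le h.card_eq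
        subst e1
        have e2 := hS _ hg.inv_mor.dom_le hg.card_eq
        rw [e2] at hg
        exact step _ _ _ hQ hg (larger _ rfl)
      · have hP'S : img f P < F.carrier := by
          refine lt_of_le_of_ne hg.inv_mor.dom_le fun e => hPS.ne ?_
          refine Subgroup.eq_of_le_of_card_ge hPS.le ?_
          rw [hg.card_eq, e]
        obtain ⟨χ, χ', hχ, hχH⟩ := ext P hPS rfl Q u v hQ h
        obtain ⟨ξ, ξ', hξ, hξH⟩ := ext _ hP'S hg.card_eq.symm Q _ _ hQ (hg.symm.trans h)
        -- Decompose f = ξ⁻¹ (ξ f χ⁻¹) χ, where χ and ξ lead from P and f(P) to the good subgroup Q.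
        -- The middle factor is an automorphism of Q.
        have hmid := (hχ.symm.trans hg).trans hξ
        have hmidH := step _ _ _ hQ hmid (larger _ h.card_eq.symm)
        have h1 := comp _ _ _ _ hχ.mor hmid.mor hχ.map hχH hmidH
        have h2 := comp _ _ _ _ (hχ.trans hmid).mor hξ.inv_mor (hχ.trans hmid).map h1
          (inv _ _ _ _ hξ hξH)
        refine congr _ _ _ ((hχ.trans hmid).trans hξ.symm).mor (fun x hx => ?_) h2
        simp only [Function.comp]
        rw [hχ.left x hx, hξ.left _ (hg.map x hx)]
  exact fun P f => main _ P f rfl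

end Saturated

end FusionSystem

/-! ### Normal subgroups and criteria for normality -/

namespace FusionSystem

variable {G : Type*} [Group G]

theorem isNormal_iff [Finite G] {F : FusionSystem G} {N : Subgroup G} : F.IsNormal N ↔
    N ≤ F.carrier ∧ F.carrier ≤ Subgroup.normalizer (N : Set G) ∧
      ∀ P f, F.IsMor P f → ∃ f', F.IsMor (N ⊔ P) f' ∧ (∀ x ∈ P, f' x = f x) ∧
        ∀ x ∈ N, f' x ∈ N := by
  constructor
  · rintro ⟨h1, h2, h3⟩
    refine ⟨h1, h2, ?_⟩
    rintro P f ⟨φ, hφ, e⟩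
    obtain ⟨φ', hφ', he, hN⟩ := h3 P φ hφ
    refine ⟨toFun φ', isMor_toFun hφ', fun x hx => ?_, fun x hx => ?_⟩
    · have hx' : x ∈ N ⊔ P := le_sup_right (a := N) hx
      rw [toFun_apply φ' hx', he x hx hx', e x hx]
    · have hx' : x ∈ N ⊔ P := le_sup_left (a := N) hx
      rw [toFun_apply φ' hx']
      exact hN.le ⟨⟨x, hx'⟩, hx, rfl⟩
  · rintro ⟨h1, h2, h3⟩
    refine ⟨h1, h2, fun P φ hφ => ?_⟩
    obtain ⟨f', ⟨φ', hφ', e⟩, he, hN⟩ := h3 P _ (isMor_toFun hφ)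
    have hf' : F.IsMor (N ⊔ P) f' := ⟨φ', hφ', e⟩
    refine ⟨φ', hφ', fun x hx hx' => ?_, ?_⟩
    · rw [e, he x hx, toFun_apply φ hx]
    · ext y
      constructor
      · rintro ⟨⟨x, hx⟩, hxN, rfl⟩
        rw [e]
        exact hN x hxN
      · intro hy
        obtain ⟨x, hx, rfl⟩ := surjOn_of_card_le hN (fun x hx y hy e =>
          hf'.inj (le_sup_left (a := N) hx) (le_sup_left (a := N) hy) e) le_rfl y hy
        exact ⟨⟨x, le_sup_left (a := N) hx⟩, hx, e _ _⟩

theorem IsStronglyClosed.le_normalizer [Finite G] {F : FusionSystem G} {N : Subgroup G}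
    (hN : F.IsStronglyClosed N) : F.carrier ≤ Subgroup.normalizer (N : Set G) := fun _ hs =>
  mem_normalizer_of_finite fun _ hx =>
    (hN.isMor_mem_iff (IsMor.of_conj hN.1 hs) hx).2 hx

theorem IsNormal.isStronglyClosed [Finite G] {F : FusionSystem G} {N : Subgroup G}
    (hN : F.IsNormal N) : F.IsStronglyClosed N := by
  obtain ⟨h1, -, h3⟩ := isNormal_iff.1 hN
  refine isStronglyClosed_iff.2 ⟨h1, fun P f hf x hx hxN => ?_⟩
  obtain ⟨f', -, he, hf'⟩ := h3 P f hf
  rw [← he x hx]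
  exact hf' x hxN

theorem isStronglyClosed_carrier (F : FusionSystem G) : F.IsStronglyClosed F.carrier :=
  isStronglyClosed_iff.2 ⟨le_rfl, fun _ _ hf _ hx _ => hf.mem hx⟩

theorem isNormal_bot [Finite G] (F : FusionSystem G) : F.IsNormal ⊥ := by
  refine isNormal_iff.2 ⟨bot_le, fun s _ => mem_normalizer_of_finite fun x hx => ?_,
    fun P f hf => ⟨f, ?_, fun _ _ => rfl, fun x hx => ?_⟩⟩
  · rw [Subgroup.mem_bot] at hx
    simp [hx]
  · rwa [bot_sup_eq]
  · rw [Subgroup.mem_bot] at hx ⊢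
    rw [hx, hf.homOn.map_one]

theorem IsNormal.sup [Finite G] {F : FusionSystem G} {N M : Subgroup G} (hN : F.IsNormal N)
    (hM : F.IsNormal M) : F.IsNormal (N ⊔ M) := by
  obtain ⟨h1, h2, h3⟩ := isNormal_iff.1 hN
  obtain ⟨k1, k2, k3⟩ := isNormal_iff.1 hM
  refine isNormal_iff.2 ⟨sup_le h1 k1, fun s hs =>
    Subgroup.normalizer_inf_normalizer_le_normalizer_sup N M ⟨h2 hs, k2 hs⟩, fun P f hf => ?_⟩
  obtain ⟨f₁, hf₁, e₁, m₁⟩ := h3 P f hf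
  obtain ⟨f₂, hf₂, e₂, m₂⟩ := k3 _ f₁ hf₁
  have e : M ⊔ (N ⊔ P) = N ⊔ M ⊔ P := by rw [← sup_assoc, sup_comm M N]
  rw [e] at hf₂
  refine ⟨f₂, hf₂, fun x hx => ?_, (hf₂.mono le_sup_left).homOn.sup_le (fun x hx => ?_)
    fun x hx => ?_⟩
  · rw [e₂ x (le_sup_right (a := N) hx), e₁ x hx]
  · rw [e₂ x (le_sup_left (a := N) hx)]
    exact le_sup_left (a := N) (m₁ x hx)
  · exact le_sup_right (a := N) (m₂ x hx)

theorem IsNormal.le_opCore {F : FusionSystem G} {N : Subgroup G} (hN : F.IsNormal N) :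
    N ≤ F.opCore :=
  le_sSup (a := N) (s := {P | F.IsNormal P}) hN

/-- Normal subgroups are closed under joins, so a maximal one contains all the others and equals
their supremum. -/
theorem isNormal_opCore [Finite G] (F : FusionSystem G) : F.IsNormal F.opCore := by
  obtain ⟨m, hm⟩ := Set.Finite.exists_maximal (Set.toFinite {P | F.IsNormal P})
    ⟨⊥, F.isNormal_bot⟩
  have : F.opCore = m := le_antisymm (sSup_le fun b hb =>
    le_sup_right.trans (hm.le_of_ge (IsNormal.sup hm.prop hb) le_sup_left)) (le_sSup hm.prop)
  rw [this]
  exact hm.prop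

/-- As N is strongly closed, it suffices to extend each morphism from P to NP. By Alperin's theorem
only an automorphism of a good P is at stake. There N ∩ N_S(P) acts on P by elements of the chain
stabilizer, a normal p-subgroup of Aut_F(P) and hence part of Aut_S(P). So it lies in N_f, and `f`
extends beyond P. -/
theorem RSat.isNormal_of_chain [Finite G] {p : ℕ} (hp : p.Prime) (hG : IsPGroup p G)
    {F : FusionSystem G} (hF : RSat p F) {N : Subgroup G} (hN : F.IsStronglyClosed N)
    {C : ℕ → Subgroup G} (hC : ∀ i, F.IsStronglyClosed (C i)) (h0 : C 0 = ⊥) {m : ℕ}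
    (hm : F.carrier ≤ C m)
    (hcomm : ∀ i, ∀ n ∈ N, ∀ x ∈ C (i + 1), n * x * n⁻¹ * x⁻¹ ∈ C i) : F.IsNormal N := by
  suffices H : ∀ P f, F.IsMor P f → ∃ f', F.IsMor (N ⊔ P) f' ∧ ∀ x ∈ P, f' x = f x by
    refine isNormal_iff.2 ⟨hN.1, hN.le_normalizer, fun P f hf => ?_⟩
    obtain ⟨f', hf', e⟩ := H P f hf
    exact ⟨f', hf', e, fun x hx =>
      (hN.isMor_mem_iff hf' (le_sup_left (a := N) hx)).2 hx⟩
  refine hF.induction hp hG ?_ ?_ ?_ ?_ ?_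
  · rintro P Q f - hPQ ⟨f', hf', e⟩
    exact ⟨f', hf'.mono (sup_le_sup_left hPQ _), fun x hx => e x (hPQ hx)⟩
  · rintro P Q f g - - hPQ ⟨f', hf', e⟩ ⟨g', hg', e'⟩
    refine ⟨g' ∘ f', hf'.comp hg' (hf'.homOn.sup_le (fun x hx => ?_) fun x hx => ?_),
      fun x hx => ?_⟩
    · exact le_sup_left (a := N)
        ((hN.isMor_mem_iff hf' (le_sup_left (a := N) hx)).2 hx)
    · rw [e x hx]
      exact le_sup_right (a := N) (hPQ x hx)
    · simp only [Function.comp]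
      rw [e x hx, e' _ (hPQ x hx)]
  · rintro P Q f g h ⟨f', hf', e⟩
    obtain ⟨g', hg'⟩ := hf'.iso
    -- The extension permutes N by strong closure, so its image contains NQ and its inverse extends
    -- `g`.
    have hle : N ⊔ Q ≤ img f' (N ⊔ P) := by
      refine sup_le (fun y hy => ?_) fun y hy => ?_
      · obtain ⟨x, hx, rfl⟩ := surjOn_of_card_le (f := f') (A := N) (B := N)
          (fun x hx => (hN.isMor_mem_iff hf' (le_sup_left (a := N) hx)).2 hx)
          (fun x hx y hy e => hf'.inj (le_sup_left (a := N) hx) (le_sup_left (a := N) hy) e)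
          le_rfl y hy
        exact mem_img_of_mem (le_sup_left (a := N) hx)
      · rw [← h.right y hy, ← e _ (h.inv_map y hy)]
        exact mem_img_of_mem (le_sup_right (a := N) (h.inv_map y hy))
    refine ⟨g', hg'.inv_mor.mono hle, fun y hy => ?_⟩
    have := hg'.left _ (le_sup_right (a := N) (h.inv_map y hy))
    rwa [e _ (h.inv_map y hy), h.right y hy] at this
  · rintro P f g - e ⟨f', hf', e'⟩
    exact ⟨f', hf', fun x hx => (e' x hx).trans (e x hx)⟩
  · intro P f g hP h larger
    by_cases hNP : N ≤ P
    · refine ⟨f, ?_, fun _ _ => rfl⟩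
      rw [sup_eq_right.2 hNP]
      exact h.mor
    · have hK : F.chainStab P hP.le hC ≤ F.autConj P :=
        le_of_normal_of_not_dvd_relIndex hp (isPGroup_autConj hG F P) hP.automized
          (fun α hα => hα.1) (isPGroup_chainStab hp hG hC h0 (hP.le.trans hm))
          (chainStab_conj hC)
      have hD : N ⊓ Subgroup.normalizer (P : Set G) ≤ F.extG P f := by
        rintro n ⟨hn, hnP⟩
        obtain ⟨α, hα, e⟩ := exists_autConj (hN.1 hn) hnP
        have hαK : α ∈ F.chainStab P hP.le hC := by
          refine ⟨autConj_le_aut hP.le hα, fun i x hx hxi => ?_⟩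
          rw [e x hx]
          exact hcomm i n hn x hxi
        obtain ⟨s, hs, e'⟩ := mem_autConj_iff.1
          (hK (chainStab_conj hC _ (h.toMulEquiv_mem_aut hP.le) α hαK))
        refine ⟨hN.1 hn, hnP, s, hs, fun x hx => ?_⟩
        have h1 := e' (f x) (h.map x hx)
        have h2 := (autFun_iso (h.toMulEquiv_mem_aut hP.le)).left x hx
        rw [h.autFun_toMulEquiv hx] at h2
        rw [autFun_mul _ _ (h.map x hx), autFun_mul _ _ (autFun_mem _ (h.map x hx)), h2,
          h.autFun_toMulEquiv (autFun_mem _ hx), e x hx] at h1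
        exact h1
      have hlt : P < F.extG P f := by
        have hlt : P < N ⊔ P := lt_of_le_not_ge le_sup_right fun h => hNP (le_sup_left.trans h)
        -- Normalizers grow in the p-group NP. An element a = nx of N_{NP}(P) outside P has n ∈ N ∩
        -- N_S(P), and n lies outside P.
        obtain ⟨a, ⟨ha, haN⟩, haP⟩ := SetLike.exists_of_lt (lt_normalizer_inf hG hp hlt)
        have hle : P ≤ Subgroup.normalizer (N : Set G) := hP.le.trans hN.le_normalizer
        have haN' : a ∈ ((N ⊔ P : Subgroup G) : Set G) := haN
        rw [Subgroup.coe_mul_of_right_le_normalizer_left N P hle] at haN'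
        obtain ⟨n, hn, x, hx, rfl⟩ := haN'
        refine lt_of_le_not_ge h.mor.le_extG fun hle' => haP (P.mul_mem (hle' (hD ⟨hn, ?_⟩)) hx)
        have := Subgroup.mul_mem _ ha (Subgroup.inv_mem _ (Subgroup.le_normalizer hx))
        simpa using this
      obtain ⟨f', hf', e⟩ := hP.receptive _ _ _ h
      obtain ⟨f'', hf'', e'⟩ := larger _ _ hlt hf'
      refine ⟨f'', hf''.mono (sup_le_sup_left hlt.le _), fun x hx => ?_⟩
      rw [e' x (hlt.le hx), e x hx]

/-- Each nontrivial term of the upper central series of N is characteristic in N and contains Z(N).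
So it absorbs both the automorphism `b` and the error term, and is strongly closed. The series,
continued by S, is the chain for `RSat.isNormal_of_chain`. -/
theorem RSat.isNormal_of_elements [Finite G] {p : ℕ} (hp : p.Prime) (hG : IsPGroup p G)
    {F : FusionSystem G} (hF : RSat p F) {N : Subgroup G} (hNS : N ≤ F.carrier)
    (H : ∀ x ∈ N, ∀ f, F.IsMor (Subgroup.zpowers x) f → ∃ b b', F.Iso N N b b' ∧
      f x * (b x)⁻¹ ∈ N ⊓ Subgroup.centralizer (N : Set G)) : F.IsNormal N := by
  have := Fact.mk hp
  have := (hG.to_subgroup N).isNilpotent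
  let U : ℕ → Subgroup G := fun i => (Subgroup.upperCentralSeries N i).map N.subtype
  have hUN : ∀ i, U i ≤ N := by
    rintro i _ ⟨x, -, rfl⟩
    exact x.2
  have hU : ∀ i, ∀ x (hx : x ∈ N), x ∈ U i ↔ (⟨x, hx⟩ : N) ∈ Subgroup.upperCentralSeries N i := by
    intro i x hx
    constructor
    · rintro ⟨y, hy, rfl⟩
      exact hy
    · exact fun h => ⟨_, h, rfl⟩
  have hU1 : ∀ i, N ⊓ Subgroup.centralizer (N : Set G) ≤ U (i + 1) := by
    rintro i z ⟨hz, hzc⟩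
    rw [hU _ z hz]
    refine Subgroup.upperCentralSeries_mono N (Nat.le_add_left 1 i) ?_
    rw [Subgroup.upperCentralSeries_one, Subgroup.mem_center_iff]
    exact fun y => Subtype.ext (Subgroup.mem_centralizer_iff.1 hzc y y.2)
  have hUS : ∀ i, F.IsStronglyClosed (U i) := by
    intro i
    refine isStronglyClosed_iff.2 ⟨(hUN i).trans hNS, fun P f hf x hx hxU => ?_⟩
    cases i with
    | zero =>
      have hx1 := (hU 0 x (hUN 0 hxU)).1 hxU
      rw [Subgroup.upperCentralSeries_zero, Subgroup.mem_bot] at hx1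
      have hx1' : x = 1 := congrArg Subtype.val hx1
      rw [hx1', hf.homOn.map_one]
      exact Subgroup.one_mem _
    | succ i =>
      have hxN := hUN _ hxU
      obtain ⟨b, b', hb, hz⟩ := H x hxN f (hf.mono (Subgroup.zpowers_le.2 hx))
      have hbx : b x ∈ U (i + 1) := by
        rw [hU _ _ (hb.map x hxN)]
        have hchar := Subgroup.characteristic_iff_le_comap.1
          (inferInstance : (Subgroup.upperCentralSeries N (i + 1)).Characteristic) hb.toMulEquiv
        exact hchar ((hU _ x hxN).1 hxU)
      have := Subgroup.mul_mem _ (hU1 i hz) hbx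
      rwa [inv_mul_cancel_right] at this
  have hUc : U (Group.nilpotencyClass N) = N := by
    change (Subgroup.upperCentralSeries N _).map N.subtype = N
    rw [Subgroup.upperCentralSeries_nilpotencyClass, ← MonoidHom.range_eq_map, Subgroup.range_subtype]
  set c := Group.nilpotencyClass N with hc
  have hN : F.IsStronglyClosed N := by
    rw [← hUc]
    exact hUS c
  -- Here U c = N with c the nilpotency class. Below c the commutators drop by the definition of the
  -- series; at i = c the claim is [N, S] ≤ N; beyond that both terms are S.
  refine hF.isNormal_of_chain hp hG hN (C := fun i => if i ≤ c then U i else F.carrier)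
    (m := c + 1) (fun i => ?_) ?_ ?_ ?_
  · split_ifs
    · exact hUS i
    · exact F.isStronglyClosed_carrier
  · simp [U]
  · simp
  · intro i n hn x hx
    rcases lt_trichotomy i c with h | h | h
    · simp only [Nat.succ_le_of_lt h, if_true, h.le] at hx ⊢
      have hxN := hUN _ hx
      have h1 := (Subgroup.mem_upperCentralSeries_succ_iff).1 ((hU _ x hxN).1 hx) ⟨n, hn⟩
      have h2 := (U i).inv_mem (show x * n * x⁻¹ * n⁻¹ ∈ U i from ⟨_, h1, rfl⟩)
      simpa [mul_assoc] using h2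
    · subst h
      simp only [le_refl, if_true]
      have hxS : x ∈ F.carrier := by simpa using hx
      rw [hUc]
      have := N.mul_mem hn (conj_mem_of_mem_normalizer (hN.le_normalizer hxS) (N.inv_mem hn))
      simpa [mul_assoc] using this
    · have h1 : ¬ i + 1 ≤ c := by omega
      simp only [h1, if_false, not_le_of_gt h] at hx ⊢
      exact F.carrier.mul_mem (F.carrier.mul_mem (F.carrier.mul_mem (hNS hn) hx)
        (F.carrier.inv_mem (hNS hn))) (F.carrier.inv_mem hx)

/-- `b` and `b'` are mutually inverse automorphisms of the group `T`. -/
structure AutOn (T : Subgroup G) (b b' : G → G) : Prop where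
  hom : HomOn b T
  hom' : HomOn b' T
  map : ∀ x ∈ T, b x ∈ T
  map' : ∀ x ∈ T, b' x ∈ T
  left : ∀ x ∈ T, b' (b x) = x
  right : ∀ x ∈ T, b (b' x) = x

theorem AutOn.symm {T : Subgroup G} {b b' : G → G} (h : AutOn T b b') : AutOn T b' b :=
  ⟨h.hom', h.hom, h.map', h.map, h.right, h.left⟩

theorem Iso.autOn {F : FusionSystem G} {T : Subgroup G} {b b' : G → G} (h : F.Iso T T b b') :
    AutOn T b b' :=
  ⟨h.mor.homOn, h.inv_mor.homOn, h.map, h.inv_map, h.left, h.right⟩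

theorem AutOn.img_img {T : Subgroup G} {b b' : G → G} (h : AutOn T b b') {P : Subgroup G}
    (hP : P ≤ T) : img b' (img b P) = P := by
  rw [(h.hom.mono hP).img_comp]
  apply le_antisymm
  · refine img_le.2 fun x hx => ?_
    rw [Function.comp, h.left x (hP hx)]
    exact hx
  · intro x hx
    have := mem_img_of_mem (f := b' ∘ b) hx
    rwa [Function.comp, h.left x (hP hx)] at this

theorem IsNormal.img [Finite G] {E : FusionSystem G} {b b' : G → G} (h : AutOn E.carrier b b')
    (hb : ∀ P f, E.IsMor P f → E.IsMor (img b P) (b ∘ f ∘ b'))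
    (hb' : ∀ P f, E.IsMor P f → E.IsMor (FusionSystem.img b' P) (b' ∘ f ∘ b))
    {N : Subgroup G} (hN : E.IsNormal N) : E.IsNormal (FusionSystem.img b N) := by
  obtain ⟨h1, h2, h3⟩ := isNormal_iff.1 hN
  have hbN := h.hom.mono h1
  refine isNormal_iff.2 ⟨img_le.2 fun x hx => h.map x (h1 hx), fun s hs =>
    mem_normalizer_of_finite fun y hy => ?_, fun P f hf => ?_⟩
  · obtain ⟨x, hx, rfl⟩ := hbN.mem_img.1 hy
    rw [← h.right s hs, ← h.hom.map_conj (h.map' s hs) (h1 hx)]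
    exact mem_img_of_mem (conj_mem_of_mem_normalizer (h2 (h.map' s hs)) hx)
  · obtain ⟨k, hk, e, hkN⟩ := h3 _ _ (hb' P f hf)
    refine ⟨b ∘ k ∘ b', (hb _ _ hk).mono (sup_le (img_mono le_sup_left) fun x hx => ?_),
      fun x hx => ?_, fun y hy => ?_⟩
    · rw [← h.right x (hf.dom_le hx)]
      exact mem_img_of_mem (le_sup_right (a := N) (mem_img_of_mem hx))
    · simp only [Function.comp]
      rw [e _ (mem_img_of_mem hx)]
      simp only [Function.comp]
      rw [h.right x (hf.dom_le hx), h.right _ (hf.mem hx)]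
    · obtain ⟨x, hx, rfl⟩ := hbN.mem_img.1 hy
      simp only [Function.comp]
      rw [h.left x (h1 hx)]
      exact mem_img_of_mem (hkN x hx)

/-- An automorphism preserving the fusion system sends normal subgroups to normal subgroups, hence
the largest one into itself. -/
theorem AutOn.map_opCore [Finite G] {E : FusionSystem G} {b b' : G → G}
    (h : AutOn E.carrier b b')
    (hb : ∀ P f, E.IsMor P f → E.IsMor (img b P) (b ∘ f ∘ b'))
    (hb' : ∀ P f, E.IsMor P f → E.IsMor (img b' P) (b' ∘ f ∘ b)) {x : G} (hx : x ∈ E.opCore) :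
    b x ∈ E.opCore :=
  (le_sSup (E.isNormal_opCore.img h hb hb') : FusionSystem.img b E.opCore ≤ E.opCore)
    (mem_img_of_mem hx)

end FusionSystem

/-! ### Quotients by a strongly closed subgroup -/

namespace FusionSystem

variable {G : Type*} [Group G]

section Quotient

variable {E : FusionSystem G} {Z : Subgroup G}

/-- The total function `f` on the quotient is induced by `g` on `P`. -/
def Covers (E : FusionSystem G) (Z P : Subgroup G) (g : G → G)
    (f : E.carrier ⧸ Z.subgroupOf E.carrier → E.carrier ⧸ Z.subgroupOf E.carrier) : Prop :=
  ∀ x w : E.carrier, (x : G) ∈ P → g x = w →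
    f (x : E.carrier ⧸ Z.subgroupOf E.carrier) = (w : E.carrier ⧸ Z.subgroupOf E.carrier)

theorem Covers.mono {P Q : Subgroup G} {g : G → G}
    {f : E.carrier ⧸ Z.subgroupOf E.carrier → E.carrier ⧸ Z.subgroupOf E.carrier}
    (h : E.Covers Z Q g f) (hPQ : P ≤ Q) : E.Covers Z P g f :=
  fun x w hx hw => h x w (hPQ hx) hw

theorem mk_eq_mk_iff {x y : E.carrier} : (x : E.carrier ⧸ Z.subgroupOf E.carrier) = y ↔
    (x : G)⁻¹ * y ∈ Z := by
  rw [QuotientGroup.eq, Subgroup.mem_subgroupOf]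
  rfl

variable [(Z.subgroupOf E.carrier).Normal]

/-- The subgroup `P / Z`. -/
def quo (E : FusionSystem G) (Z : Subgroup G) [(Z.subgroupOf E.carrier).Normal] (P : Subgroup G) :
    Subgroup (E.carrier ⧸ Z.subgroupOf E.carrier) :=
  (P.subgroupOf E.carrier).map (QuotientGroup.mk' _)

theorem mk_mem_quo {P : Subgroup G} (hZP : Z ≤ P) {x : E.carrier} :
    (x : E.carrier ⧸ Z.subgroupOf E.carrier) ∈ E.quo Z P ↔ (x : G) ∈ P := by
  constructor
  · rintro ⟨y, hy, e⟩
    have := hZP (mk_eq_mk_iff.1 e)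
    have h := P.mul_mem hy this
    simpa using h
  · exact fun h => ⟨x, h, rfl⟩

theorem preim_quo {P : Subgroup G} (hZP : Z ≤ P) (hP : P ≤ E.carrier) :
    E.preim Z (E.quo Z P) = P := by
  ext x
  constructor
  · rintro ⟨y, hy, rfl⟩
    exact (mk_mem_quo hZP).1 hy
  · intro hx
    exact (mem_preim (⟨x, hP hx⟩ : E.carrier)).2 ((mk_mem_quo hZP).2 hx)

theorem le_preim (hZ : Z ≤ E.carrier) (A : Subgroup (E.carrier ⧸ Z.subgroupOf E.carrier)) :
    Z ≤ E.preim Z A := by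
  intro z hz
  refine (mem_preim (⟨z, hZ hz⟩ : E.carrier)).2 ?_
  rw [(mk_eq_one (N := Z) (⟨z, hZ hz⟩ : E.carrier)).2 hz]
  exact A.one_mem

theorem quo_preim (hZ : Z ≤ E.carrier) (A : Subgroup (E.carrier ⧸ Z.subgroupOf E.carrier)) :
    E.quo Z (E.preim Z A) = A := by
  ext a
  induction a using QuotientGroup.induction_on with
  | H x => rw [mk_mem_quo (le_preim hZ A), mem_preim]

theorem isMor_quotient_iff [Finite G] (hZ : E.IsStronglyClosed Z)
    {A : Subgroup (E.carrier ⧸ Z.subgroupOf E.carrier)}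
    {f : E.carrier ⧸ Z.subgroupOf E.carrier → E.carrier ⧸ Z.subgroupOf E.carrier} :
    (E.quotient Z hZ).IsMor A f ↔
      ∃ g, E.IsMor (E.preim Z A) g ∧ E.Covers Z (E.preim Z A) g f := by
  constructor
  · rintro ⟨ψ, ⟨φ, hφ, h⟩, e⟩
    refine ⟨toFun φ, isMor_toFun hφ, fun x w hx hw => ?_⟩
    rw [toFun_apply φ hx] at hw
    rw [← e _ ((mem_preim x).1 hx)]
    exact h x w _ hx hw
  · rintro ⟨g, ⟨φ, hφ, e⟩, h⟩
    have hg : E.IsMor (E.preim Z A) g := ⟨φ, hφ, e⟩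
    have hm : ∀ a ∈ A, ∀ b ∈ A, f (a * b) = f a * f b := by
      intro a ha b hb
      induction a using QuotientGroup.induction_on with
      | H x =>
        induction b using QuotientGroup.induction_on with
        | H y =>
          have hx := (mem_preim x).2 ha
          have hy := (mem_preim y).2 hb
          rw [h x ⟨_, hg.mem hx⟩ hx rfl, h y ⟨_, hg.mem hy⟩ hy rfl]
          exact h (x * y) (⟨_, hg.mem hx⟩ * ⟨_, hg.mem hy⟩) (Subgroup.mul_mem _ hx hy)
            (hg.homOn _ hx _ hy)
    refine ⟨MonoidHom.mk' (fun a : A => f a) fun a b => hm a a.2 b b.2, ⟨φ, hφ, ?_⟩,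
      fun _ _ => rfl⟩
    intro x w hx hx' hw
    exact h x w hx' ((e _ _).symm.trans hw)

theorem IsMor.exists_covers (hZ : E.IsStronglyClosed Z) {P : Subgroup G} {g : G → G}
    (hg : E.IsMor P g) (hZP : Z ≤ P) : ∃ f, E.Covers Z P g f := by
  classical
  -- Apply g to a representative of the coset. For a coset meeting P the representative lies in P,
  -- as Z ≤ P; the value 1 is a dummy for cosets on which g is not controlled.
  refine ⟨fun a => if h : g (Quotient.out a : E.carrier) ∈ E.carrier then
    ((⟨_, h⟩ : E.carrier) : E.carrier ⧸ Z.subgroupOf E.carrier) else 1, fun x w hx hw => ?_⟩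
  set y : E.carrier := Quotient.out (x : E.carrier ⧸ Z.subgroupOf E.carrier) with hy
  have hyx : (y : E.carrier ⧸ Z.subgroupOf E.carrier) = x := Quotient.out_eq _
  have hz := mk_eq_mk_iff.1 hyx.symm
  have hzP := hZP hz
  have hyP : (y : G) ∈ P := by
    have := P.mul_mem hx hzP
    simpa using this
  have e : g y = w * g ((x : G)⁻¹ * y) := by
    rw [← hw, ← hg.homOn _ hx _ hzP]
    simp
  refine (dif_pos (hg.mem hyP)).trans (mk_eq_mk_iff.2 ?_).symm
  change (w : G)⁻¹ * g y ∈ Z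
  rw [e, inv_mul_cancel_left]
  exact (hZ.isMor_mem_iff hg hzP).2 hz

variable [Finite G]

theorem IsMor.quotient (hZ : E.IsStronglyClosed Z) {P : Subgroup G} {g : G → G}
    (hg : E.IsMor P g) (hZP : Z ≤ P)
    {f : E.carrier ⧸ Z.subgroupOf E.carrier → E.carrier ⧸ Z.subgroupOf E.carrier}
    (hf : E.Covers Z P g f) : (E.quotient Z hZ).IsMor (E.quo Z P) f := by
  refine (isMor_quotient_iff hZ).2 ⟨g, ?_, ?_⟩ <;> rwa [preim_quo hZP hg.dom_le]

theorem Iso.quotient (hZ : E.IsStronglyClosed Z) {P Q : Subgroup G} {g g' : G → G}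
    (hg : E.Iso P Q g g') (hZP : Z ≤ P) (hZQ : Z ≤ Q) :
    ∃ f f', E.Covers Z P g f ∧ (E.quotient Z hZ).Iso (E.quo Z P) (E.quo Z Q) f f' := by
  obtain ⟨f, hf⟩ := hg.mor.exists_covers hZ hZP
  obtain ⟨f', hf'⟩ := hg.inv_mor.exists_covers hZ hZQ
  refine ⟨f, f', hf, hg.mor.quotient hZ hZP hf, hg.inv_mor.quotient hZ hZQ hf', ?_, ?_, ?_, ?_⟩
  · rintro _ ⟨x, hx, rfl⟩
    exact ⟨⟨_, hg.mor.mem hx⟩, hg.map x hx, (hf x _ hx rfl).symm⟩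
  · rintro _ ⟨x, hx, rfl⟩
    exact ⟨⟨_, hg.inv_mor.mem hx⟩, hg.inv_map x hx, (hf' x _ hx rfl).symm⟩
  · rintro _ ⟨x, hx, rfl⟩
    exact (congrArg f' (hf x ⟨_, hg.mor.mem hx⟩ hx rfl)).trans
      (hf' _ x (hg.map x hx) (hg.left x hx))
  · rintro _ ⟨x, hx, rfl⟩
    exact (congrArg f (hf' x ⟨_, hg.inv_mor.mem hx⟩ hx rfl)).trans
      (hf _ x (hg.inv_map x hx) (hg.right x hx))

theorem Iso.exists_lift (hZ : E.IsStronglyClosed Z)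
    {A B : Subgroup (E.carrier ⧸ Z.subgroupOf E.carrier)}
    {f f' : E.carrier ⧸ Z.subgroupOf E.carrier → E.carrier ⧸ Z.subgroupOf E.carrier}
    (hf : (E.quotient Z hZ).Iso A B f f') :
    ∃ g g', E.Covers Z (E.preim Z A) g f ∧ E.Iso (E.preim Z A) (E.preim Z B) g g' := by
  obtain ⟨g, hg, hc⟩ := (isMor_quotient_iff hZ).1 hf.mor
  obtain ⟨g', hg'⟩ := hg.iso
  refine ⟨g, g', hc, ?_⟩
  have : img g (E.preim Z A) = E.preim Z B := by
    apply le_antisymm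
    · refine img_le.2 fun x hx => ?_
      have hx' := (mem_preim (⟨x, preim_le hx⟩ : E.carrier)).1 hx
      refine (mem_preim (⟨_, hg.mem hx⟩ : E.carrier)).2 ?_
      rw [← hc ⟨x, preim_le hx⟩ _ hx rfl]
      exact hf.map _ hx'
    · intro y hy
      have hy' := (mem_preim (⟨y, preim_le hy⟩ : E.carrier)).1 hy
      obtain ⟨x, hx⟩ := QuotientGroup.mk_surjective (f' (⟨y, preim_le hy⟩ : E.carrier))
      have hxA := hf.inv_map _ hy'
      rw [← hx] at hxA
      have hxP := (mem_preim x).2 hxA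
      have e := hc x ⟨_, hg.mem hxP⟩ hxP rfl
      rw [hx, hf.right _ hy'] at e
      have hz := mk_eq_mk_iff.1 e.symm
      -- The lift hits y only up to an element of Z. As g permutes Z, correcting the argument x by
      -- some z ∈ Z hits y itself.
      obtain ⟨z, hz', e'⟩ := surjOn_of_card_le (f := g) (A := Z) (B := Z)
        (fun z hz => (hZ.isMor_mem_iff hg (le_preim hZ.1 A hz)).2 hz)
        (fun z hz w hw e => hg.inj (le_preim hZ.1 A hz) (le_preim hZ.1 A hw) e) le_rfl _ hz
      refine hg.homOn.mem_img.2 ⟨x * z, Subgroup.mul_mem _ hxP (le_preim hZ.1 A hz'), ?_⟩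
      rw [hg.homOn _ hxP _ (le_preim hZ.1 A hz'), e']
      simp
  rw [this] at hg'
  exact hg'

/-- Full automization passes along the surjection from Aut_E(Q) to the automorphisms of Q/Z. For
receptivity, lift f to g; the preimage of N_f must lie in N_g. The obstruction is an automorphism of
Q trivial on Z and on Q/Z. Those form a normal p-subgroup of Aut_E(Q), so it is conjugation by an
element of S. -/
theorem Good.quotient {p : ℕ} (hp : p.Prime) (hG : IsPGroup p G) (hZ : E.IsStronglyClosed Z)
    (hfix : ∀ P f, E.IsMor P f → ∀ z ∈ P, z ∈ Z → f z = z) {Q : Subgroup G} (hQ : Good p E Q)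
    (hZQ : Z ≤ Q) : Good p (E.quotient Z hZ) (E.quo Z Q) where
  le := le_top
  automized := by
    have hd := relIndex_dvd_of_rel (A := E.aut Q hQ.le) (H := E.autConj Q)
      (B := (E.quotient Z hZ).aut (E.quo Z Q) le_top) (K := (E.quotient Z hZ).autConj (E.quo Z Q))
      (rel := fun a b => E.Covers Z Q (autFun a) (autFun b)) ?_ ?_ ?_ ?_ ?_
    · exact fun hdvd => hQ.automized (hdvd.trans hd)
    · intro a ha
      obtain ⟨f, f', hc, h⟩ := (autFun_iso ha).quotient hZ hZQ hZQ
      refine ⟨_, h.toMulEquiv_mem_aut le_top, fun x w hx hw => ?_⟩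
      rw [h.autFun_toMulEquiv ((mk_mem_quo hZQ).2 hx)]
      exact hc x w hx hw
    · intro a ha b _ b' _ h h'
      apply mulAut_ext
      rintro _ ⟨x, hx, rfl⟩
      exact (h x ⟨_, (autFun_iso ha).mor.mem hx⟩ hx rfl).trans (h' x _ hx rfl).symm
    · intro a ha a' ha' b _ b' _ h h' x w hx hw
      rw [autFun_mul _ _ ((mk_mem_quo hZQ).2 hx),
        h' x ⟨_, (autFun_iso ha').mor.mem hx⟩ hx rfl]
      rw [autFun_mul _ _ hx] at hw
      exact h _ w (autFun_mem a' hx) hw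
    · intro b hb
      obtain ⟨g, g', hc, h⟩ := (autFun_iso hb).exists_lift hZ
      rw [preim_quo hZQ hQ.le] at h hc
      refine ⟨_, h.toMulEquiv_mem_aut hQ.le, fun x w hx hw => hc x w hx ?_⟩
      rwa [h.autFun_toMulEquiv hx] at hw
    · intro a ha b hb haH h
      obtain ⟨s, hs, e⟩ := mem_autConj_iff.1 haH
      refine mem_autConj_iff.2 ⟨(⟨s, hs⟩ : E.carrier), trivial, ?_⟩
      rintro _ ⟨x, hx, rfl⟩
      exact h x (⟨s, hs⟩ * x * ⟨s, hs⟩⁻¹) hx (e x hx)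
  receptive := by
    intro A f f' hf
    obtain ⟨g, g', hc, hg⟩ := hf.exists_lift hZ
    rw [preim_quo hZQ hQ.le] at hg
    have hext : E.preim Z ((E.quotient Z hZ).extG A f) ≤ E.extG (E.preim Z A) g := by
      rintro _ ⟨s, ⟨-, hs, t, -, ht⟩, rfl⟩
      obtain ⟨t, rfl⟩ := QuotientGroup.mk_surjective t
      have hsN : (s : G) ∈ Subgroup.normalizer (E.preim Z A : Set G) := by
        refine mem_normalizer_of_finite fun x hx => ?_
        exact (mem_preim (s * ⟨x, preim_le hx⟩ * s⁻¹ : E.carrier)).2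
          (conj_mem_of_mem_normalizer hs ((mem_preim (⟨x, preim_le hx⟩ : E.carrier)).1 hx))
      have hconj : ∀ x (hx : x ∈ E.preim Z A),
          (t * g x * (t : G)⁻¹)⁻¹ * g (s * x * (s : G)⁻¹) ∈ Z := by
        intro x hx
        have hx' := conj_mem_of_mem_normalizer hsN hx
        have h1 := ht _ ((mem_preim (⟨x, preim_le hx⟩ : E.carrier)).1 hx)
        rw [hc ⟨x, preim_le hx⟩ ⟨_, hg.mor.mem hx⟩ hx rfl] at h1
        have h2 := hc (s * ⟨x, preim_le hx⟩ * s⁻¹) ⟨_, hg.mor.mem hx'⟩ hx' rfl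
        exact mk_eq_mk_iff.1 (h1.symm.trans h2 : ((t * ⟨_, hg.mor.mem hx⟩ * t⁻¹ : E.carrier) :
          E.carrier ⧸ Z.subgroupOf E.carrier) = _)
      -- This κ is c_t⁻¹ g c_s g⁻¹: it measures by how much g c_s g⁻¹ fails to be c_t, which it is
      -- modulo Z. If κ = c_r, then g c_s g⁻¹ = c_{tr}.
      let κ : G → G := fun y => (t : G)⁻¹ * g (s * g' y * (s : G)⁻¹) * t
      have hκz : ∀ y ∈ Q, κ y * y⁻¹ ∈ Z := by
        intro y hy
        have h1 := hconj _ (hg.inv_map y hy)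
        rw [hg.right y hy] at h1
        have h2 := conj_mem_of_mem_normalizer (hZ.le_normalizer (E.carrier.mul_mem (hQ.le hy)
          (E.carrier.inv_mem t.2))) h1
        simpa [κ, mul_assoc] using h2
      have hκQ : ∀ y ∈ Q, κ y ∈ Q := by
        intro y hy
        have := Q.mul_mem (hZQ (hκz y hy)) hy
        rwa [inv_mul_cancel_right] at this
      have hκ : E.IsMor Q κ := by
        have h1 := (hg.inv_mor.comp (.of_conj preim_le s.2) hg.inv_map).comp hg.mor
          fun y hy => conj_mem_of_mem_normalizer hsN (hg.inv_map y hy)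
        have h2 := h1.comp (.of_conj (s := (t : G)⁻¹) le_rfl (E.carrier.inv_mem t.2))
          fun y hy => h1.mem hy
        refine h2.congr fun y hy => ?_
        simp [κ]
      obtain ⟨κ', hκi⟩ := hκ.iso_self hκQ
      -- The chain is 1 ≤ Z ≤ S; κ is trivial on Z by `hfix` and on Q/Z by `hκz`.
      have hC : ∀ i : ℕ, E.IsStronglyClosed
          (if i = 0 then ⊥ else if i = 1 then Z else E.carrier) := by
        intro i
        split_ifs
        · exact E.isNormal_bot.isStronglyClosed
        · exact hZ
        · exact E.isStronglyClosed_carrier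
      have hle : E.chainStab Q hQ.le hC ≤ E.autConj Q :=
        le_of_normal_of_not_dvd_relIndex hp (isPGroup_autConj hG E Q) hQ.automized
          (fun α hα => hα.1) (isPGroup_chainStab hp hG hC (m := 2) (by simp)
            (by simpa using hQ.le)) (chainStab_conj hC)
      have hmem : (hκi.toMulEquiv : MulAut Q) ∈ E.chainStab Q hQ.le hC := by
        refine ⟨hκi.toMulEquiv_mem_aut hQ.le, fun i y hy hyi => ?_⟩
        rw [hκi.autFun_toMulEquiv hy]
        rcases i with _ | _ | i
        · have hyZ : y ∈ Z := by simpa using hyi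
          rw [hfix _ _ hκ y hy hyZ]
          simp
        · simpa using hκz y hy
        · simpa using E.carrier.mul_mem (hκ.mem hy) (E.carrier.inv_mem (hQ.le hy))
      obtain ⟨r, hr, e⟩ := mem_autConj_iff.1 (hle hmem)
      refine ⟨s.2, hsN, t * r, E.carrier.mul_mem t.2 hr, fun x hx => ?_⟩
      have h1 := e _ (hg.map x hx)
      rw [hκi.autFun_toMulEquiv (hg.map x hx)] at h1
      simp only [κ, hg.left x hx] at h1
      calc g (s * x * (s : G)⁻¹) = t * ((t : G)⁻¹ * g (s * x * (s : G)⁻¹) * t) * (t : G)⁻¹ := by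
            group
        _ = _ := by
            rw [h1]
            group
    obtain ⟨g₁, hg₁, e⟩ := hQ.receptive _ _ _ hg
    have hZe : Z ≤ E.extG (E.preim Z A) g := (le_preim hZ.1 A).trans hg.mor.le_extG
    obtain ⟨f₁, hf₁⟩ := hg₁.exists_covers hZ hZe
    refine ⟨f₁, (isMor_quotient_iff hZ).2 ⟨g₁, hg₁.mono hext, hf₁.mono hext⟩, fun a ha => ?_⟩
    induction a using QuotientGroup.induction_on with
    | H x =>
      have hx := (mem_preim x).2 ha
      rw [hf₁ x ⟨_, hg.mor.mem hx⟩ (hg.mor.le_extG hx) (e _ hx), hc x ⟨_, hg.mor.mem hx⟩ hx rfl]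

/-- Subgroups of the quotient correspond to overgroups of Z, so good conjugates are demanded only
for these. Saturation of E itself is not required. -/
theorem RSat.quotient {p : ℕ} (hp : p.Prime) (hG : IsPGroup p G) (hZ : E.IsStronglyClosed Z)
    (hfix : ∀ P f, E.IsMor P f → ∀ z ∈ P, z ∈ Z → f z = z)
    (hgood : ∀ P, Z ≤ P → P ≤ E.carrier → ∃ Q g g', E.Iso P Q g g' ∧ Good p E Q) :
    RSat p (E.quotient Z hZ) := by
  intro A _
  obtain ⟨Q, g, g', hg, hQ⟩ := hgood _ (le_preim hZ.1 A) preim_le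
  have hZQ : Z ≤ Q := fun z hz => by
    rw [← hfix _ _ hg.mor z (le_preim hZ.1 A hz) hz]
    exact hg.map z (le_preim hZ.1 A hz)
  obtain ⟨f, f', -, hf⟩ := hg.quotient hZ (le_preim hZ.1 A) hZQ
  rw [quo_preim hZ.1] at hf
  exact ⟨_, f, f', hf, hQ.quotient hp hG hZ hfix hZQ⟩

end Quotient

end FusionSystem

/-! ### The centralizer system of a normal subgroup and its quotient -/

theorem Subgroup.relIndex_dvd_index_of_normal_right {A : Type*} [Group A] [Finite A]
    (H K : Subgroup A) [K.Normal] : H.relIndex K ∣ H.index := by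
  -- Two computations of |HK : H ∩ K| give |K : H ∩ K| = |HK : H|, a divisor of |A : H|.
  have h1 := Subgroup.relIndex_mul_relIndex (H ⊓ K) K (H ⊔ K) inf_le_right le_sup_right
  have h2 := Subgroup.relIndex_mul_relIndex (H ⊓ K) H (H ⊔ K) inf_le_left le_sup_left
  rw [Subgroup.inf_relIndex_right, Subgroup.relIndex_sup_right] at h1
  rw [Subgroup.inf_relIndex_left] at h2
  have h3 : H.relIndex K * K.relIndex H = H.relIndex (H ⊔ K) * K.relIndex H := by
    rw [h1, ← h2, mul_comm]
  rw [Nat.eq_of_mul_eq_mul_right (Nat.pos_of_ne_zero Subgroup.index_ne_zero_of_finite) h3]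
  exact Subgroup.relIndex_dvd_index_of_le le_sup_left

theorem Subgroup.relIndex_dvd_relIndex_of_conj {X : Type*} [Group X] [Finite X]
    {A H K : Subgroup X} (hKA : K ≤ A) (hn : ∀ a ∈ A, ∀ k ∈ K, a * k * a⁻¹ ∈ K) :
    H.relIndex K ∣ H.relIndex A := by
  have : (K.subgroupOf A).Normal := ⟨fun k hk a => hn a a.2 k hk⟩
  rw [← Subgroup.relIndex_subgroupOf hKA]
  exact Subgroup.relIndex_dvd_index_of_normal_right _ _

namespace FusionSystem

variable {G : Type*} [Group G] {F : FusionSystem G} {Q : Subgroup G}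

theorem isMor_centralizer_iff {hQ : Q ≤ F.carrier} {P : Subgroup G} {f : G → G} :
    (F.centralizer Q hQ).IsMor P f ↔ P ≤ Subgroup.centralizer (Q : Set G) ⊓ F.carrier ∧
      ∃ f', F.IsMor (P ⊔ Q) f' ∧ (∀ x ∈ P, f' x = f x) ∧ ∀ x ∈ Q, f' x = x := by
  constructor
  · rintro ⟨φ, ⟨h1, h2, φ', hφ', e, e'⟩, h⟩
    refine ⟨h1, toFun φ', isMor_toFun hφ', fun x hx => ?_, fun x hx => ?_⟩
    · have hx' : x ∈ P ⊔ Q := le_sup_left (a := P) hx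
      rw [toFun_apply φ' hx', e x hx hx', h]
    · have hx' : x ∈ P ⊔ Q := le_sup_right (a := P) hx
      rw [toFun_apply φ' hx', e' x hx hx']
      rfl
  · rintro ⟨hP, f', hf', e, e'⟩
    have hm : HomOn f P := fun x hx y hy => by
      rw [← e x hx, ← e y hy, ← e _ (P.mul_mem hx hy)]
      exact hf'.homOn _ (le_sup_left (a := P) hx) _ (le_sup_left (a := P) hy)
    obtain ⟨φ', hφ', h⟩ := id hf'
    refine ⟨MonoidHom.mk' (fun x : P => f x) fun x y => hm x x.2 y y.2,
      ⟨hP, ?_, φ', hφ', fun x hx hx' => ?_, fun x hx hx' => ?_⟩, fun _ _ => rfl⟩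
    · rintro _ ⟨⟨x, hx⟩, rfl⟩
      change f x ∈ _
      rw [← e x hx]
      refine ⟨Subgroup.mem_centralizer_iff.2 fun y hy => ?_, hf'.mem (le_sup_left (a := P) hx)⟩
      have := congrArg f' (Subgroup.mem_centralizer_iff.1 (hP hx).1 y hy)
      rwa [hf'.homOn _ (le_sup_right (a := P) hy) _ (le_sup_left (a := P) hx),
        hf'.homOn _ (le_sup_left (a := P) hx) _ (le_sup_right (a := P) hy), e' y hy] at this
    · rw [h, e x hx]
      rfl
    · rw [h, e' x hx]
      rfl

theorem centralizer_le (hQ : Q ≤ F.carrier) : F.centralizer Q hQ ≤ F := by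
  refine le_iff_isMor.2 ⟨inf_le_right, fun P f hf => ?_⟩
  obtain ⟨-, f', hf', e, -⟩ := isMor_centralizer_iff.1 hf
  exact (hf'.mono le_sup_left).congr e

theorem centralizer_le_normalizer (F : FusionSystem G) (Q : Subgroup G) :
    Subgroup.centralizer (Q : Set G) ⊓ F.carrier ≤ Subgroup.normalizer (Q : Set G) :=
  fun _ hc => mem_normalizer_of_mem_centralizer hc.1

/-- The subgroup `C_S(Q) Q`. -/
def centralizerSup (F : FusionSystem G) (Q : Subgroup G) : Subgroup G :=
  Subgroup.centralizer (Q : Set G) ⊓ F.carrier ⊔ Q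

/-- Dedekind's law: PQ ∩ C(Q) = P(Q ∩ C(Q)) = P. So P can be recovered from PQ, which is where Z(Q)
≤ P is needed. -/
theorem mem_of_mem_sup_of_mem_centralizer {P : Subgroup G} (hZP : centerOf Q ≤ P)
    (hP : P ≤ Subgroup.centralizer (Q : Set G) ⊓ F.carrier) {x : G} (hx : x ∈ P ⊔ Q)
    (hxC : x ∈ Subgroup.centralizer (Q : Set G)) : x ∈ P := by
  have hx' : x ∈ ((P ⊔ Q : Subgroup G) : Set G) := hx
  rw [Subgroup.coe_mul_of_left_le_normalizer_right P Q
    (hP.trans (centralizer_le_normalizer F Q))] at hx'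
  obtain ⟨a, ha, q, hq, rfl⟩ := hx'
  refine P.mul_mem ha (hZP ⟨hq, ?_⟩)
  have := Subgroup.mul_mem _ (Subgroup.inv_mem _ (hP ha).1) hxC
  simpa using this

theorem IsMor.map_centralizer [Finite G] {R : Subgroup G} {f : G → G} (hf : F.IsMor R f)
    (hQR : Q ≤ R) (hQ : ∀ x ∈ Q, f x ∈ Q) {c : G} (hc : c ∈ R)
    (hcQ : c ∈ Subgroup.centralizer (Q : Set G)) :
    f c ∈ Subgroup.centralizer (Q : Set G) ⊓ F.carrier := by
  refine ⟨Subgroup.mem_centralizer_iff.2 fun y hy => ?_, hf.mem hc⟩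
  obtain ⟨x, hx, rfl⟩ := surjOn_of_card_le hQ
    (fun x hx y hy e => hf.inj (hQR hx) (hQR hy) e) le_rfl y hy
  have := congrArg f (Subgroup.mem_centralizer_iff.1 hcQ x hx)
  rwa [hf.homOn _ (hQR hx) _ hc, hf.homOn _ hc _ (hQR hx)] at this

/-- `ψ` and `ψ'` are mutually inverse automorphisms of `C_S(Q) Q` in `F` which leave `Q`
invariant. -/
structure CentralizerAut (F : FusionSystem G) (Q : Subgroup G) (ψ ψ' : G → G) : Prop where
  iso : F.Iso (F.centralizerSup Q) (F.centralizerSup Q) ψ ψ'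
  onC : AutOn (Subgroup.centralizer (Q : Set G) ⊓ F.carrier) ψ ψ'
  onQ : ∀ x ∈ Q, ψ x ∈ Q
  onQ' : ∀ x ∈ Q, ψ' x ∈ Q

theorem CentralizerAut.symm {ψ ψ' : G → G} (h : CentralizerAut F Q ψ ψ') :
    CentralizerAut F Q ψ' ψ :=
  ⟨h.iso.symm, h.onC.symm, h.onQ', h.onQ⟩

theorem le_centralizerSup_right : Q ≤ F.centralizerSup Q := le_sup_right

theorem le_centralizerSup_left :
    Subgroup.centralizer (Q : Set G) ⊓ F.carrier ≤ F.centralizerSup Q := le_sup_left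

/-- Conjugation by an automorphism of `C_S(Q) Q` preserves the centralizer fusion system. -/
theorem CentralizerAut.isMor {ψ ψ' : G → G} (h : CentralizerAut F Q ψ ψ') {hQ : Q ≤ F.carrier}
    {P : Subgroup G} {g : G → G} (hg : (F.centralizer Q hQ).IsMor P g) :
    (F.centralizer Q hQ).IsMor (img ψ P) (ψ ∘ g ∘ ψ') := by
  obtain ⟨hP, g', hg', e, e'⟩ := isMor_centralizer_iff.1 hg
  have hgC : ∀ x ∈ P, g x ∈ Subgroup.centralizer (Q : Set G) ⊓ F.carrier := fun x hx => hg.mem hx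
  have hmP := h.onC.hom.mono hP
  have hPD : img ψ P ⊔ Q ≤ F.centralizerSup Q :=
    sup_le_sup_right (img_le.2 fun x hx => h.onC.map x (hP hx)) _
  have h1 : ∀ x ∈ img ψ P ⊔ Q, ψ' x ∈ P ⊔ Q := by
    refine (h.iso.inv_mor.mono hPD).homOn.sup_le (fun y hy => ?_) fun y hy => ?_
    · obtain ⟨x, hx, rfl⟩ := hmP.mem_img.1 hy
      rw [h.onC.left x (hP hx)]
      exact le_sup_left (a := P) hx
    · exact le_sup_right (a := P) (h.onQ' y hy)
  have h2 : ∀ x ∈ P ⊔ Q, g' x ∈ F.centralizerSup Q := by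
    refine hg'.homOn.sup_le (fun y hy => ?_) fun y hy => ?_
    · rw [e y hy]
      exact le_centralizerSup_left (hgC y hy)
    · rw [e' y hy]
      exact le_centralizerSup_right hy
  refine isMor_centralizer_iff.2 ⟨img_le.2 fun x hx => h.onC.map x (hP hx), ψ ∘ g' ∘ ψ',
    ((h.iso.inv_mor.mono hPD).comp hg' h1).comp h.iso.mor fun x hx => h2 _ (h1 x hx),
    fun y hy => ?_, fun y hy => ?_⟩
  · obtain ⟨x, hx, rfl⟩ := hmP.mem_img.1 hy
    simp only [Function.comp]
    rw [h.onC.left x (hP hx), e x hx]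
  · simp only [Function.comp]
    rw [e' _ (h.onQ' y hy), h.iso.right _ (le_centralizerSup_right hy)]

variable [Finite G] {p : ℕ}

/-- A strongly closed subgroup is its own only F-conjugate. -/
theorem IsNormal.good (hF : RSat p F) (hQ : F.IsNormal Q) : Good p F Q := by
  obtain ⟨R, f, g, h, hR⟩ := hF Q hQ.1
  have hle : R ≤ Q := fun y hy => by
    rw [← h.right y hy]
    exact (hQ.isStronglyClosed.isMor_mem_iff h.mor (h.inv_map y hy)).2 (h.inv_map y hy)
  rwa [← Subgroup.eq_of_le_of_card_ge hle h.card_eq.le]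

/-- Since C_S(Q) acts trivially on Q, the group N_u contains C_S(Q)Q for every u ∈ Aut_F(Q), and Q
is receptive. -/
theorem IsNormal.exists_centralizerAut (hF : RSat p F) (hQ : F.IsNormal Q) {u : G → G}
    (hu : F.IsMor Q u) : ∃ ψ ψ', CentralizerAut F Q ψ ψ' ∧ ∀ x ∈ Q, ψ x = u x := by
  have huQ : ∀ x ∈ Q, u x ∈ Q := fun x hx => (hQ.isStronglyClosed.isMor_mem_iff hu hx).2 hx
  obtain ⟨v, huv⟩ := hu.iso_self huQ
  obtain ⟨ψ, hψ, e⟩ := (hQ.good hF).receptive _ _ _ huv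
  have hle : F.centralizerSup Q ≤ F.extG Q u := by
    refine sup_le ?_ hu.le_extG
    rintro c ⟨hc, hcS⟩
    refine ⟨hcS, mem_normalizer_of_mem_centralizer hc, 1, F.carrier.one_mem, fun x hx => ?_⟩
    rw [mul_inv_eq_of_eq_mul (Subgroup.mem_centralizer_iff.1 hc x hx).symm]
    simp
  have hψ' := hψ.mono hle
  have hψQ : ∀ x ∈ Q, ψ x ∈ Q := fun x hx => by
    rw [e x hx]
    exact huQ x hx
  have hψC : ∀ x ∈ Subgroup.centralizer (Q : Set G) ⊓ F.carrier,
      ψ x ∈ Subgroup.centralizer (Q : Set G) ⊓ F.carrier := fun x hx =>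
    hψ'.map_centralizer le_centralizerSup_right hψQ (le_centralizerSup_left hx) hx.1
  obtain ⟨ψ', hi⟩ := hψ'.iso_self (hψ'.homOn.sup_le
    (fun x hx => le_centralizerSup_left (hψC x hx))
    fun x hx => le_centralizerSup_right (hψQ x hx))
  have hψQ' : ∀ x ∈ Q, ψ' x ∈ Q := fun x hx =>
    (hQ.isStronglyClosed.isMor_mem_iff hi.inv_mor (le_centralizerSup_right hx)).2 hx
  refine ⟨ψ, ψ', ⟨hi, ⟨hi.mor.homOn.mono le_centralizerSup_left,
    hi.inv_mor.homOn.mono le_centralizerSup_left, hψC, fun x hx => ?_,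
    fun x hx => hi.left x (le_centralizerSup_left hx),
    fun x hx => hi.right x (le_centralizerSup_left hx)⟩, hψQ, hψQ'⟩, e⟩
  exact hi.inv_mor.map_centralizer le_centralizerSup_right hψQ' (le_centralizerSup_left hx) hx.1

/-- The automorphisms of `R` in `F` which are the identity on `Q`. -/
def autFixing (F : FusionSystem G) (R : Subgroup G) (hR : R ≤ F.carrier) (Q : Subgroup G)
    (hQR : Q ≤ R) : Subgroup (MulAut R) where
  carrier := {α | α ∈ F.aut R hR ∧ ∀ x ∈ Q, autFun α x = x}
  one_mem' := ⟨Subgroup.one_mem _, fun x hx => by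
    rw [← autFun_apply 1 ⟨x, hQR hx⟩]
    rfl⟩
  mul_mem' := by
    rintro α β ⟨ha, ha'⟩ ⟨hb, hb'⟩
    refine ⟨Subgroup.mul_mem _ ha hb, fun x hx => ?_⟩
    rw [autFun_mul _ _ (hQR hx), hb' x hx, ha' x hx]
  inv_mem' := by
    rintro α ⟨ha, ha'⟩
    refine ⟨Subgroup.inv_mem _ ha, fun x hx => ?_⟩
    have := (autFun_iso ha).left x (hQR hx)
    rwa [ha' x hx] at this

/-- Everything is transported along ψ : PQ → R. Automorphisms of P in C_F(Q) correspond to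
automorphisms of R in F fixing Q pointwise; these are normal in Aut_F(R), so Aut_S(R) meets them in
a subgroup of index prime to p. For receptivity, a morphism is extended into F using R and brought
back by ψ⁻¹, which makes it the identity on Q again. -/
theorem good_centralizer (hQ : F.IsNormal Q) {P R : Subgroup G}
    (hZP : centerOf Q ≤ P) (hP : P ≤ Subgroup.centralizer (Q : Set G) ⊓ F.carrier)
    {ψ ψ' : G → G} (hψ : CentralizerAut F Q ψ ψ') (hPR : F.Iso (P ⊔ Q) R ψ ψ')
    (hR : Good p F R) : Good p (F.centralizer Q hQ.1) P := by
  have hPQD : P ⊔ Q ≤ F.centralizerSup Q := sup_le_sup_right hP _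
  have hQR : Q ≤ R := fun y hy => by
    rw [← hψ.iso.right y (le_centralizerSup_right hy)]
    exact hPR.map _ (le_sup_right (a := P) (hψ.onQ' y hy))
  refine ⟨hP, ?_, ?_⟩
  · have hn : ∀ β ∈ F.aut R hR.le, ∀ α ∈ F.autFixing R hR.le Q hQR,
        β * α * β⁻¹ ∈ F.autFixing R hR.le Q hQR := by
      rintro β hb α ⟨ha, ha'⟩
      refine ⟨Subgroup.mul_mem _ (Subgroup.mul_mem _ hb ha) (Subgroup.inv_mem _ hb),
        fun x hx => ?_⟩
      have hxR := hQR hx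
      rw [autFun_mul _ _ hxR, autFun_mul _ _ (autFun_mem _ hxR), ha' _
        ((hQ.isStronglyClosed.isMor_mem_iff (autFun_iso hb).inv_mor hxR).2 hx),
        (autFun_iso hb).right x hxR]
    have hi := Subgroup.relIndex_dvd_relIndex_of_conj (A := F.aut R hR.le) (H := F.autConj R)
      (K := F.autFixing R hR.le Q hQR) (fun α hα => hα.1) hn
    have hd := relIndex_dvd_of_rel (A := F.autFixing R hR.le Q hQR) (H := F.autConj R)
      (B := (F.centralizer Q hQ.1).aut P hP) (K := (F.centralizer Q hQ.1).autConj P)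
      (rel := fun κ α => ∀ x ∈ P, autFun κ (ψ x) = ψ (autFun α x)) ?_ ?_ ?_ ?_ ?_
    · exact fun h => hR.automized ((h.trans hd).trans hi)
    · rintro κ ⟨hκ, hκQ⟩
      have hk := (hPR.trans (autFun_iso hκ)).trans hPR.symm
      have hkQ : ∀ x ∈ Q, (ψ' ∘ autFun κ ∘ ψ) x = x := fun x hx => by
        simp only [Function.comp]
        rw [hκQ _ (hψ.onQ x hx), hψ.iso.left x (le_centralizerSup_right hx)]
      -- The map is an automorphism of PQ which is trivial on Q, so it preserves PQ ∩ C(Q) = P.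
      have hkP : ∀ x ∈ P, (ψ' ∘ autFun κ ∘ ψ) x ∈ P := fun x hx =>
        mem_of_mem_sup_of_mem_centralizer hZP hP (hk.map x (le_sup_left (a := P) hx))
          (hk.mor.map_centralizer le_sup_right (fun y hy => by
            rw [hkQ y hy]
            exact hy) (le_sup_left (a := P) hx) (hP hx).1).1
      obtain ⟨k', hk'⟩ := IsMor.iso_self (F := F.centralizer Q hQ.1) (isMor_centralizer_iff.2
        ⟨hP, _, hk.mor, fun _ _ => rfl, hkQ⟩) hkP
      refine ⟨_, hk'.toMulEquiv_mem_aut hP, fun x hx => ?_⟩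
      rw [hk'.autFun_toMulEquiv hx]
      exact (hPR.right _ (autFun_mem _ (hPR.map x (le_sup_left (a := P) hx)))).symm
    · intro κ _ α _ α' _ h h'
      apply mulAut_ext
      intro x hx
      refine hPR.mor.inj (le_sup_left (a := P) (autFun_mem _ hx))
        (le_sup_left (a := P) (autFun_mem _ hx)) ?_
      rw [← h x hx, ← h' x hx]
    · intro κ _ κ' _ α _ α' _ h h' x hx
      rw [autFun_mul _ _ (hPR.map x (le_sup_left (a := P) hx)), autFun_mul _ _ hx, h' x hx,
        h _ (autFun_mem _ hx)]
    · intro α hα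
      obtain ⟨-, f', hf', e, e'⟩ := isMor_centralizer_iff.1 (autFun_iso hα).mor
      have hm : ∀ x ∈ P ⊔ Q, f' x ∈ P ⊔ Q := by
        refine hf'.homOn.sup_le (fun x hx => ?_) fun x hx => ?_
        · rw [e x hx]
          exact le_sup_left (a := P) (autFun_mem _ hx)
        · rw [e' x hx]
          exact le_sup_right (a := P) hx
      obtain ⟨f'', hf⟩ := hf'.iso_self hm
      have hk := (hPR.symm.trans hf).trans hPR
      refine ⟨_, ⟨hk.toMulEquiv_mem_aut hR.le, fun x hx => ?_⟩, fun x hx => ?_⟩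
      · rw [hk.autFun_toMulEquiv (hQR hx)]
        simp only [Function.comp]
        rw [e' _ (hψ.onQ' x hx), hψ.iso.right x (le_centralizerSup_right hx)]
      · have hx' : x ∈ P ⊔ Q := le_sup_left (a := P) hx
        rw [hk.autFun_toMulEquiv (hPR.map x hx')]
        simp only [Function.comp]
        rw [hPR.left x hx', e x hx]
    · rintro κ ⟨hκ, hκQ⟩ α - hκS h
      obtain ⟨s, hs, hs'⟩ := mem_autConj_iff.1 hκS
      -- As κ fixes Q pointwise, s centralizes Q. Thus ψ⁻¹(s) lies in C_S(Q), and it induces α on P.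
      have hsC : s ∈ Subgroup.centralizer (Q : Set G) ⊓ F.carrier := by
        refine ⟨Subgroup.mem_centralizer_iff.2 fun y hy => ?_, hs⟩
        have h1 := hs' y (hQR hy)
        rw [hκQ y hy] at h1
        exact eq_mul_inv_iff_mul_eq.1 h1
      refine mem_autConj_iff.2 ⟨ψ' s, hψ.onC.map' s hsC, fun x hx => ?_⟩
      have hd := le_centralizerSup_left (hψ.onC.map' s hsC)
      have hxD := hPQD (le_sup_left (a := P) hx)
      refine hψ.iso.mor.inj (hPQD (le_sup_left (a := P) (autFun_mem _ hx)))
        (Subgroup.mul_mem _ (Subgroup.mul_mem _ hd hxD) (Subgroup.inv_mem _ hd)) ?_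
      rw [← h x hx, hs' _ (hPR.map x (le_sup_left (a := P) hx)), hψ.iso.mor.homOn.map_conj hd hxD,
        hψ.onC.right s hsC]
  · intro X g g' hg
    obtain ⟨hX, k, hk, e, e'⟩ := isMor_centralizer_iff.1 hg.mor
    have hki : ∃ k', F.Iso (X ⊔ Q) (P ⊔ Q) k k' := by
      obtain ⟨k', hk'⟩ := hk.iso
      have : img k (X ⊔ Q) = P ⊔ Q := by
        apply le_antisymm
        · refine img_le.2 (hk.homOn.sup_le (fun x hx => ?_) fun x hx => ?_)
          · rw [e x hx]
            exact le_sup_left (a := P) (hg.map x hx)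
          · rw [e' x hx]
            exact le_sup_right (a := P) hx
        · refine sup_le (fun y hy => ?_) fun y hy => ?_
          · rw [← hg.right y hy, ← e _ (hg.inv_map y hy)]
            exact mem_img_of_mem (le_sup_left (a := X) (hg.inv_map y hy))
          · rw [← e' y hy]
            exact mem_img_of_mem (le_sup_right (a := X) hy)
      rw [this] at hk'
      exact ⟨k', hk'⟩
    obtain ⟨k', hki⟩ := hki
    obtain ⟨ω, hω, hω'⟩ := hR.receptive _ _ _ (hki.trans hPR)
    set D := (F.centralizer Q hQ.1).extG X g with hD
    have hDC : D ≤ Subgroup.centralizer (Q : Set G) ⊓ F.carrier := fun a ha => ha.1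
    -- For a ∈ N_g realized by h, the maps k c_a and c_h k agree on X by assumption and on Q because
    -- a and h centralize Q; hence they agree on XQ.
    have hext : D ⊔ Q ≤ F.extG (X ⊔ Q) (ψ ∘ k) := by
      refine sup_le ?_ (le_sup_right.trans (hki.trans hPR).mor.le_extG)
      rintro a ⟨ha, haX, h, hh, H⟩
      have haQ : ∀ x ∈ Q, a * x * a⁻¹ = x := fun x hx =>
        mul_inv_eq_of_eq_mul (Subgroup.mem_centralizer_iff.1 ha.1 x hx).symm
      have hhQ : ∀ x ∈ Q, h * x * h⁻¹ = x := fun x hx =>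
        mul_inv_eq_of_eq_mul (Subgroup.mem_centralizer_iff.1 hh.1 x hx).symm
      have haN : a ∈ Subgroup.normalizer ((X ⊔ Q : Subgroup G) : Set G) :=
        Subgroup.normalizer_inf_normalizer_le_normalizer_sup X Q
          ⟨haX, centralizer_le_normalizer F Q ha⟩
      refine ⟨ha.2, haN, ψ h, (hψ.onC.map h hh).2, ?_⟩
      have hm : HomOn (fun x => k (a * x * a⁻¹)) (X ⊔ Q) := fun x hx y hy => by
        have := hk.homOn _ (conj_mem_of_mem_normalizer haN hx) _
          (conj_mem_of_mem_normalizer haN hy)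
        simpa [mul_assoc] using this
      have hm' : HomOn (fun x => h * k x * h⁻¹) (X ⊔ Q) := fun x hx y hy => by
        have := hk.homOn _ hx _ hy
        simp [this, mul_assoc]
      have hall := hm.eqOn_sup hm' (fun x hx => by
        rw [e x hx, e _ (conj_mem_of_mem_normalizer haX hx)]
        exact H x hx) fun x hx => by rw [haQ x hx, e' x hx, hhQ x hx]
      intro x hx
      simp only [Function.comp]
      rw [hall x hx, hψ.iso.mor.homOn.map_conj (le_centralizerSup_left hh)
        (hPQD (hki.map x hx))]
    have hω₁ := hω.mono hext
    have hωQ : ∀ x ∈ Q, ω x = ψ x := fun x hx => by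
      rw [hω' x (le_sup_right (a := X) hx), Function.comp, e' x hx]
    have hωD : ∀ x ∈ D ⊔ Q, ω x ∈ F.centralizerSup Q := by
      refine hω₁.homOn.sup_le (fun x hx => le_centralizerSup_left ?_) fun x hx => ?_
      · refine hω₁.map_centralizer le_sup_right (fun y hy => ?_) (le_sup_left (a := D) hx)
          (hDC hx).1
        rw [hωQ y hy]
        exact hψ.onQ y hy
      · rw [hωQ x hx]
        exact le_centralizerSup_right (hψ.onQ x hx)
    refine ⟨ψ' ∘ ω, isMor_centralizer_iff.2 ⟨hDC, ψ' ∘ ω,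
      hω₁.comp hψ.iso.inv_mor hωD, fun _ _ => rfl, fun x hx => ?_⟩, fun x hx => ?_⟩
    · simp only [Function.comp]
      rw [hωQ x hx, hψ.iso.left x (le_centralizerSup_right hx)]
    · simp only [Function.comp]
      rw [hω' x (le_sup_left (a := X) hx), Function.comp, e x hx,
        hψ.iso.left _ (hPQD (le_sup_left (a := P) (hg.map x hx)))]

/-- Take ρ from PQ to a good subgroup R. In general ρ moves Q, so divide by an automorphism ψ of
C_S(Q)Q which agrees with ρ on Q. Then ψ⁻¹ρ is the identity on Q, and ψ carries (ψ⁻¹ρ)(P)Q onto R.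
-/
theorem exists_good_centralizer (hF : RSat p F) (hQ : F.IsNormal Q) {P : Subgroup G}
    (hZP : centerOf Q ≤ P) (hP : P ≤ Subgroup.centralizer (Q : Set G) ⊓ F.carrier) :
    ∃ P' g g', (F.centralizer Q hQ.1).Iso P P' g g' ∧ Good p (F.centralizer Q hQ.1) P' := by
  obtain ⟨R, ρ, ρ', hρ, hR⟩ := hF (P ⊔ Q) (sup_le (hP.trans inf_le_right) hQ.1)
  have hρQ : ∀ x ∈ Q, ρ x ∈ Q := fun x hx =>
    (hQ.isStronglyClosed.isMor_mem_iff hρ.mor (le_sup_right (a := P) hx)).2 hx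
  obtain ⟨ψ, ψ', hψ, e⟩ := hQ.exists_centralizerAut hF (hρ.mor.mono le_sup_right)
  have hρD : ∀ x ∈ P ⊔ Q, ρ x ∈ F.centralizerSup Q :=
    hρ.mor.homOn.sup_le (fun x hx => le_centralizerSup_left (hρ.mor.map_centralizer le_sup_right
      hρQ (le_sup_left (a := P) hx) (hP hx).1)) fun x hx => le_centralizerSup_right (hρQ x hx)
  have hτ := hρ.mor.comp hψ.iso.inv_mor hρD
  have hτQ : ∀ x ∈ Q, (ψ' ∘ ρ) x = x := fun x hx => by
    rw [Function.comp, ← e x hx, hψ.iso.left x (le_centralizerSup_right hx)]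
  have hτC : (F.centralizer Q hQ.1).IsMor P (ψ' ∘ ρ) :=
    isMor_centralizer_iff.2 ⟨hP, _, hτ, fun _ _ => rfl, hτQ⟩
  obtain ⟨τ', hτ'⟩ := hτC.iso
  refine ⟨_, _, τ', hτ', good_centralizer hQ (R := R) (fun z hz => ?_) hτ'.inv_mor.dom_le hψ ?_ hR⟩
  · rw [← hτQ z hz.1]
    exact mem_img_of_mem (hZP hz)
  · have hP' : img (ψ' ∘ ρ) P ≤ Subgroup.centralizer (Q : Set G) ⊓ F.carrier := hτ'.inv_mor.dom_le
    have hle : img (ψ' ∘ ρ) P ⊔ Q ≤ F.centralizerSup Q := sup_le_sup_right hP' _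
    have hψτ : ∀ x ∈ P ⊔ Q, ψ ((ψ' ∘ ρ) x) = ρ x := fun x hx => hψ.iso.right _ (hρD x hx)
    have := hψ.iso.mono hle
    have himg : img ψ (img (ψ' ∘ ρ) P ⊔ Q) = R := by
      apply le_antisymm
      · refine img_le.2 ((hψ.iso.mor.mono hle).homOn.sup_le (fun y hy => ?_) fun y hy => ?_)
        · obtain ⟨x, hx, rfl⟩ := hτC.homOn.mem_img.1 hy
          rw [hψτ x (le_sup_left (a := P) hx)]
          exact hρ.map x (le_sup_left (a := P) hx)
        · rw [e y hy]
          exact hρ.map y (le_sup_right (a := P) hy)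
      · intro y hy
        have hx := hρ.inv_map y hy
        rw [← hρ.right y hy, ← hψτ _ hx]
        refine mem_img_of_mem (hτ.homOn.sup_le (fun x hx => ?_) (fun x hx => ?_) _ hx)
        · exact le_sup_left (a := img (ψ' ∘ ρ) P) (mem_img_of_mem hx)
        · rw [hτQ x hx]
          exact le_sup_right (a := img (ψ' ∘ ρ) P) hx
    rwa [himg] at this

theorem RSat.quotient_centralizer (hp : p.Prime) (hG : IsPGroup p G) (hF : RSat p F)
    (hQ : F.IsNormal Q) : RSat p ((F.centralizer Q hQ.1).quotient (centerOf Q)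
      (F.isStronglyClosed_centerOf Q hQ.1)) := by
  refine RSat.quotient hp hG _ (fun P f hf z hz hzZ => ?_) fun P hZP hP =>
    exists_good_centralizer hF hQ hZP hP
  obtain ⟨-, f', -, e, e'⟩ := isMor_centralizer_iff.1 hf
  rw [← e z hz, e' z hzZ.1]

end FusionSystem

/-! ### Triviality of O_p for the quotient of the centralizer of O_p(F) -/

namespace FusionSystem

variable {G : Type*} [Group G] [Finite G] {p : ℕ} {F : FusionSystem G} {Q : Subgroup G}

/-- The automorphism of `C_S(Q) / Z(Q)` induced by an automorphism of `C_S(Q) Q`. -/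
theorem CentralizerAut.exists_quotient {ψ ψ' : G → G} (h : CentralizerAut F Q ψ ψ')
    (hQ : Q ≤ F.carrier) :
    ∃ β β', AutOn ((F.centralizer Q hQ).quotient (centerOf Q)
        (F.isStronglyClosed_centerOf Q hQ)).carrier β β' ∧
      (F.centralizer Q hQ).Covers (centerOf Q) (F.centralizer Q hQ).carrier ψ β ∧
      (F.centralizer Q hQ).Covers (centerOf Q) (F.centralizer Q hQ).carrier ψ' β' := by
  have main : ∀ {ψ ψ' : G → G}, CentralizerAut F Q ψ ψ' →
      ∃ β : (F.centralizer Q hQ).carrier ⧸ (centerOf Q).subgroupOf (F.centralizer Q hQ).carrier →*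
        (F.centralizer Q hQ).carrier ⧸ (centerOf Q).subgroupOf (F.centralizer Q hQ).carrier,
        (F.centralizer Q hQ).Covers (centerOf Q) (F.centralizer Q hQ).carrier ψ β := by
    intro ψ ψ' h
    let f : (F.centralizer Q hQ).carrier →* (F.centralizer Q hQ).carrier :=
      MonoidHom.mk' (fun x => ⟨ψ x, h.onC.map x x.2⟩)
        fun x y => Subtype.ext (h.onC.hom x x.2 y y.2)
    refine ⟨QuotientGroup.map _ _ f fun z hz => ?_, fun x w _ hw => ?_⟩
    · exact ⟨h.onQ _ hz.1, (h.onC.map _ z.2).1⟩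
    · exact congrArg _ (Subtype.ext hw)
  obtain ⟨β, hβ⟩ := main h
  obtain ⟨β', hβ'⟩ := main h.symm
  refine ⟨β, β', ⟨fun x _ y _ => map_mul β x y, fun x _ y _ => map_mul β' x y, fun _ _ => trivial,
    fun _ _ => trivial, fun a _ => ?_, fun a _ => ?_⟩, hβ, hβ'⟩
  · induction a using QuotientGroup.induction_on with
    | H x =>
      rw [hβ x ⟨_, h.onC.map x x.2⟩ x.2 rfl]
      exact hβ' _ x (h.onC.map x x.2) (h.onC.left x x.2)
  · induction a using QuotientGroup.induction_on with
    | H x =>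
      rw [hβ' x ⟨_, h.onC.map' x x.2⟩ x.2 rfl]
      exact hβ _ x (h.onC.map' x x.2) (h.onC.right x x.2)

theorem CentralizerAut.quotient_isMor {ψ ψ' : G → G} (h : CentralizerAut F Q ψ ψ')
    {hQ : Q ≤ F.carrier}
    {β β' : (F.centralizer Q hQ).carrier ⧸ (centerOf Q).subgroupOf (F.centralizer Q hQ).carrier →
        (F.centralizer Q hQ).carrier ⧸ (centerOf Q).subgroupOf (F.centralizer Q hQ).carrier}
    (hβa : AutOn ((F.centralizer Q hQ).quotient (centerOf Q)
        (F.isStronglyClosed_centerOf Q hQ)).carrier β β')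
    (hβ : (F.centralizer Q hQ).Covers (centerOf Q) (F.centralizer Q hQ).carrier ψ β)
    (hβ' : (F.centralizer Q hQ).Covers (centerOf Q) (F.centralizer Q hQ).carrier ψ' β')
    {A : Subgroup _} {f}
    (hf : ((F.centralizer Q hQ).quotient (centerOf Q)
        (F.isStronglyClosed_centerOf Q hQ)).IsMor A f) :
    ((F.centralizer Q hQ).quotient (centerOf Q)
        (F.isStronglyClosed_centerOf Q hQ)).IsMor (img β A) (β ∘ f ∘ β') := by
  obtain ⟨g, hg, hc⟩ := (isMor_quotient_iff _).1 hf
  have hm : ∀ x : (F.centralizer Q hQ).carrier,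
      (x : G) ∈ (F.centralizer Q hQ).preim (centerOf Q) (img β A) →
      ψ' x ∈ (F.centralizer Q hQ).preim (centerOf Q) A := by
    intro x hx
    obtain ⟨a, ha, e⟩ := (hβa.hom.mono le_top).mem_img.1 ((mem_preim x).1 hx)
    refine (mem_preim (⟨_, h.onC.map' x x.2⟩ : (F.centralizer Q hQ).carrier)).2 ?_
    rw [← hβ' x _ x.2 rfl, ← e, hβa.left a trivial]
    exact ha
  refine (isMor_quotient_iff _).2 ⟨_, (h.isMor hg).mono fun x hx => ?_, fun x w hx hw => ?_⟩
  · have hxC := preim_le hx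
    rw [← h.onC.right x hxC]
    exact mem_img_of_mem (hm ⟨x, hxC⟩ hx)
  · have hx' := hm x hx
    simp only [Function.comp]
    rw [hβ' x ⟨_, h.onC.map' x x.2⟩ x.2 rfl, hc _ ⟨_, hg.mem hx'⟩ hx' rfl]
    exact hβ _ w (hg.mem hx') hw

theorem CentralizerAut.map_mem_preim_opCore {ψ ψ' : G → G} (h : CentralizerAut F Q ψ ψ')
    {hQ : Q ≤ F.carrier} {x : G}
    (hx : x ∈ (F.centralizer Q hQ).preim (centerOf Q)
      ((F.centralizer Q hQ).quotient (centerOf Q) (F.isStronglyClosed_centerOf Q hQ)).opCore) :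
    ψ x ∈ (F.centralizer Q hQ).preim (centerOf Q)
      ((F.centralizer Q hQ).quotient (centerOf Q)
        (F.isStronglyClosed_centerOf Q hQ)).opCore := by
  obtain ⟨β, β', ha, hβ, hβ'⟩ := h.exists_quotient hQ
  have hxC := preim_le hx
  refine (mem_preim (⟨_, h.onC.map x hxC⟩ : (F.centralizer Q hQ).carrier)).2 ?_
  rw [← hβ ⟨x, hxC⟩ _ hxC rfl]
  exact ha.map_opCore (fun P f hf => h.quotient_isMor ha hβ hβ' hf)
    (fun P f hf => h.symm.quotient_isMor ha.symm hβ' hβ hf)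
    ((mem_preim (⟨x, hxC⟩ : (F.centralizer Q hQ).carrier)).1 hx)

/-- Apply `RSat.isNormal_of_elements` with b = kψ: here ψ corrects the action of the morphism on Q,
and k is an automorphism of N in C_F(Q), lifted from the quotient. The error term lies in Z(Q),
which is central in N because N ≤ C_S(Q). -/
theorem isNormal_preim_opCore (hp : p.Prime) (hG : IsPGroup p G) (hF : RSat p F)
    (hQ : F.IsNormal Q) : F.IsNormal ((F.centralizer Q hQ.1).preim (centerOf Q)
      ((F.centralizer Q hQ.1).quotient (centerOf Q)
        (F.isStronglyClosed_centerOf Q hQ.1)).opCore) := by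
  set E := F.centralizer Q hQ.1
  have hZ : E.IsStronglyClosed (centerOf Q) := F.isStronglyClosed_centerOf Q hQ.1
  set B := (E.quotient (centerOf Q) hZ).opCore
  set N := E.preim (centerOf Q) B
  have hNE : N ≤ E.carrier := preim_le
  have hZN : centerOf Q ≤ N := le_preim hZ.1 B
  have hEF : E ≤ F := centralizer_le hQ.1
  refine hF.isNormal_of_elements hp hG (hNE.trans hEF.1) fun x hx f hf => ?_
  obtain ⟨-, -, hext⟩ := isNormal_iff.1 hQ
  obtain ⟨φ, hφ, e, hφQ⟩ := hext _ _ hf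
  obtain ⟨ψ, ψ', hψ, hψφ⟩ := hQ.exists_centralizerAut hF (hφ.mono le_sup_left)
  have hyN : ψ x ∈ N := hψ.map_mem_preim_opCore hx
  have hxC := hNE hx
  have hyC := hNE hyN
  set W := Subgroup.zpowers (ψ x) ⊔ centerOf Q
  have hWN : W ≤ N := sup_le (Subgroup.zpowers_le.2 hyN) hZN
  have hWQ : W ⊔ Q ≤ F.centralizerSup Q := sup_le_sup_right (hWN.trans hNE) _
  -- This makes φψ⁻¹ defined on WQ. It is the identity on Q, hence a morphism of C_F(Q) on W sending
  -- ψ(x) to f(x); W includes Z(Q) so that it descends to the quotient.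
  have hψ'x : ∀ y ∈ W ⊔ Q, ψ' y ∈ Q ⊔ Subgroup.zpowers x := by
    refine (hψ.iso.inv_mor.mono hWQ).homOn.sup_le (((hψ.iso.inv_mor.mono
      (le_sup_left.trans hWQ)).homOn).sup_le (fun y hy => ?_) fun y hy => ?_) fun y hy => ?_
    · have h1 : Subgroup.zpowers (ψ x) ≤ img ψ (Subgroup.zpowers x) :=
        Subgroup.zpowers_le.2 (mem_img_of_mem (Subgroup.mem_zpowers x))
      obtain ⟨z, hz, rfl⟩ := (hψ.onC.hom.mono (Subgroup.zpowers_le.2 hxC)).mem_img.1 (h1 hy)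
      rw [hψ.onC.left z (Subgroup.zpowers_le.2 hxC hz)]
      exact le_sup_right (a := Q) hz
    · exact le_sup_left (a := Q) (hψ.onQ' y hy.1)
    · exact le_sup_left (a := Q) (hψ.onQ' y hy)
  have hχF : F.IsMor (W ⊔ Q) (φ ∘ ψ') := (hψ.iso.inv_mor.mono hWQ).comp hφ hψ'x
  have hχ : E.IsMor W (φ ∘ ψ') := by
    refine isMor_centralizer_iff.2 ⟨hWN.trans hNE, _, hχF, fun _ _ => rfl, fun q hq => ?_⟩
    rw [Function.comp, ← hψφ _ (hψ.onQ' q hq), hψ.iso.right q (le_centralizerSup_right hq)]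
  have hχx : (φ ∘ ψ') (ψ x) = f x := by
    rw [Function.comp, hψ.onC.left x hxC, e x (Subgroup.mem_zpowers x)]
  have hyW : ψ x ∈ W := le_sup_left (a := Subgroup.zpowers (ψ x)) (Subgroup.mem_zpowers _)
  obtain ⟨χ, hχc⟩ := hχ.exists_covers hZ le_sup_right
  obtain ⟨-, -, hext'⟩ := isNormal_iff.1 (E.quotient (centerOf Q) hZ).isNormal_opCore
  obtain ⟨κ, hκ, eκ, hκB⟩ := hext' _ _ (hχ.quotient hZ le_sup_right hχc)
  obtain ⟨κ', hκi⟩ := (hκ.mono le_sup_left).iso_self hκB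
  obtain ⟨k, k', hkc, hk⟩ := hκi.exists_lift hZ
  obtain ⟨ψ₁, hψN⟩ := (hψ.iso.mor.mono (hNE.trans le_centralizerSup_left)).iso_self
    fun x hx => hψ.map_mem_preim_opCore hx
  refine ⟨_, _, hψN.trans (hk.ofLE hEF), ?_⟩
  have hfC := hχ.mem hyW
  rw [hχx] at hfC
  have hkC := hk.mor.mem hyN
  have e1 := hkc ⟨ψ x, hyC⟩ ⟨_, hkC⟩ hyN rfl
  rw [eκ _ ((mk_mem_quo le_sup_right).2 hyW), hχc ⟨ψ x, hyC⟩ ⟨f x, hfC⟩ hyW hχx] at e1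
  have hz := mk_eq_mk_iff.1 e1.symm
  -- The quotient gives the error term as k(ψx)⁻¹ f(x) ∈ Z(Q). The order may be exchanged since
  -- k(ψx) centralizes Q.
  have hzc : f x * (k (ψ x))⁻¹ = (k (ψ x))⁻¹ * f x := by
    have := Subgroup.mem_centralizer_iff.1 hkC.1 _ hz.1
    change ((k (ψ x))⁻¹ * f x) * k (ψ x) = k (ψ x) * ((k (ψ x))⁻¹ * f x) at this
    rw [mul_inv_cancel_left] at this
    rw [mul_inv_eq_iff_eq_mul, this]
  rw [Function.comp, hzc]
  refine ⟨hZN hz, Subgroup.mem_centralizer_iff.2 fun y hy => ?_⟩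
  exact (Subgroup.mem_centralizer_iff.1 (hNE hy).1 _ hz.1).symm

/-- The preimage of O_p is normal in F, hence contained in Q; it also lies in C_S(Q), so it is
contained in Z(Q). -/
theorem opCore_coreQuotient (hp : p.Prime) (hG : IsPGroup p G) (hF : RSat p F) :
    F.coreQuotient.opCore = ⊥ := by
  have hQ := F.isNormal_opCore
  have hle : (F.centralizer F.opCore F.opCore_le).preim (centerOf F.opCore)
      F.coreQuotient.opCore ≤ F.opCore :=
    (isNormal_preim_opCore hp hG hF hQ).le_opCore
  rw [eq_bot_iff]
  intro a ha
  induction a using QuotientGroup.induction_on with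
  | H x =>
    rw [Subgroup.mem_bot]
    exact (mk_eq_one x).2 ⟨hle ((mem_preim x).2 ha), x.2.1⟩

theorem rsat_coreQuotient (hp : p.Prime) (hG : IsPGroup p G) (hF : RSat p F) :
    RSat p F.coreQuotient :=
  hF.quotient_centralizer hp hG F.isNormal_opCore

end FusionSystem

/-! ### Transport of a fusion system along an automorphism of its group -/

namespace FusionSystem

variable {G : Type*} [Group G]

/-- The homomorphism given by a function which is multiplicative on a subgroup. -/
def HomOn.toHom {f : G → G} {P : Subgroup G} (h : HomOn f P) : P →* G :=
  MonoidHom.mk' (fun x => f x) fun x y => h x x.2 y y.2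

/-- The fusion system obtained from `E` by transport along an automorphism of its underlying
group. -/
def conj (E : FusionSystem G) (b b' : G → G) (h : AutOn E.carrier b b') : FusionSystem G where
  carrier := E.carrier
  Mor P := {φ | P ≤ E.carrier ∧ ∃ k, E.IsMor (img b' P) k ∧
    ∀ x (hx : x ∈ P), φ ⟨x, hx⟩ = b (k (b' x))}
  dom_le hφ := hφ.1
  range_le := by
    rintro P φ ⟨-, k, hk, e⟩ _ ⟨⟨x, hx⟩, rfl⟩
    rw [e x hx]
    exact h.map _ (hk.mem (mem_img_of_mem hx))
  injective := by
    rintro P φ ⟨hP, k, hk, e⟩ ⟨x, hx⟩ ⟨y, hy⟩ hxy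
    rw [e x hx, e y hy] at hxy
    have h1 := congrArg b' hxy
    rw [h.left _ (hk.mem (mem_img_of_mem hx)), h.left _ (hk.mem (mem_img_of_mem hy))] at h1
    have h2 := congrArg b (hk.inj (mem_img_of_mem hx) (mem_img_of_mem hy) h1)
    rw [h.right x (hP hx), h.right y (hP hy)] at h2
    exact Subtype.ext h2
  conj_mem := by
    intro P g hP hg
    refine ⟨hP, _, .of_conj (img_le.2 fun x hx => h.map' x (hP hx)) (h.map' g hg),
      fun x hx => ?_⟩
    rw [h.hom.map_conj (h.map' g hg) (h.map' x (hP hx)), h.right g hg, h.right x (hP hx)]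
    rfl
  comp_mem := by
    rintro P R φ ψ hPR ⟨hP, k, hk, e⟩ ⟨hR, l, hl, e'⟩
    have hm : ∀ x ∈ P, k (b' x) = b' (b (k (b' x))) ∧ b (k (b' x)) ∈ R := by
      intro x hx
      refine ⟨(h.left _ (hk.mem (mem_img_of_mem hx))).symm, ?_⟩
      rw [← e x hx]
      exact hPR _
    refine ⟨hP, l ∘ k, hk.comp hl fun y hy => ?_, fun x hx => ?_⟩
    · obtain ⟨x, hx, rfl⟩ := (h.hom'.mono hP).mem_img.1 hy
      rw [(hm x hx).1]
      exact mem_img_of_mem (hm x hx).2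
    · refine (e' _ (hPR ⟨x, hx⟩)).trans ?_
      rw [e x hx, ← (hm x hx).1]
      rfl
  inv_mem := by
    rintro P φ ⟨hP, k, hk, e⟩
    obtain ⟨l, hl⟩ := hk.iso
    have hb' : ∀ x (hx : x ∈ P), b' (φ ⟨x, hx⟩) = k (b' x) := fun x hx => by
      rw [e x hx, h.left _ (hk.mem (mem_img_of_mem hx))]
    have hr : φ.range ≤ E.carrier := by
      rintro _ ⟨⟨x, hx⟩, rfl⟩
      rw [e x hx]
      exact h.map _ (hk.mem (mem_img_of_mem hx))
    have hl' : E.IsMor (img b' φ.range) l := by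
      refine hl.inv_mor.mono (img_le.2 ?_)
      rintro _ ⟨⟨x, hx⟩, rfl⟩
      rw [hb' x hx]
      exact mem_img_of_mem (mem_img_of_mem hx)
    have hm : HomOn (fun y => b (l (b' y))) φ.range := fun x hx y hy => by
      dsimp only
      rw [h.hom' _ (hr hx) _ (hr hy), hl'.homOn _ (mem_img_of_mem hx) _ (mem_img_of_mem hy),
        h.hom _ (hl'.mem (mem_img_of_mem hx)) _ (hl'.mem (mem_img_of_mem hy))]
    refine ⟨hm.toHom, ⟨hr, l, hl', fun _ _ => rfl⟩, fun ⟨x, hx⟩ => ?_⟩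
    change b (l (b' (φ ⟨x, hx⟩))) = x
    rw [hb' x hx, hl.left _ (mem_img_of_mem hx), h.right x (hP hx)]

section Conj

variable {E : FusionSystem G} {b b' : G → G} (h : AutOn E.carrier b b')

include h

theorem isMor_conj_iff {P : Subgroup G} {f : G → G} : (E.conj b b' h).IsMor P f ↔
    P ≤ E.carrier ∧ ∃ k, E.IsMor (img b' P) k ∧ ∀ x ∈ P, f x = b (k (b' x)) := by
  constructor
  · rintro ⟨φ, ⟨hP, k, hk, e⟩, e'⟩
    exact ⟨hP, k, hk, fun x hx => by rw [← e' x hx, e x hx]⟩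
  · rintro ⟨hP, k, hk, e⟩
    have hm : HomOn f P := fun x hx y hy => by
      rw [e x hx, e y hy, e _ (P.mul_mem hx hy), h.hom' _ (hP hx) _ (hP hy),
        hk.homOn _ (mem_img_of_mem hx) _ (mem_img_of_mem hy),
        h.hom _ (hk.mem (mem_img_of_mem hx)) _ (hk.mem (mem_img_of_mem hy))]
    exact ⟨hm.toHom, ⟨hP, k, hk, e⟩, fun _ _ => rfl⟩

theorem IsMor.conj {P : Subgroup G} {f : G → G} (hf : E.IsMor P f) :
    (E.conj b b' h).IsMor (img b P) (b ∘ f ∘ b') := by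
  refine (isMor_conj_iff h).2 ⟨img_le.2 fun x hx => h.map x (hf.dom_le hx), f, ?_,
    fun _ _ => rfl⟩
  rwa [h.img_img hf.dom_le]

theorem IsMor.of_conj_system {P : Subgroup G} {f : G → G} (hf : (E.conj b b' h).IsMor P f) :
    E.IsMor (img b' P) (b' ∘ f ∘ b) := by
  obtain ⟨hP, k, hk, e⟩ := (isMor_conj_iff h).1 hf
  refine hk.congr fun y hy => ?_
  obtain ⟨x, hx, rfl⟩ := (h.hom'.mono hP).mem_img.1 hy
  simp only [Function.comp]
  rw [h.right x (hP hx), e x hx, h.left _ (hk.mem (mem_img_of_mem hx))]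

theorem Iso.conj {P Q : Subgroup G} {f g : G → G} (hf : E.Iso P Q f g) :
    (E.conj b b' h).Iso (img b P) (img b Q) (b ∘ f ∘ b') (b ∘ g ∘ b') := by
  have hP := hf.mor.dom_le
  have hQ := hf.inv_mor.dom_le
  refine ⟨hf.mor.conj h, hf.inv_mor.conj h, ?_, ?_, ?_, ?_⟩ <;> intro y hy
  · obtain ⟨x, hx, rfl⟩ := (h.hom.mono hP).mem_img.1 hy
    simp only [Function.comp, h.left x (hP hx)]
    exact mem_img_of_mem (hf.map x hx)
  · obtain ⟨x, hx, rfl⟩ := (h.hom.mono hQ).mem_img.1 hy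
    simp only [Function.comp, h.left x (hQ hx)]
    exact mem_img_of_mem (hf.inv_map x hx)
  · obtain ⟨x, hx, rfl⟩ := (h.hom.mono hP).mem_img.1 hy
    simp only [Function.comp, h.left x (hP hx), h.left _ (hf.mor.mem hx), hf.left x hx]
  · obtain ⟨x, hx, rfl⟩ := (h.hom.mono hQ).mem_img.1 hy
    simp only [Function.comp, h.left x (hQ hx), h.left _ (hf.inv_mor.mem hx), hf.right x hx]

theorem Iso.of_conj_system {P Q : Subgroup G} {f g : G → G} (hf : (E.conj b b' h).Iso P Q f g) :
    E.Iso (img b' P) (img b' Q) (b' ∘ f ∘ b) (b' ∘ g ∘ b) := by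
  have hP : P ≤ E.carrier := hf.mor.dom_le
  have hQ : Q ≤ E.carrier := hf.inv_mor.dom_le
  refine ⟨hf.mor.of_conj_system h, hf.inv_mor.of_conj_system h, ?_, ?_, ?_, ?_⟩ <;> intro y hy
  · obtain ⟨x, hx, rfl⟩ := (h.hom'.mono hP).mem_img.1 hy
    simp only [Function.comp, h.right x (hP hx)]
    exact mem_img_of_mem (hf.map x hx)
  · obtain ⟨x, hx, rfl⟩ := (h.hom'.mono hQ).mem_img.1 hy
    simp only [Function.comp, h.right x (hQ hx)]
    exact mem_img_of_mem (hf.inv_map x hx)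
  · obtain ⟨x, hx, rfl⟩ := (h.hom'.mono hP).mem_img.1 hy
    simp only [Function.comp, h.right x (hP hx), h.right _ (hf.mor.mem hx), hf.left x hx]
  · obtain ⟨x, hx, rfl⟩ := (h.hom'.mono hQ).mem_img.1 hy
    simp only [Function.comp, h.right x (hQ hx), h.right _ (hf.inv_mor.mem hx), hf.right x hx]

theorem Good.conj [Finite G] {p : ℕ} {Q : Subgroup G} (hQ : Good p E Q) :
    Good p (E.conj b b' h) (img b Q) where
  le := img_le.2 fun x hx => h.map x (hQ.le hx)
  automized := by
    have hbQ := h.hom.mono hQ.le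
    have hd := relIndex_dvd_of_rel (A := E.aut Q hQ.le) (H := E.autConj Q)
      (B := (E.conj b b' h).aut (img b Q) (img_le.2 fun x hx => h.map x (hQ.le hx)))
      (K := (E.conj b b' h).autConj (img b Q))
      (rel := fun α β => ∀ x ∈ Q, autFun β (b x) = b (autFun α x)) ?_ ?_ ?_ ?_ ?_
    · exact fun hdvd => hQ.automized (hdvd.trans hd)
    · intro α hα
      have hi := (autFun_iso hα).conj h
      refine ⟨_, hi.toMulEquiv_mem_aut _, fun x hx => ?_⟩
      rw [hi.autFun_toMulEquiv (mem_img_of_mem hx)]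
      simp only [Function.comp, h.left x (hQ.le hx)]
    · intro α _ β _ β' _ e e'
      apply mulAut_ext
      intro y hy
      obtain ⟨x, hx, rfl⟩ := hbQ.mem_img.1 hy
      rw [e x hx, e' x hx]
    · intro α _ α' _ β _ β' _ e e' x hx
      rw [autFun_mul _ _ (mem_img_of_mem hx), e' x hx, e _ (autFun_mem _ hx), autFun_mul _ _ hx]
    · intro β hβ
      have hi := (autFun_iso hβ).of_conj_system h
      rw [h.img_img hQ.le] at hi
      refine ⟨_, hi.toMulEquiv_mem_aut hQ.le, fun x hx => ?_⟩
      rw [hi.autFun_toMulEquiv hx]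
      simp only [Function.comp]
      rw [h.right]
      exact (autFun_iso hβ).mor.mem (mem_img_of_mem hx)
    · intro α hα β hβ hαS e
      obtain ⟨s, hs, e'⟩ := mem_autConj_iff.1 hαS
      refine mem_autConj_iff.2 ⟨b s, h.map s hs, fun y hy => ?_⟩
      obtain ⟨x, hx, rfl⟩ := hbQ.mem_img.1 hy
      rw [e x hx, e' x hx, h.hom.map_conj hs (hQ.le hx)]
  receptive := by
    intro X f g hf
    have hX : X ≤ E.carrier := hf.mor.dom_le
    have hi := hf.of_conj_system h
    rw [h.img_img hQ.le] at hi
    obtain ⟨k, hk, e⟩ := hQ.receptive _ _ _ hi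
    have hD : ∀ a ∈ (E.conj b b' h).extG X f, b' a ∈ E.extG (img b' X) (b' ∘ f ∘ b) := by
      rintro a ⟨ha, haX, s, hs, H⟩
      refine ⟨h.map' a ha, mem_normalizer_of_finite fun y hy => ?_, b' s, h.map' s hs,
        fun y hy => ?_⟩ <;> obtain ⟨x, hx, rfl⟩ := (h.hom'.mono hX).mem_img.1 hy
      · rw [← h.hom'.map_conj ha (hX hx)]
        exact mem_img_of_mem (conj_mem_of_mem_normalizer haX hx)
      · rw [← h.hom'.map_conj ha (hX hx)]
        simp only [Function.comp]
        rw [h.right x (hX hx), h.right _ (hX (conj_mem_of_mem_normalizer haX hx)), H x hx,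
          h.hom'.map_conj hs (hf.mor.mem hx)]
    refine ⟨b ∘ k ∘ b', (hk.conj h).mono fun a ha => ?_, fun x hx => ?_⟩
    · rw [← h.right a ha.1]
      exact mem_img_of_mem (hD a ha)
    · simp only [Function.comp]
      rw [e _ (mem_img_of_mem hx)]
      simp only [Function.comp]
      rw [h.right x (hX hx), h.right _ (hf.mor.mem hx)]

theorem RSat.conj [Finite G] {p : ℕ} (hE : RSat p E) : RSat p (E.conj b b' h) := by
  intro P hP
  obtain ⟨Q, f, g, hf, hQ⟩ := hE (img b' P) (img_le.2 fun x hx => h.map' x (hP hx))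
  have := hf.conj h
  rw [h.symm.img_img hP] at this
  exact ⟨_, _, _, this, hQ.conj h⟩

end Conj

/-! ### Invariance and factorization for O^p(F) and O^{p'}(F) -/

section Residual

variable {E F : FusionSystem G}

/-- The homomorphism between automorphism groups given by an isomorphism. -/
def Iso.autHom {P Q : Subgroup G} {f g : G → G} (h : F.Iso P Q f g) :
    F.aut P h.mor.dom_le →* F.aut Q h.inv_mor.dom_le where
  toFun α := ⟨MulAut.congr h.toMulEquiv α, h.congr_mem_aut α.2 _⟩
  map_one' := Subtype.ext (map_one _)
  map_mul' α β := Subtype.ext (map_mul (MulAut.congr h.toMulEquiv) (α : MulAut P) β)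

theorem conj_le (hEF : E ≤ F) {b b' : G → G} (h : F.Iso E.carrier E.carrier b b') :
    E.conj b b' h.autOn ≤ F := by
  refine le_iff_isMor.2 ⟨hEF.1, fun P f hf => ?_⟩
  obtain ⟨hP, k, hk, e⟩ := (isMor_conj_iff h.autOn).1 hf
  exact (((h.inv_mor.mono hP).comp ((le_iff_isMor.1 hEF).2 _ _ hk)
    fun x hx => mem_img_of_mem hx).comp h.mor
    fun x hx => hk.mem (mem_img_of_mem hx)).congr fun x hx => (e x hx).symm

theorem mem_aut_conj {b b' : G → G} (h : F.Iso E.carrier E.carrier b b') {P : Subgroup G}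
    (hP : P ≤ E.carrier) (α : F.aut P (hP.trans h.mor.dom_le))
    (hα : ((h.symm.mono hP).autHom α : MulAut (img b' P)) ∈
      E.aut (img b' P) (img_le.2 fun x hx => h.inv_map x (hP hx))) :
    (α : MulAut P) ∈ (E.conj b b' h.autOn).aut P hP := by
  rw [mem_aut_iff_isMor] at hα
  refine (mem_aut_iff_isMor (F := E.conj b b' h.autOn) hP).2
    ((isMor_conj_iff h.autOn).2 ⟨hP, _, hα, fun x hx => ?_⟩)
  have h1 := (h.symm.mono hP).autFun_congr (α : MulAut P) (mem_img_of_mem (f := b') hx)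
  rw [h.right x (hP hx)] at h1
  change _ = b (autFun (MulAut.congr _ _) _)
  rw [h1, h.right _ (hP (autFun_mem _ hx))]

variable [Finite G] {p : ℕ}

/-- Transport along an F-automorphism of the underlying group of E stays inside F. It keeps the
automizer condition because isomorphisms between automizers in F carry O^p into O^p. -/
theorem HasPPowerIndex.conj (hp : p.Prime) (hG : IsPGroup p G) (hE : HasPPowerIndex p E F)
    {b b' : G → G} (h : F.Iso E.carrier E.carrier b b') :
    HasPPowerIndex p (E.conj b b' h.autOn) F := by
  refine ⟨((hE.1.rsat hp).conj h.autOn).isSaturated hp hG, conj_le hE.2.1 h, hE.2.2.1, ?_⟩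
  rintro P hP hPF _ ⟨α, hα, rfl⟩
  exact mem_aut_conj h hP α (hE.2.2.2 _ _ _ ⟨_, mem_pResidual_of_hom hp (h.symm.mono hP).autHom hα, rfl⟩)

theorem HasPrimeToPIndex.conj (hp : p.Prime) (hG : IsPGroup p G) (hE : HasPrimeToPIndex p E F)
    {b b' : G → G} (h : F.Iso E.carrier E.carrier b b') :
    HasPrimeToPIndex p (E.conj b b' h.autOn) F := by
  refine ⟨((hE.1.rsat hp).conj h.autOn).isSaturated hp hG, conj_le hE.2.1 h, hE.2.2.1, ?_⟩
  rintro P hP hPF _ ⟨α, hα, rfl⟩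
  exact mem_aut_conj h hP α (hE.2.2.2 _ _ _ ⟨_, mem_pPrimeResidual_of_hom (h.symm.mono hP).autHom hα, rfl⟩)

/-- `E` is invariant under the automorphisms in `F` of its underlying group. -/
def Invariant (E F : FusionSystem G) : Prop :=
  ∀ b b', F.Iso E.carrier E.carrier b b' → ∀ P f, E.IsMor P f → E.IsMor (img b P) (b ∘ f ∘ b')

/-- The transport of E along the inverse automorphism competes with E, so by minimality it contains
E. -/
theorem IsOUpperP.invariant (hp : p.Prime) (hG : IsPGroup p G) (hE : IsOUpperP p F E) :
    Invariant E F := fun _ _ h _ _ hf =>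
  ((le_iff_isMor.1 (hE.2 ⟨hE.1.1.conj hp hG h.symm, hE.1.2⟩)).2 _ _ hf).of_conj_system h.symm.autOn

theorem IsOUpperPPrime.invariant (hp : p.Prime) (hG : IsPGroup p G) (hE : IsOUpperPPrime p F E) :
    Invariant E F := fun _ _ h _ _ hf =>
  ((le_iff_isMor.1 (hE.2 (hE.1.conj hp hG h.symm))).2 _ _ hf).of_conj_system h.symm.autOn

/-- On `P ∩ T`, where `T` is the underlying group of `E`, the map `f` factors as a morphism of `E`
followed by an automorphism of `T` in `F`. -/
def Factors (E F : FusionSystem G) (P : Subgroup G) (f : G → G) : Prop :=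
  (∀ x ∈ P, x ∈ E.carrier ↔ f x ∈ E.carrier) ∧ ∃ b b' e, F.Iso E.carrier E.carrier b b' ∧
    E.IsMor (P ⊓ E.carrier) e ∧ ∀ x ∈ P ⊓ E.carrier, f x = b (e x)

omit [Finite G]

theorem Factors.mono {P Q : Subgroup G} {f : G → G} (h : Factors E F Q f) (hPQ : P ≤ Q) :
    Factors E F P f := by
  obtain ⟨h1, b, b', e, hb, he, h2⟩ := h
  exact ⟨fun x hx => h1 x (hPQ hx), b, b', e, hb, he.mono (inf_le_inf_right _ hPQ),
    fun x hx => h2 x ⟨hPQ hx.1, hx.2⟩⟩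

theorem Factors.congr {P : Subgroup G} {f g : G → G} (h : Factors E F P f)
    (hfg : ∀ x ∈ P, f x = g x) : Factors E F P g := by
  obtain ⟨h1, b, b', e, hb, he, h2⟩ := h
  exact ⟨fun x hx => by rw [← hfg x hx]; exact h1 x hx, b, b', e, hb, he,
    fun x hx => by rw [← hfg x hx.1]; exact h2 x hx⟩

theorem Factors.comp (hinv : Invariant E F) {P Q : Subgroup G} {f g : G → G}
    (hf : Factors E F P f) (hg : Factors E F Q g) (hPQ : ∀ x ∈ P, f x ∈ Q) :
    Factors E F P (g ∘ f) := by
  obtain ⟨h1, b, b', e, hb, he, h2⟩ := hf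
  obtain ⟨k1, c, c', d, hc, hd, k2⟩ := hg
  have hm : ∀ x ∈ P ⊓ E.carrier, b (e x) ∈ Q ⊓ E.carrier := fun x hx => by
    rw [← h2 x hx]
    exact ⟨hPQ x hx.1, (h1 x hx.1).1 hx.2⟩
  -- Rewrite (c d)(b e) as (c b)(b⁻¹ d b · e); invariance puts b⁻¹ d b in E.
  refine ⟨fun x hx => (h1 x hx).trans (k1 _ (hPQ x hx)), _, _, _, hb.trans hc,
    he.comp (hinv b' b hb.symm _ _ hd) fun x hx => ?_, fun x hx => ?_⟩
  · rw [← hb.left _ (he.mem hx)]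
    exact mem_img_of_mem (hm x hx)
  · simp only [Function.comp]
    rw [h2 x hx, k2 _ (hm x hx), hb.right _ (hd.mem (hm x hx))]

theorem Factors.inv (hinv : Invariant E F) {P Q : Subgroup G} {f g : G → G} (h : F.Iso P Q f g)
    (hf : Factors E F P f) : Factors E F Q g := by
  obtain ⟨h1, b, b', e, hb, he, h2⟩ := hf
  obtain ⟨e', he'⟩ := he.iso
  have hm : ∀ y ∈ Q, y ∈ E.carrier ↔ g y ∈ E.carrier := fun y hy => by
    rw [h1 _ (h.inv_map y hy), h.right y hy]
  have hg : ∀ y ∈ Q ⊓ E.carrier, g y ∈ P ⊓ E.carrier ∧ y = b (e (g y)) := fun y hy => by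
    have hgy : g y ∈ P ⊓ E.carrier := ⟨h.inv_map y hy.1, (hm y hy.1).1 hy.2⟩
    refine ⟨hgy, ?_⟩
    rw [← h2 _ hgy, h.right y hy.1]
  -- Rewrite (b e)⁻¹ as b⁻¹ (b e⁻¹ b⁻¹), again using invariance.
  refine ⟨hm, b', b, _, hb.symm, (hinv b b' hb _ _ he'.inv_mor).mono fun y hy => ?_,
    fun y hy => ?_⟩
  · rw [(hg y hy).2]
    exact mem_img_of_mem (mem_img_of_mem (hg y hy).1)
  · obtain ⟨h3, h4⟩ := hg y hy
    have h5 : b' y = e (g y) := by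
      conv_lhs => rw [h4]
      exact hb.left _ (he.mem h3)
    simp only [Function.comp]
    rw [h5, he'.left _ h3, hb.left _ h3.2]

theorem factors_of_isMor (hEF : E ≤ F) {P : Subgroup G} {e : G → G} (he : E.IsMor P e) :
    Factors E F P e :=
  ⟨fun _ hx => iff_of_true (he.dom_le hx) (he.mem hx), id, id, e, .refl hEF.1,
    he.mono inf_le_left, fun _ _ => rfl⟩

variable [Finite G]

theorem RSat.factors (hp : p.Prime) (hG : IsPGroup p G) (hF : RSat p F) (hinv : Invariant E F)
    (step : ∀ P f g, Good p F P → F.Iso P P f g →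
      (∀ (Q : Subgroup G) k, P < Q → F.IsMor Q k → Factors E F Q k) → Factors E F P f) :
    ∀ P f, F.IsMor P f → Factors E F P f :=
  hF.induction hp hG (fun _ _ _ _ hPQ h => h.mono hPQ)
    (fun _ _ _ _ _ _ hPQ hf hg => hf.comp hinv hg hPQ) (fun _ _ _ _ h hf => hf.inv hinv h)
    (fun _ _ _ _ e h => h.congr e) step

/-- On ⟨x⟩ with x ∈ O_p(E), a morphism of F is b e. Here e extends to a morphism of E leaving O_p(E)
invariant, and b preserves O_p(E) by invariance of E. So the criterion applies with trivial error
term. -/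
theorem RSat.isNormal_opCore_of_factors (hp : p.Prime) (hG : IsPGroup p G) (hF : RSat p F)
    (hEF : E ≤ F) (hinv : Invariant E F) (hfac : ∀ P f, F.IsMor P f → Factors E F P f) :
    F.IsNormal E.opCore := by
  obtain ⟨hNT, -, hext⟩ := isNormal_iff.1 E.isNormal_opCore
  refine hF.isNormal_of_elements hp hG (hNT.trans hEF.1) fun x hx f hf => ?_
  obtain ⟨-, b, b', e, hb, he, h⟩ := hfac _ f hf
  have hxT : Subgroup.zpowers x ≤ E.carrier := Subgroup.zpowers_le.2 (hNT hx)
  have hxx := Subgroup.mem_zpowers x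
  rw [inf_eq_left.2 hxT] at he h
  obtain ⟨e', he', heq, hN⟩ := hext _ _ he
  have hb' : ∀ y ∈ E.opCore, b y ∈ E.opCore := fun y hy =>
    hb.autOn.map_opCore (hinv b b' hb) (hinv b' b hb.symm) hy
  have hmor := (((le_iff_isMor.1 hEF).2 _ _ (he'.mono le_sup_left)).comp hb.mor
    fun y hy => hNT (hN y hy))
  obtain ⟨c, hc⟩ := hmor.iso_self fun y hy => hb' _ (hN y hy)
  refine ⟨_, c, hc, ?_⟩
  rw [Function.comp, heq x hxx, h x hxx, mul_inv_cancel]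
  exact Subgroup.one_mem _

/-- Conjugation by an element of S permutes the defining generators of the hyperfocal subgroup. -/
theorem hyp_normal (hp : p.Prime) (F : FusionSystem G) :
    F.carrier ≤ Subgroup.normalizer (F.hyp p : Set G) := by
  intro s hs
  refine mem_normalizer_of_finite ?_
  suffices h : F.hyp p ≤ (F.hyp p).comap (MulAut.conj s).toMonoidHom from fun x hx => h hx
  unfold hyp
  rw [Subgroup.closure_le]
  rintro _ ⟨P, hP, x, α, hα, rfl⟩
  have hi := Iso.of_conj hP hs
  refine Subgroup.subset_closure ⟨_, hi.inv_mor.dom_le, ⟨_, hi.map x x.2⟩, _,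
    mem_pResidual_of_hom hp hi.autHom hα, ?_⟩
  change s * ((x : G)⁻¹ * ((α : MulAut P) x : P)) * s⁻¹ = _
  have h1 := hi.autFun_congr (α : MulAut P) (hi.map x x.2)
  rw [hi.left x x.2] at h1
  rw [autFun_apply, autFun_apply]
  change _ = _ * autFun (MulAut.congr hi.toMulEquiv (α : MulAut P)) _
  rw [h1]
  group

/-- For good P, Aut_F(P) = O^p(Aut_F(P)) Aut_S(P). Conjugations by S restrict to automorphisms of
the normal subgroup T = hyp(F). Elements of O^p(Aut_F(P)) move points by hyperfocal elements, so
they preserve P ∩ T, and restriction sends them into O^p(Aut_F(P ∩ T)), which lies in E. -/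
theorem IsOUpperP.factors (hp : p.Prime) (hG : IsPGroup p G) (hF : RSat p F)
    (hE : IsOUpperP p F E) : ∀ P f, F.IsMor P f → Factors E F P f := by
  have hinv := hE.invariant hp hG
  obtain ⟨⟨⟨-, hEF, -, hres⟩, hT⟩, -⟩ := hE
  have hTS : E.carrier ≤ F.carrier := hEF.1
  have hnorm : F.carrier ≤ Subgroup.normalizer (E.carrier : Set G) := by
    rw [hT]
    exact F.hyp_normal hp
  refine hF.factors hp hG hinv fun P f g hP h _ => ?_
  have hconj : ∀ α ∈ F.autConj P, Factors E F P (autFun α) := by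
    intro α hα
    obtain ⟨s, hs, e⟩ := mem_autConj_iff.1 hα
    have hb := (IsMor.of_conj hTS hs)
    obtain ⟨c, hc⟩ := hb.iso_self fun x hx => conj_mem_of_mem_normalizer (hnorm hs) hx
    refine Factors.congr (f := fun x => s * x * s⁻¹) ⟨fun x _ =>
      Subgroup.mem_normalizer_iff.1 (hnorm hs) x, _, c, id, hc, .of_id inf_le_right,
      fun _ _ => rfl⟩ fun x hx => (e x hx).symm
  have hmem : ∀ α : F.aut P hP.le, α ∈ pResidual p (F.aut P hP.le) →
      ∀ x ∈ P, x ∈ E.carrier ↔ autFun (α : MulAut P) x ∈ E.carrier := by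
    intro α hα x hx
    have : x⁻¹ * autFun (α : MulAut P) x ∈ E.carrier := by
      rw [hT]
      refine Subgroup.subset_closure ⟨P, hP.le, ⟨x, hx⟩, α, hα, ?_⟩
      rw [autFun_apply]
    have h1 := Subgroup.mul_mem_cancel_right E.carrier this (y := x)
    rw [mul_inv_cancel_left] at h1
    exact h1.symm
  have hprod : ∀ α : F.aut P hP.le, ∃ δ ∈ pResidual p (F.aut P hP.le),
      ∃ γ : F.aut P hP.le, (γ : MulAut P) ∈ F.autConj P ∧ α = δ * γ := by
    intro α
    have := (pResidual_spec hp (F.aut P hP.le)).1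
    have htop := pResidual_sup_eq_top hp (H := (F.autConj P).subgroupOf (F.aut P hP.le))
      hP.automized
    have hα : α ∈ pResidual p (F.aut P hP.le) ⊔ (F.autConj P).subgroupOf (F.aut P hP.le) := by
      rw [htop]
      trivial
    obtain ⟨δ, hδ, γ, hγ, e⟩ := Subgroup.mem_sup_of_normal_left.1 hα
    exact ⟨δ, hδ, γ, hγ, e.symm⟩
  have hmem' : ∀ α : F.aut P hP.le, ∀ x ∈ P,
      x ∈ E.carrier ↔ autFun (α : MulAut P) x ∈ E.carrier := by
    intro α x hx
    obtain ⟨δ, hδ, γ, hγ, rfl⟩ := hprod α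
    rw [(hconj _ hγ).1 x hx, hmem δ hδ _ (autFun_mem _ hx), Subgroup.coe_mul, autFun_mul _ _ hx]
  have hPT : P ⊓ E.carrier ≤ F.carrier := inf_le_left.trans hP.le
  -- Restriction to P ∩ T as a homomorphism on all of Aut_F(P), so that functoriality of O^p
  -- applies.
  obtain ⟨r, hr⟩ := exists_hom_of_rel (A := F.aut P hP.le) (B := F.aut (P ⊓ E.carrier) hPT)
    (rel := fun α β => ∀ x ∈ P ⊓ E.carrier, autFun β x = autFun α x) (fun α hα => by
      obtain ⟨c, hc⟩ := ((autFun_iso hα).mor.mono inf_le_left).iso_self (P := P ⊓ E.carrier)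
        fun x hx => ⟨autFun_mem _ hx.1, (hmem' ⟨α, hα⟩ x hx.1).1 hx.2⟩
      exact ⟨_, hc.toMulEquiv_mem_aut hPT, fun x hx => hc.autFun_toMulEquiv hx⟩)
    (fun α _ β _ β' _ e e' => mulAut_ext fun x hx => by rw [e x hx, e' x hx])
    (fun α _ α' _ β _ β' _ e e' x hx => by
      rw [autFun_mul _ _ hx, e' x hx, autFun_mul _ _ hx.1, ← e' x hx, e _ (autFun_mem _ hx)])
  have hresid : ∀ δ ∈ pResidual p (F.aut P hP.le), Factors E F P (autFun (δ : MulAut P)) := by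
    intro δ hδ
    have h1 := hres _ inf_le_right hPT ⟨_, mem_pResidual_of_hom hp r hδ, rfl⟩
    exact ⟨hmem δ hδ, id, id, _, .refl hTS, (mem_aut_iff_isMor _).1 h1,
      fun x hx => (hr δ x hx).symm⟩
  obtain ⟨δ, hδ, γ, hγ, e⟩ := hprod ⟨_, h.toMulEquiv_mem_aut hP.le⟩
  refine ((hconj _ hγ).comp hinv (hresid δ hδ) fun x hx => autFun_mem _ hx).congr fun x hx => ?_
  rw [Function.comp, ← autFun_mul _ _ hx, ← Subgroup.coe_mul, ← e, h.autFun_toMulEquiv hx]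

/-- For P = S the automorphism is its own factorization. For good P < S the Frattini argument gives
Aut_F(P) = O^{p'}(Aut_F(P)) N(Aut_S(P)): the first factor lies in E, and elements of the second
extend to N_S(P) > P, where the induction hypothesis applies. -/
theorem IsOUpperPPrime.factors (hp : p.Prime) (hG : IsPGroup p G) (hF : RSat p F)
    (hE : IsOUpperPPrime p F E) : ∀ P f, F.IsMor P f → Factors E F P f := by
  have hinv := hE.invariant hp hG
  obtain ⟨⟨-, hEF, hT, hres⟩, -⟩ := hE
  refine hF.factors hp hG hinv fun P f g hP h larger => ?_
  rcases hP.le.eq_or_lt with hPS | hPS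
  · rw [← hT] at hPS
    subst hPS
    exact ⟨fun x hx => iff_of_true hx (h.map x hx), f, g, id, h, .of_id inf_le_right,
      fun _ _ => rfl⟩
  have := (pPrimeResidual_spec (p := p) (F.aut P hP.le)).1
  have htop := pPrimeResidual_sup_normalizer_eq_top hp
    (H := (F.autConj P).subgroupOf (F.aut P hP.le)) hP.automized
    ((isPGroup_autConj hG F P).comap_of_injective _ (F.aut P hP.le).subtype_injective)
  have hα : (⟨_, h.toMulEquiv_mem_aut hP.le⟩ : F.aut P hP.le) ∈ pPrimeResidual p (F.aut P hP.le) ⊔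
      Subgroup.normalizer ((F.autConj P).subgroupOf (F.aut P hP.le) : Set (F.aut P hP.le)) := by
    rw [htop]
    trivial
  obtain ⟨δ, hδ, γ, hγ, e⟩ := Subgroup.mem_sup_of_normal_left.1 hα
  have hδF : Factors E F P (autFun (δ : MulAut P)) :=
    factors_of_isMor hEF ((mem_aut_iff_isMor _).1
      (hres P (hP.le.trans hT.ge) hP.le ⟨δ, hδ, rfl⟩))
  have hγF : Factors E F P (autFun (γ : MulAut P)) := by
    have hlt := lt_normalizer_inf hG hp hPS
    have hle : Subgroup.normalizer (P : Set G) ⊓ F.carrier ≤ F.extG P (autFun (γ : MulAut P)) := by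
      rintro n ⟨hn, hnS⟩
      obtain ⟨β, hβ, e⟩ := exists_autConj hnS hn
      -- As γ normalizes Aut_S(P), each γ c_n γ⁻¹ is again conjugation by an element of S; that is,
      -- N_γ contains N_S(P).
      have h1 := (Subgroup.mem_normalizer_iff.1 hγ ⟨β, autConj_le_aut hP.le hβ⟩).1 hβ
      obtain ⟨s, hs, e'⟩ := mem_autConj_iff.1 h1
      refine ⟨hnS, hn, s, hs, fun x hx => ?_⟩
      have h2 := e' _ (autFun_mem (γ : MulAut P) hx)
      change autFun ((γ : MulAut P) * β * (γ : MulAut P)⁻¹) _ = _ at h2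
      rw [← autFun_mul _ _ hx, inv_mul_cancel_right, autFun_mul _ _ hx, e x hx] at h2
      exact h2
    obtain ⟨k, hk, ek⟩ := hP.receptive _ _ _ (autFun_iso γ.2)
    exact ((larger _ _ hlt (hk.mono hle)).mono hlt.le).congr ek
  refine (hγF.comp hinv hδF fun x hx => autFun_mem _ hx).congr fun x hx => ?_
  rw [Function.comp, ← autFun_mul _ _ hx, ← Subgroup.coe_mul, e, h.autFun_toMulEquiv hx]

end Residual

/-! ### Induction along the sequence and conclusion -/

theorem isReduced_of_opCore_eq_bot {p : ℕ} {F : FusionSystem G} (hF : F.IsSaturated p)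
    (hcore : F.opCore = ⊥) (hP : IsOUpperP p F F) (hP' : IsOUpperPPrime p F F) :
    F.IsReduced p where
  saturated := hF
  normal_eq_bot _ hN := eq_bot_iff.2 (hN.le_opCore.trans hcore.le)
  -- Since O^p(F) = F, the hyperfocal subgroup is all of S. So a subsystem of p-power index lives
  -- over it, and minimality of F applies.
  pPower _ _ hE := le_antisymm hE.2.1
    (hP.2 ⟨hE, le_antisymm (hE.2.1.1.trans hP.1.2.le) hE.2.2.1⟩)
  primeToP _ _ hE := le_antisymm hE.2.1 (hP'.2 hE)

theorem isSaturated_and_opCore_eq_bot [Finite G] {p : ℕ} (hp : p.Prime) (hG : IsPGroup p G)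
    {E : ℕ → FusionSystem G} {m : ℕ} (h₀ : (E 0).IsSaturated p ∧ (E 0).opCore = ⊥)
    (hE : ∀ i < m, IsOUpperP p (E i) (E (i + 1)) ∨ IsOUpperPPrime p (E i) (E (i + 1))) :
    ∀ i ≤ m, (E i).IsSaturated p ∧ (E i).opCore = ⊥ := by
  intro i
  induction i with
  | zero => exact fun _ => h₀
  | succ i ih =>
    intro hi
    obtain ⟨hs, hc⟩ := ih (by omega)
    have hF := hs.rsat hp
    -- O_p of the next term is normal in the current one, whose O_p is trivial.
    have key : ∀ hle : E (i + 1) ≤ E i, Invariant (E (i + 1)) (E i) →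
        (∀ P f, (E i).IsMor P f → Factors (E (i + 1)) (E i) P f) → (E (i + 1)).opCore = ⊥ :=
      fun hle hinv hfac => eq_bot_iff.2
        ((hF.isNormal_opCore_of_factors hp hG hle hinv hfac).le_opCore.trans hc.le)
    rcases hE i (by omega) with h | h
    · exact ⟨h.1.1.1, key h.1.1.2.1 (h.invariant hp hG) (h.factors hp hG hF)⟩
    · exact ⟨h.1.1, key h.1.2.1 (h.invariant hp hG) (h.factors hp hG hF)⟩

end FusionSystem

theorem propositionp (p : ℕ) (hp : p.Prime) (S : Type*) [Group S] [Finite S]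
    (hS : IsPGroup p S) (F : FusionSystem S) (hF : F.IsSaturated p) :
    (∀ R : FusionSystem F.CoreQuotient, F.IsReduction p R → R.IsReduced p) ∧
    (∀ (m : ℕ) (E : ℕ → FusionSystem F.CoreQuotient), E 0 = F.coreQuotient →
      (∀ i < m, FusionSystem.IsOUpperP p (E i) (E (i + 1)) ∨
        FusionSystem.IsOUpperPPrime p (E i) (E (i + 1))) →
      ∀ i ≤ m, (E i).IsSaturated p ∧ (E i).opCore = ⊥) := by
  have hG : IsPGroup p F.CoreQuotient := (hS.to_subgroup _).to_quotient _
  have h₀ : F.coreQuotient.IsSaturated p ∧ F.coreQuotient.opCore = ⊥ :=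
    ⟨(FusionSystem.rsat_coreQuotient hp hS (hF.rsat hp)).isSaturated hp hG,
      FusionSystem.opCore_coreQuotient hp hS (hF.rsat hp)⟩
  refine ⟨?_, fun m E hE h => FusionSystem.isSaturated_and_opCore_eq_bot hp hG (hE ▸ h₀) h⟩
  rintro _ ⟨m, E, hE, h, h1, h2, rfl⟩
  -- An alternating sequence is a special case of an arbitrary one, by the parity of the index.
  obtain ⟨hs, hc⟩ := FusionSystem.isSaturated_and_opCore_eq_bot hp hG (hE ▸ h₀) (fun i hi =>
    (Nat.even_or_odd i).imp (h i hi).1 (h i hi).2) m le_rfl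
  exact FusionSystem.isReduced_of_opCore_eq_bot hs hc h1 h2
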